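/- **Setting.** A *process type* is a finite Petri net with edge weights at most $1$ and a single initial token, in which every transition has exactly one predecessor place ${}^\bullet t$ and one successor place $t^\bullet$ and is either *observable* or *internal*. Let $\mathbb{P}$ be a finite family of process types with pairwise disjoint sets of places and of transitions, with places $Q_{\mathbb{P}}$ and observable transitions $T^{obs}_{\mathbb{P}}$, and let $\Pi$ be a finite set of ports, each port $\pi$ having a process type $\mathrm{ptype}(\pi)\in\mathbb{P}$. A *system* over $\mathbb{P}$ is a finite loopless directed graph whose vertices are labeled with exactly one process type and at most one port (of that process type), and whose edges are labeled with pairs $(t,t')$ of observable transitions of the process types of their source and target. Its *sort* is the set of ports occurring in it. Its *behavior* is the Petri net with places $(q,v)$, $q$ a place of the process type of $v$, whose transitions are the edges $v\xrightarrow{(t,t')}v'$, with predecessors $({}^\bullet t,v),({}^\bullet t',v')$ and successors $(t^\bullet,v),(t'^\bullet,v')$, and the pairs $(t,v)$ with $t$ internal in the process type of $v$, with predecessor $({}^\bullet t,v)$ and successor $(t^\bullet,v)$; initially each vertex holds the initial token of its process type. *Ground VR-terms* are built from single vertices $\mathbf{1}_\pi$ (port $\pi$, process type $\mathrm{ptype}(\pi)$);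 edge creations $\mathrm{add}^{(t,t')}_{\pi,\pi'}$ with $\pi\ne\pi'$ and $t$, $t'$ observable transitions of $\mathrm{ptype}(\pi)$, $\mathrm{ptype}(\pi')$, which add a $(t,t')$-edge from every $\pi$-port to every $\pi'$-port; port redefinitions $\mathrm{relab}_\alpha$ by a type-preserving partial function $\alpha:\Pi\rightharpoonup\Pi$ (a port is erased where $\alpha$ is undefined); and disjoint unions $\oplus_{\mathbf{p}_1,\mathbf{p}_2}$ of arguments of sorts $\mathbf{p}_1,\mathbf{p}_2$. *Ground HR-terms*, over systems in which each port labels at most one vertex, are built from single vertices, single edges $\mathrm{edge}^{(t,t')}_{\pi,\pi'}$, $\pi\neq\pi'$ (two vertices with ports $\pi,\pi'$ and an edge from the first to the second), port redefinitions by injective $\alpha$, and the composition $\parallel$, which is the disjoint union followed by joining the vertices of the two arguments that carry the same port. $\mathrm{val}_{VR}$ and $\mathrm{val}_{HR}$ denote the values of terms; an empty composition is omitted. **Expanded process types.** For $\mathsf p\in\mathbb{P}$, the process type $\tfrac12\mathsf p$ has the places of $\mathsf p$ and a new place $\tfrac12 t$ for each observable $t$ of $\mathsf p$; it has the internal transitions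 of $\mathsf p$ and, for each observable $t$, observable transitions $\mathsf{try}_t:{}^\bullet t\to\tfrac12t$ and $\mathsf{commit}_t:\tfrac12t\to t^\bullet$; its initial marking is that of $\mathsf p$. For $t\in T^{obs}_{\mathbb{P}}$, the process type $\epsilon_t$ has places $\mathsf{idle}_t$ (initially marked), $\mathsf{active}_t,\mathsf{wait}_t,\mathsf{reply}_t$ and observable transitions $\mathsf{recv}:\mathsf{idle}_t\to\mathsf{active}_t$, $\mathsf{fwd}:\mathsf{active}_t\to\mathsf{wait}_t$, $\mathsf{ack}:\mathsf{wait}_t\to\mathsf{reply}_t$, $\mathsf{reset}:\mathsf{reply}_t\to\mathsf{idle}_t$, $t:\mathsf{active}_t\to\mathsf{reply}_t$. Let $\mathbb{P}^{e}=\{\tfrac12\mathsf p\mid\mathsf p\in\mathbb{P}\}\cup\{\epsilon_t\mid t\in T^{obs}_{\mathbb{P}}\}$. The ports are $\tfrac12\pi$, of type $\tfrac12\mathrm{ptype}(\pi)$, and $(\pi,t)$, $\overline{(\pi,t)}$, of type $\epsilon_t$, for $t$ an observable transition of $\mathrm{ptype}(\pi)$. **Translation.** Put $E^t(\pi,\pi')=\mathrm{edge}^{(\mathsf{fwd},\mathsf{recv})}_{(\pi,t),\overline{(\pi',t)}}\parallel\mathrm{edge}^{(\mathsf{reset},\mathsf{ack})}_{\overline{(\pi',t)},(\pi,t)}$,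 $\tfrac12E^t(\pi)=\mathrm{edge}^{(\mathsf{try}_t,\mathsf{recv})}_{\frac12\pi,(\pi,t)}\parallel\mathrm{edge}^{(\mathsf{reset},\mathsf{commit}_t)}_{(\pi,t),\frac12\pi}$, and let $\mathsf{enc}(\alpha)$ be the composition of all $E^t(\pi,\alpha(\pi))$ with $\pi\in\mathrm{dom}\,\alpha$ and $t$ observable in $\mathrm{ptype}(\pi)$. Let $\mathsf{obs}$ be the identity on the ports $(\pi,t)$, $\mathsf{fresh}$ the map $\overline{(\pi,t)}\mapsto(\pi,t)$, and, for sets of ports $\mathbf{p},\mathbf{p}'$, let $\mathsf{fresh}_{\mathbf{p},\mathbf{p}'}$ be the map $\overline{(\pi,t)}\mapsto(\pi,t)$ for $\pi\in\mathbf{p}\cap\mathbf{p}'$, $(\pi,t)\mapsto(\pi,t)$ for $\pi\in\mathbf{p}\setminus\mathbf{p}'$; all three are undefined elsewhere. Define $$\begin{aligned} \mathrm{expand}(\mathbf 1_\pi)&=\mathrm{relab}_{\mathsf{obs}}\big(\mathbf 1_{\frac12\pi}\parallel\textstyle\big\|_{t}\,\tfrac12E^t(\pi)\big)\quad(t\text{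 observable in }\mathrm{ptype}(\pi)),\\ \mathrm{expand}(\mathrm{add}^{(t,t')}_{\pi,\pi'}(\theta_1))&=\mathrm{edge}^{(t,t')}_{(\pi,t),(\pi',t')}\parallel\mathrm{expand}(\theta_1),\\ \mathrm{expand}(\mathrm{relab}_\alpha(\theta_1))&=\mathrm{relab}_{\mathsf{fresh}}\big(\mathrm{expand}(\theta_1)\parallel\mathsf{enc}(\alpha)\big),\\ \mathrm{expand}(\theta_1\oplus_{\mathbf p_1,\mathbf p_2}\theta_2)&=\mathrm{relab}_{\mathsf{fresh}_{\mathbf p_1,\mathbf p_2}}\big(\mathrm{expand}(\theta_1)\parallel\mathsf{enc}(\mathrm{id}_{\mathbf p_1\cap\mathbf p_2})\big)\parallel\mathrm{relab}_{\mathsf{fresh}_{\mathbf p_2,\mathbf p_1}}\big(\mathrm{expand}(\theta_2)\parallel\mathsf{enc}(\mathrm{id}_{\mathbf p_1\cap\mathbf p_2})\big). \end{aligned}$$ **Stuttering.** Let $\mathbb{X}$ be a countably infinite set of variables. A partial labeling $\mathsf L:Q_{\mathbb{P}}\rightharpoonup\mathbb{X}$ induces $\mathsf L^{e}:Q_{\mathbb{P}^{e}}\rightharpoonup\mathbb{X}$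 by $\mathsf L^{e}(q)=\mathsf L(q)$ for $q\in Q_{\mathbb{P}}$, $\mathsf L^{e}(\mathsf{active}_t)=\mathsf L({}^\bullet t)$, $\mathsf L^{e}(\mathsf{reply}_t)=\mathsf L(t^\bullet)$, undefined elsewhere. A marking $\mathsf m$ of a behavior satisfies a first-order arithmetic formula (over $\mathbb{N}$, with $+$, $\cdot$, constants, $=$, $\le$) if the formula holds when each free variable $x$ is given the value $\sum\mathsf m(q,v)$ over the places $(q,v)$ with label of $q$ equal to $x$. For a finite or infinite firing sequence $\rho$ from the initial marking, its *atom sequence* lists the sets of formulas satisfied by the successive markings, starting with the initial one. For $\mathsf S$ over $\mathbb{P}$ and $\mathsf S'$ over $\mathbb{P}^{e}$, a firing sequence $\rho'$ of the behavior of $\mathsf S'$ is a *stuttering* of a firing sequence $\rho$ of the behavior of $\mathsf S$ if there are integers $n_0,n_1,\dots\ge1$ such that the atom sequence of $\rho$ (with $\mathsf L$) is $A_0,A_1,\dots$ and that of $\rho'$ (with $\mathsf L^{e}$) is $A_0$ repeated $n_0$ times, then $A_1$ repeated $n_1$ times, and so on. Write $\mathsf S\trianglelefteq_{\mathsf L}\mathsf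 S'$ if every finite or infinite firing sequence of the behavior of $\mathsf S$ from its initial marking has a stuttering among those of the behavior of $\mathsf S'$, and every finite or infinite firing sequence of the behavior of $\mathsf S'$ from its initial marking is a stuttering of one of the behavior of $\mathsf S$. **Lemma.** For every ground VR-term $\theta$ over $\mathbb{P}$ and $\Pi$ and every partial labeling $\mathsf L:Q_{\mathbb{P}}\rightharpoonup\mathbb{X}$, $$\mathrm{val}_{VR}(\theta)\ \trianglelefteq_{\mathsf L}\ \mathrm{val}_{HR}(\mathrm{expand}(\theta)).$$ -/

import Mathlib

namespace VRHR

/-! ## Arithmetic formulas -/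

/-- The countably infinite set of variables. -/
abbrev Var : Type := ℕ

/-- Arithmetic terms over variables, constants, addition and multiplication. -/
inductive ArithTerm : Type
  | var (x : Var)
  | const (c : ℕ)
  | add (s t : ArithTerm)
  | mul (s t : ArithTerm)

/-- First-order arithmetic formulas. -/
inductive Formula : Type
  | eq (s t : ArithTerm)
  | le (s t : ArithTerm)
  | neg (a : Formula)
  | and (a b : Formula)
  | or (a b : Formula)
  | all (x : Var) (a : Formula)
  | ex (x : Var) (a : Formula)

def ArithTerm.eval (e : Var → ℕ) : ArithTerm → ℕ
  | .var x => e x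
  | .const c => c
  | .add s t => s.eval e + t.eval e
  | .mul s t => s.eval e * t.eval e

/-- Truth of a formula over the natural numbers in the environment `e`. -/
def Formula.Holds : Formula → (Var → ℕ) → Prop
  | .eq s t, e => s.eval e = t.eval e
  | .le s t, e => s.eval e ≤ t.eval e
  | .neg a, e => ¬ a.Holds e
  | .and a b, e => a.Holds e ∧ b.Holds e
  | .or a b, e => a.Holds e ∨ b.Holds e
  | .all x a, e => ∀ n : ℕ, a.Holds (Function.update e x n)
  | .ex x a, e => ∃ n : ℕ, a.Holds (Function.update e x n)

/-! ## Petri nets -/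

/-- A finite Petri net. `inW q t` is the weight of the edge from the place `q` to the transition
`t`, `outW t q` the weight of the edge from `t` to `q`. -/
structure PetriNet where
  Place : Type
  Trans : Type
  finPlace : Finite Place
  finTrans : Finite Trans
  inW : Place → Trans → ℕ
  outW : Trans → Place → ℕ
  init : Place → ℕ

attribute [instance] PetriNet.finPlace PetriNet.finTrans

namespace PetriNet

variable (N : PetriNet)

abbrev Marking : Type := N.Place → ℕ

def Enabled (m : N.Marking) (t : N.Trans) : Prop := ∀ q, N.inW q t ≤ m q

/-- The marking obtained from `m` by firing `t` (meaningful when `t` is enabled in `m`). -/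
def fire (m : N.Marking) (t : N.Trans) : N.Marking := fun q => m q - N.inW q t + N.outW t q

/-- The marking reached from the initial one after the first `i` transitions of the finite or
infinite sequence `ρ` (after all of them, if `ρ` has fewer than `i` elements). -/
def markingAfter (ρ : Stream'.Seq N.Trans) : ℕ → N.Marking
  | 0 => N.init
  | i + 1 =>
    match ρ.get? i with
    | some t => N.fire (markingAfter ρ i) t
    | none => markingAfter ρ i

/-- The finite or infinite firing sequences that start in the initial marking. -/
def paths : Set (Stream'.Seq N.Trans) :=
  {ρ | ∀ i t, ρ.get? i = some t → N.Enabled (N.markingAfter ρ i) t}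

open Classical in
/-- The value of the variable `x`: the number of tokens on the places labeled by `x`. -/
noncomputable def varValue (lab : N.Place → Option Var) (m : N.Marking) (x : Var) : ℕ :=
  ∑ᶠ q : N.Place, if lab q = some x then m q else 0

/-- The set of arithmetic formulas satisfied by a marking. -/
def atoms (lab : N.Place → Option Var) (m : N.Marking) : Set Formula :=
  {a | a.Holds (N.varValue lab m)}

/-- The sequence of the sets of formulas satisfied by the successive markings along `ρ`; it has
one element more than `ρ`. -/
def atomsSeq (lab : N.Place → Option Var) (ρ : Stream'.Seq N.Trans) : Stream'.Seq (Set Formula) :=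
  ⟨fun i =>
    match i with
    | 0 => some (N.atoms lab N.init)
    | j + 1 => (ρ.get? j).map fun _ => N.atoms lab (N.markingAfter ρ (j + 1)), by
    intro i h
    cases i with
    | zero => cases h
    | succ j =>
      have h1 : ρ.get? j = none := by
        change (ρ.get? j).map _ = none at h
        simpa using h
      have h2 : ρ.get? (j + 1) = none := ρ.2 h1
      change (ρ.get? (j + 1)).map _ = none
      rw [h2]; rfl⟩

end PetriNet

/-- `B` is the sequence `A 0, …, A 0, A 1, …, A 1, …`, where each element `A i` is repeated
`n i ≥ 1` times. -/
def IsStretch {α : Type} (A : Stream'.Seq α) (n : ℕ → ℕ) (B : Stream'.Seq α) : Prop :=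
  (∀ i, 1 ≤ n i) ∧
    ∀ i k, k < n i → B.get? ((∑ j ∈ Finset.range i, n j) + k) = A.get? i

/-! ## Process types -/

/-- A process type: a Petri net with weights at most one and one initial token, each transition
of which has exactly one predecessor and one successor and is either observable or internal. -/
structure ProcessType extends PetriNet where
  obs : Trans → Prop
  inW_le : ∀ q t, inW q t ≤ 1
  outW_le : ∀ t q, outW t q ≤ 1
  existsUnique_pre : ∀ t, ∃! q, 0 < inW q t
  existsUnique_post : ∀ t, ∃! q, 0 < outW t q
  exists_init : ∃ q, init q = 1 ∧ ∀ q', q' ≠ q → init q' = 0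

namespace ProcessType

/-- Observable transitions. -/
abbrev Obs (p : ProcessType) : Type := {t : p.Trans // p.obs t}

/-- Internal transitions. -/
abbrev Internal (p : ProcessType) : Type := {t : p.Trans // ¬ p.obs t}

/-- The unique predecessor of a transition. -/
noncomputable def pre (p : ProcessType) (t : p.Trans) : p.Place :=
  (p.existsUnique_pre t).choose

/-- The unique successor of a transition. -/
noncomputable def post (p : ProcessType) (t : p.Trans) : p.Place :=
  (p.existsUnique_post t).choose

/-- Places of the process type `p` split in two halves. -/
inductive HalfPlace (p : ProcessType) : Type
  | orig (q : p.Place)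
  | mid (t : p.Obs)

/-- Transitions of the process type `p` split in two halves. -/
inductive HalfTrans (p : ProcessType) : Type
  | internal (t : p.Internal)
  | attempt (t : p.Obs)
  | commit (t : p.Obs)

instance (p : ProcessType) : Finite p.HalfPlace :=
  Finite.of_injective
    (fun x : p.HalfPlace => match x with
      | .orig q => (Sum.inl q : p.Place ⊕ p.Obs)
      | .mid t => Sum.inr t)
    (by rintro (_ | _) (_ | _) h <;> simp_all)

instance (p : ProcessType) : Finite p.HalfTrans :=
  Finite.of_injective
    (fun x : p.HalfTrans => match x with
      | .internal t => (Sum.inl t : p.Internal ⊕ p.Obs ⊕ p.Obs)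
      | .attempt t => Sum.inr (Sum.inl t)
      | .commit t => Sum.inr (Sum.inr t))
    (by rintro (_ | _ | _) (_ | _ | _) h <;> simp_all)

open Classical in
/-- The process type in which each observable transition `t : q → q'` of `p` is split into an
observable `attempt t : q → mid t` and an observable `commit t : mid t → q'`. -/
noncomputable def half (p : ProcessType) : ProcessType where
  Place := p.HalfPlace
  Trans := p.HalfTrans
  finPlace := inferInstance
  finTrans := inferInstance
  inW
    | .orig q, .internal t => p.inW q t
    | .orig q, .attempt t => p.inW q t
    | .mid s, .commit t => if s = t then 1 else 0
    | _, _ => 0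
  outW
    | .internal t, .orig q => p.outW t q
    | .attempt t, .mid s => if s = t then 1 else 0
    | .commit t, .orig q => p.outW t q
    | _, _ => 0
  init
    | .orig q => p.init q
    | .mid _ => 0
  obs
    | .internal _ => False
    | .attempt _ => True
    | .commit _ => True
  inW_le := by
    rintro (q | s) (t | t | t) <;> dsimp only <;>
      first | exact p.inW_le _ _ | omega | (split <;> omega)
  outW_le := by
    rintro (t | t | t) (q | s) <;> dsimp only <;>
      first | exact p.outW_le _ _ | omega | (split <;> omega)
  existsUnique_pre := by
    rintro (t | t | t)
    · obtain ⟨q, hq, hu⟩ := p.existsUnique_pre t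
      refine ⟨.orig q, hq, ?_⟩
      rintro (q' | s) h
      · exact congrArg _ (hu q' h)
      · exact absurd h (lt_irrefl 0)
    · obtain ⟨q, hq, hu⟩ := p.existsUnique_pre t
      refine ⟨.orig q, hq, ?_⟩
      rintro (q' | s) h
      · exact congrArg _ (hu q' h)
      · exact absurd h (lt_irrefl 0)
    · refine ⟨.mid t, by simp, ?_⟩
      rintro (q' | s) h
      · exact absurd h (lt_irrefl 0)
      · by_cases hs : s = t
        · rw [hs]
        · simp [hs] at h
  existsUnique_post := by
    rintro (t | t | t)
    · obtain ⟨q, hq, hu⟩ := p.existsUnique_post t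
      refine ⟨.orig q, hq, ?_⟩
      rintro (q' | s) h
      · exact congrArg _ (hu q' h)
      · exact absurd h (lt_irrefl 0)
    · refine ⟨.mid t, by simp, ?_⟩
      rintro (q' | s) h
      · exact absurd h (lt_irrefl 0)
      · by_cases hs : s = t
        · rw [hs]
        · simp [hs] at h
    · obtain ⟨q, hq, hu⟩ := p.existsUnique_post t
      refine ⟨.orig q, hq, ?_⟩
      rintro (q' | s) h
      · exact congrArg _ (hu q' h)
      · exact absurd h (lt_irrefl 0)
  exists_init := by
    obtain ⟨q, hq, hu⟩ := p.exists_init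
    refine ⟨.orig q, hq, ?_⟩
    rintro (q' | s) h
    · exact hu q' fun e => h (congrArg _ e)
    · rfl

end ProcessType

inductive RouterPlace : Type
  | idle | active | wait | reply
  deriving DecidableEq

instance : Fintype RouterPlace :=
  ⟨{.idle, .active, .wait, .reply}, by rintro (_ | _ | _ | _) <;> decide⟩

inductive RouterTrans : Type
  | recv | fwd | ack | reset | exec
  deriving DecidableEq

instance : Fintype RouterTrans :=
  ⟨{.recv, .fwd, .ack, .reset, .exec}, by rintro (_ | _ | _ | _ | _) <;> decide⟩

def RouterTrans.src : RouterTrans → RouterPlace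
  | .recv => .idle
  | .fwd => .active
  | .ack => .wait
  | .reset => .reply
  | .exec => .active

def RouterTrans.tgt : RouterTrans → RouterPlace
  | .recv => .active
  | .fwd => .wait
  | .ack => .reply
  | .reset => .idle
  | .exec => .reply

/-- The process type of a routing node. All transitions are observable; in the copy that
belongs to an observable transition `t`, the transition `exec` plays the role of `t`. -/
def router : ProcessType where
  Place := RouterPlace
  Trans := RouterTrans
  finPlace := inferInstance
  finTrans := inferInstance
  inW q t := if q = t.src then 1 else 0
  outW t q := if q = t.tgt then 1 else 0
  init q := if q = .idle then 1 else 0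
  obs _ := True
  inW_le := by intro q t; split <;> omega
  outW_le := by intro t q; split <;> omega
  existsUnique_pre t := ⟨t.src, by simp, fun q h => by
    by_contra hq
    simp [hq] at h⟩
  existsUnique_post t := ⟨t.tgt, by simp, fun q h => by
    by_contra hq
    simp [hq] at h⟩
  exists_init := ⟨.idle, by simp, fun q h => by simp [h]⟩

/-! ## Systems -/

/-- The places of a family of process types, as a disjoint union. -/
abbrev PlaceOf {ι : Type} (P : ι → ProcessType) : Type := Σ p : ι, (P p).Place

/-- The transitions of a family of process types, as a disjoint union. -/
abbrev TransOf {ι : Type} (P : ι → ProcessType) : Type := Σ p : ι, (P p).Trans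

/-- The observable transitions of a family of process types, as a disjoint union. -/
abbrev ObsOf {ι : Type} (P : ι → ProcessType) : Type := Σ p : ι, (P p).Obs

section Family

variable {ι : Type} (P : ι → ProcessType)

def ObsOf.toTrans {ι : Type} {P : ι → ProcessType} (t : ObsOf P) : TransOf P := ⟨t.1, t.2.1⟩

open Classical in
/-- Weights of the disjoint union of the process types. -/
noncomputable def inWeight (q : PlaceOf P) (t : TransOf P) : ℕ :=
  if h : q.1 = t.1 then (P t.1).inW (h ▸ q.2) t.2 else 0

open Classical in
/-- Weights of the disjoint union of the process types. -/
noncomputable def outWeight (t : TransOf P) (q : PlaceOf P) : ℕ :=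
  if h : q.1 = t.1 then (P t.1).outW t.2 (h ▸ q.2) else 0

variable {Port : Type} (ptype : Port → ι)

/-- A system: a finite loopless directed graph in which each vertex `v` is labeled with exactly
one process type `proc v` and at most one port `port v`, whose process type is that of `v`, and
each edge is labeled with a pair of observable transitions of the process types of its ends.
`edge v t t' w` says that there is an edge from `v` to `w` with label `(t, t')`. -/
structure System where
  V : Type
  finV : Finite V
  proc : V → ι
  port : V → Option Port
  edge : V → ObsOf P → ObsOf P → V → Prop
  port_type : ∀ v π, port v = some π → ptype π = proc v
  edge_src : ∀ v t t' w, edge v t t' w → t.1 = proc v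
  edge_tgt : ∀ v t t' w, edge v t t' w → t'.1 = proc w
  loopless : ∀ v t t', ¬ edge v t t' v

attribute [instance] System.finV

/-- A system in which each port labels at most one vertex. -/
structure HRSystem extends System P ptype where
  port_unique : ∀ v w π, port v = some π → port w = some π → v = w

/-- A type-preserving partial function on ports. -/
structure PortMap where
  toFun : Port → Option Port
  type_eq : ∀ π π', toFun π = some π' → ptype π' = ptype π

/-- Injectivity on the domain of definition. -/
def PortMap.Injective {ptype : Port → ι} (α : PortMap ptype) : Prop :=
  ∀ π₁ π₂ π', α.toFun π₁ = some π' → α.toFun π₂ = some π' → π₁ = π₂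

end Family

namespace System

variable {ι : Type} {P : ι → ProcessType} {Port : Type} {ptype : Port → ι}

/-- The ports that occur in a system. -/
def sort (S : System P ptype) : Set Port := {π | ∃ v, S.port v = some π}

open Classical in
/-- The behavior of a system. Its places are the pairs `(q, v)` with `q` a place of the process
type of `v`; its transitions are the edges of the system and the pairs `(t, v)` with `t` an
internal transition of the process type of `v`. -/
noncomputable def behavior [Finite ι] (S : System P ptype) : PetriNet where
  Place := {x : PlaceOf P × S.V // x.1.1 = S.proc x.2}
  Trans := {e : S.V × ObsOf P × ObsOf P × S.V // S.edge e.1 e.2.1 e.2.2.1 e.2.2.2} ⊕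
    {x : TransOf P × S.V // x.1.1 = S.proc x.2 ∧ ¬ (P x.1.1).obs x.1.2}
  finPlace := inferInstance
  finTrans := inferInstance
  inW
    | ⟨(q, u), _⟩, .inl ⟨(v, t, t', w), _⟩ =>
      (if u = v then inWeight P q t.toTrans else 0) +
        (if u = w then inWeight P q t'.toTrans else 0)
    | ⟨(q, u), _⟩, .inr ⟨(t, v), _⟩ => if u = v then inWeight P q t else 0
  outW
    | .inl ⟨(v, t, t', w), _⟩, ⟨(q, u), _⟩ =>
      (if u = v then outWeight P t.toTrans q else 0) +
        (if u = w then outWeight P t'.toTrans q else 0)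
    | .inr ⟨(t, v), _⟩, ⟨(q, u), _⟩ => if u = v then outWeight P t q else 0
  init x := (P x.1.1.1).init x.1.1.2

/-- The labeling of the places of the behavior induced by a labeling of the places of the
process types. -/
def liftLabeling [Finite ι] (S : System P ptype) (L : PlaceOf P → Option Var) :
    S.behavior.Place → Option Var :=
  fun x => L x.1.1

/-! ### Operations on systems -/

/-- The single-vertex system with port `π`. -/
def single (P : ι → ProcessType) (ptype : Port → ι) (π : Port) : System P ptype where
  V := Unit
  finV := inferInstance
  proc _ := ptype π
  port _ := some π
  edge _ _ _ _ := False
  port_type := by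
    rintro _ _ ⟨⟩
    rfl
  edge_src _ _ _ _ h := h.elim
  edge_tgt _ _ _ _ h := h.elim
  loopless _ _ _ h := h

/-- Adds a `(t, t')`-edge from each `π`-port to each `π'`-port. -/
def addEdge (S : System P ptype) (π π' : Port) (hne : π ≠ π') (t : (P (ptype π)).Obs)
    (t' : (P (ptype π')).Obs) : System P ptype where
  V := S.V
  finV := S.finV
  proc := S.proc
  port := S.port
  edge v s s' w := S.edge v s s' w ∨
    (S.port v = some π ∧ S.port w = some π' ∧ s = ⟨ptype π, t⟩ ∧ s' = ⟨ptype π', t'⟩)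
  port_type := S.port_type
  edge_src := by
    rintro v s s' w (h | ⟨h, _, rfl, _⟩)
    · exact S.edge_src v s s' w h
    · exact S.port_type v π h
  edge_tgt := by
    rintro v s s' w (h | ⟨_, h, _, rfl⟩)
    · exact S.edge_tgt v s s' w h
    · exact S.port_type w π' h
  loopless := by
    rintro v s s' (h | ⟨h, h', _, _⟩)
    · exact S.loopless v s s' h
    · exact hne (Option.some.inj (h.symm.trans h'))

/-- Redefinition of ports: the port `π` becomes `α π`, or is erased if `α π` is undefined. -/
def rename (S : System P ptype) (α : PortMap ptype) : System P ptype where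
  V := S.V
  finV := S.finV
  proc := S.proc
  port v := (S.port v).bind α.toFun
  edge := S.edge
  port_type := by
    intro v π h
    obtain ⟨π₀, h₀, h₁⟩ := Option.bind_eq_some_iff.1 h
    rw [α.type_eq π₀ π h₁]
    exact S.port_type v π₀ h₀
  edge_src := S.edge_src
  edge_tgt := S.edge_tgt
  loopless := S.loopless

/-- Edges of the disjoint union. -/
def sumEdge (S₁ S₂ : System P ptype) : S₁.V ⊕ S₂.V → ObsOf P → ObsOf P → S₁.V ⊕ S₂.V → Prop
  | .inl v, t, t', .inl w => S₁.edge v t t' w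
  | .inr v, t, t', .inr w => S₂.edge v t t' w
  | _, _, _, _ => False

/-- Disjoint union. -/
def disjUnion (S₁ S₂ : System P ptype) : System P ptype where
  V := S₁.V ⊕ S₂.V
  finV := inferInstance
  proc := Sum.elim S₁.proc S₂.proc
  port := Sum.elim S₁.port S₂.port
  edge := sumEdge S₁ S₂
  port_type := by
    rintro (v | v) π h
    · exact S₁.port_type v π h
    · exact S₂.port_type v π h
  edge_src := by
    rintro (v | v) t t' (w | w) h
    · exact S₁.edge_src v t t' w h
    · exact h.elim
    · exact h.elim
    · exact S₂.edge_src v t t' w h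
  edge_tgt := by
    rintro (v | v) t t' (w | w) h
    · exact S₁.edge_tgt v t t' w h
    · exact h.elim
    · exact h.elim
    · exact S₂.edge_tgt v t t' w h
  loopless := by
    rintro (v | v) t t' h
    · exact S₁.loopless v t t' h
    · exact S₂.loopless v t t' h

end System

namespace HRSystem

variable {ι : Type} {P : ι → ProcessType} {Port : Type} {ptype : Port → ι}

/-- The single-vertex system with port `π`. -/
def single (P : ι → ProcessType) (ptype : Port → ι) (π : Port) : HRSystem P ptype where
  toSystem := System.single P ptype π
  port_unique _ _ _ _ _ := rfl

/-- The single-edge system: two vertices with ports `π` and `π'` and a `(t, t')`-edge from the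
first to the second. -/
def singleEdge (π π' : Port) (hne : π ≠ π') (t : (P (ptype π)).Obs) (t' : (P (ptype π')).Obs) :
    HRSystem P ptype where
  V := Bool
  finV := inferInstance
  proc v := cond v (ptype π') (ptype π)
  port v := some (cond v π' π)
  edge v s s' w := v = false ∧ w = true ∧ s = ⟨ptype π, t⟩ ∧ s' = ⟨ptype π', t'⟩
  port_type := by
    rintro (_ | _) π₀ h <;> cases h <;> rfl
  edge_src := by
    rintro v s s' w ⟨rfl, _, rfl, _⟩
    rfl
  edge_tgt := by
    rintro v s s' w ⟨_, rfl, _, rfl⟩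
    rfl
  loopless := by
    rintro v s s' ⟨rfl, h, _⟩
    cases h
  port_unique := by
    rintro (_ | _) (_ | _) π₀ h h'
    · rfl
    · exact absurd (Option.some.inj (h.trans h'.symm)) hne
    · exact absurd (Option.some.inj (h.trans h'.symm)) hne.symm
    · rfl

/-- Redefinition of ports by an injective partial function. -/
def rename (S : HRSystem P ptype) (α : PortMap ptype) (hα : α.Injective) : HRSystem P ptype where
  toSystem := S.toSystem.rename α
  port_unique := by
    intro v w π hv hw
    obtain ⟨π₁, h₁, h₁'⟩ := Option.bind_eq_some_iff.1 hv
    obtain ⟨π₂, h₂, h₂'⟩ := Option.bind_eq_some_iff.1 hw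
    obtain rfl := hα π₁ π₂ π h₁' h₂'
    exact S.port_unique v w π₁ h₁ h₂

/-- Two vertices of the disjoint union are identified by the composition when they are equal, or
belong to different arguments and carry the same port. -/
def Joined (S₁ S₂ : HRSystem P ptype) : S₁.V ⊕ S₂.V → S₁.V ⊕ S₂.V → Prop
  | .inl v, .inl w => v = w
  | .inr v, .inr w => v = w
  | .inl v, .inr w => ∃ π, S₁.port v = some π ∧ S₂.port w = some π
  | .inr w, .inl v => ∃ π, S₁.port v = some π ∧ S₂.port w = some π

theorem Joined.symm {S₁ S₂ : HRSystem P ptype} :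
    ∀ {x y : S₁.V ⊕ S₂.V}, Joined S₁ S₂ x y → Joined S₁ S₂ y x
  | .inl _, .inl _, h => Eq.symm h
  | .inr _, .inr _, h => Eq.symm h
  | .inl _, .inr _, h => h
  | .inr _, .inl _, h => h

theorem Joined.trans {S₁ S₂ : HRSystem P ptype} {x y z : S₁.V ⊕ S₂.V}
    (h : Joined S₁ S₂ x y) (h' : Joined S₁ S₂ y z) : Joined S₁ S₂ x z := by
  rcases x with x | x <;> rcases y with y | y <;> rcases z with z | z
  · exact Eq.trans h h'
  · obtain rfl : x = y := h
    exact h'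
  · obtain ⟨π, h₁, h₂⟩ := h
    obtain ⟨π', h₁', h₂'⟩ := h'
    obtain rfl : π = π' := Option.some.inj (h₂.symm.trans h₂')
    exact S₁.port_unique _ _ π h₁ h₁'
  · obtain rfl : y = z := h'
    exact h
  · obtain rfl : y = z := h'
    exact h
  · obtain ⟨π, h₁, h₂⟩ := h
    obtain ⟨π', h₁', h₂'⟩ := h'
    obtain rfl : π = π' := Option.some.inj (h₁.symm.trans h₁')
    exact S₂.port_unique _ _ π h₂ h₂'
  · obtain rfl : x = y := h
    exact h'
  · exact Eq.trans h h'

/-- The identification of vertices in the composition. -/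
def joinSetoid (S₁ S₂ : HRSystem P ptype) : Setoid (S₁.V ⊕ S₂.V) where
  r := Joined S₁ S₂
  iseqv := ⟨by rintro (x | x) <;> exact rfl, Joined.symm, Joined.trans⟩

theorem Joined.proc_eq {S₁ S₂ : HRSystem P ptype} {x y : S₁.V ⊕ S₂.V}
    (h : Joined S₁ S₂ x y) :
    Sum.elim S₁.proc S₂.proc x = Sum.elim S₁.proc S₂.proc y := by
  rcases x with x | x <;> rcases y with y | y
  · exact congrArg S₁.proc h
  · obtain ⟨π, h₁, h₂⟩ := h
    exact (S₁.port_type x π h₁).symm.trans (S₂.port_type y π h₂)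
  · obtain ⟨π, h₁, h₂⟩ := h
    exact (S₂.port_type x π h₂).symm.trans (S₁.port_type y π h₁)
  · exact congrArg S₂.proc h

theorem Joined.port_eq {S₁ S₂ : HRSystem P ptype} {x y : S₁.V ⊕ S₂.V}
    (h : Joined S₁ S₂ x y) :
    Sum.elim S₁.port S₂.port x = Sum.elim S₁.port S₂.port y := by
  rcases x with x | x <;> rcases y with y | y
  · exact congrArg S₁.port h
  · obtain ⟨π, h₁, h₂⟩ := h
    exact h₁.trans h₂.symm
  · obtain ⟨π, h₁, h₂⟩ := h
    exact h₂.trans h₁.symm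
  · exact congrArg S₂.port h

/-- Composition: the disjoint union, in which each vertex of the first argument is joined with
the vertex of the second argument that carries the same port. Joined vertices have the same
port and hence the same process type, so the union of their labels is their common label. -/
def comp (S₁ S₂ : HRSystem P ptype) : HRSystem P ptype where
  V := Quotient (joinSetoid S₁ S₂)
  finV := inferInstance
  proc := Quotient.lift (Sum.elim S₁.proc S₂.proc) fun _ _ h => Joined.proc_eq h
  port := Quotient.lift (Sum.elim S₁.port S₂.port) fun _ _ h => Joined.port_eq h
  edge c t t' d := ∃ x y, Quotient.mk (joinSetoid S₁ S₂) x = c ∧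
    Quotient.mk (joinSetoid S₁ S₂) y = d ∧
    System.sumEdge S₁.toSystem S₂.toSystem x t t' y
  port_type := by
    rintro ⟨v | v⟩ π h
    · exact S₁.port_type v π h
    · exact S₂.port_type v π h
  edge_src := by
    rintro _ t t' _ ⟨v | v, w | w, rfl, rfl, h⟩
    · exact S₁.edge_src v t t' w h
    · exact h.elim
    · exact h.elim
    · exact S₂.edge_src v t t' w h
  edge_tgt := by
    rintro _ t t' _ ⟨v | v, w | w, rfl, rfl, h⟩
    · exact S₁.edge_tgt v t t' w h
    · exact h.elim
    · exact h.elim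
    · exact S₂.edge_tgt v t t' w h
  loopless := by
    rintro _ t t' ⟨v | v, w | w, rfl, hw, h⟩
    · obtain rfl : w = v := Quotient.exact hw
      exact S₁.loopless w t t' h
    · exact h.elim
    · exact h.elim
    · obtain rfl : w = v := Quotient.exact hw
      exact S₂.loopless w t t' h
  port_unique := by
    rintro ⟨v | v⟩ ⟨w | w⟩ π hv hw
    · exact congrArg _ (congrArg _ (S₁.port_unique v w π hv hw))
    · exact Quotient.sound (s := joinSetoid S₁ S₂) ⟨π, hv, hw⟩
    · exact Quotient.sound (s := joinSetoid S₁ S₂) ⟨π, hw, hv⟩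
    · exact congrArg _ (congrArg _ (S₂.port_unique v w π hv hw))

end HRSystem

/-! ## Terms -/

section Terms

variable {ι : Type} (P : ι → ProcessType) {Port : Type} (ptype : Port → ι)

/-- Ground VR-terms. The sorts that annotate a disjoint union are those of its arguments. -/
inductive VRTerm : Type
  | single (π : Port)
  | addEdge (π π' : Port) (hne : π ≠ π') (t : (P (ptype π)).Obs) (t' : (P (ptype π')).Obs)
      (θ : VRTerm)
  | rename (α : PortMap ptype) (θ : VRTerm)
  | disjUnion (θ₁ θ₂ : VRTerm)

/-- Ground HR-terms. -/
inductive HRTerm : Type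
  | single (π : Port)
  | edge (π π' : Port) (hne : π ≠ π') (t : (P (ptype π)).Obs) (t' : (P (ptype π')).Obs)
  | rename (α : PortMap ptype) (hα : α.Injective) (θ : HRTerm)
  | comp (θ₁ θ₂ : HRTerm)

variable {P ptype}

/-- The value of a VR-term. -/
def VRTerm.val : VRTerm P ptype → System P ptype
  | .single π => System.single P ptype π
  | .addEdge π π' hne t t' θ => θ.val.addEdge π π' hne t t'
  | .rename α θ => θ.val.rename α
  | .disjUnion θ₁ θ₂ => θ₁.val.disjUnion θ₂.val

/-- The value of an HR-term. -/
def HRTerm.val : HRTerm P ptype → HRSystem P ptype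
  | .single π => HRSystem.single P ptype π
  | .edge π π' hne t t' => HRSystem.singleEdge π π' hne t t'
  | .rename α hα θ => θ.val.rename α hα
  | .comp θ₁ θ₂ => θ₁.val.comp θ₂.val

/-- `θ ∥ E₁ ∥ ⋯ ∥ Eₙ` (just `θ` if the list is empty). -/
def HRTerm.compList (θ : HRTerm P ptype) (l : List (HRTerm P ptype)) : HRTerm P ptype :=
  l.foldl HRTerm.comp θ

end Terms

/-- The elements of a finite type, each listed once. -/
noncomputable def enumerate (α : Type) [Finite α] : List α :=
  (@Finset.univ α (Fintype.ofFinite α)).toList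

/-! ## The translation -/

section Expand

variable {ι : Type} (P : ι → ProcessType)

/-- The expanded process types: `half p` for each process type `p` and a routing process type
for each observable transition. -/
noncomputable def expTypes : ι ⊕ ObsOf P → ProcessType
  | .inl p => (P p).half
  | .inr _ => router

variable {P}

/-- The place labeling of the expanded process types induced by `L`. -/
noncomputable def expLabeling (L : PlaceOf P → Option Var) : PlaceOf (expTypes P) → Option Var
  | ⟨.inl p, .orig q⟩ => L ⟨p, q⟩
  | ⟨.inl _, .mid _⟩ => none
  | ⟨.inr t, .active⟩ => L ⟨t.1, (P t.1).pre t.2.1⟩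
  | ⟨.inr t, .reply⟩ => L ⟨t.1, (P t.1).post t.2.1⟩
  | ⟨.inr _, .idle⟩ => none
  | ⟨.inr _, .wait⟩ => none

variable {Port : Type} (ptype : Port → ι)

variable (P) in
/-- The expanded ports: `half π`, and, for each observable transition `t` of the process type
of `π`, the port `root π t` and its copy `back π t`. -/
inductive ExpPort : Type
  | half (π : Port)
  | root (π : Port) (t : ObsOf P) (ht : t.1 = ptype π)
  | back (π : Port) (t : ObsOf P) (ht : t.1 = ptype π)

/-- The process types of the expanded ports. -/
def expPtype : ExpPort P ptype → ι ⊕ ObsOf P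
  | .half π => .inl (ptype π)
  | .root _ t _ => .inr t
  | .back _ t _ => .inr t

variable (P) in
/-- HR-terms over the expanded process types and ports. -/
abbrev ExpTerm : Type := HRTerm (expTypes P) (expPtype (P := P) ptype)

variable (P) in
/-- Keeps the ports `root π t` and forgets all others. -/
def obsMap : PortMap (expPtype (P := P) ptype) where
  toFun
    | .root π t ht => some (.root π t ht)
    | _ => none
  type_eq := by rintro (_ | _ | _) _ h <;> cases h; rfl

theorem obsMap_injective : (obsMap P ptype).Injective := by
  rintro (_ | _ | _) (_ | _ | _) _ h h' <;> cases h <;> cases h'; rfl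

variable (P) in
/-- Replaces `back π t` by `root π t` and forgets all other ports. -/
def freshMap : PortMap (expPtype (P := P) ptype) where
  toFun
    | .back π t ht => some (.root π t ht)
    | _ => none
  type_eq := by rintro (_ | _ | _) _ h <;> cases h; rfl

theorem freshMap_injective : (freshMap P ptype).Injective := by
  rintro (_ | _ | _) (_ | _ | _) _ h h' <;> cases h <;> cases h'; rfl

open Classical in
variable (P) in
/-- The renaming applied to the argument of sort `s₁` in a disjoint union whose other argument
has sort `s₂`: it replaces `back π t` by `root π t` for `π ∈ s₁ ∩ s₂`, keeps `root π t` for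
`π ∈ s₁ \ s₂`, and forgets all other ports. -/
noncomputable def unionMap (s₁ s₂ : Set Port) : PortMap (expPtype (P := P) ptype) where
  toFun
    | .half _ => none
    | .root π t ht => if π ∈ s₁ \ s₂ then some (.root π t ht) else none
    | .back π t ht => if π ∈ s₁ ∩ s₂ then some (.root π t ht) else none
  type_eq := by
    rintro (_ | _ | _) _ h <;> dsimp only at h <;> first | cases h | skip
    all_goals
      split at h
      · cases h; rfl
      · cases h

theorem unionMap_injective (s₁ s₂ : Set Port) : (unionMap P ptype s₁ s₂).Injective := by
  rintro (_ | _ | _) (_ | _ | _) _ h h' <;> dsimp only [unionMap] at h h' <;>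
    first
    | cases h
    | cases h'
    | (split at h
       · split at h'
         · cases h
           first
           | (cases h'; rfl)
           | (cases h'; simp_all)
         · cases h'
       · cases h)

variable {ptype}

/-- The edges `root π t → back π' t` with label `(fwd, recv)` and `back π' t → root π t` with
label `(reset, ack)`. -/
noncomputable def linkTerm (t : ObsOf P) (π π' : Port) (h : t.1 = ptype π) (h' : t.1 = ptype π') :
    ExpTerm P ptype :=
  .comp
    (.edge (.root π t h) (.back π' t h') (by simp)
      ⟨RouterTrans.fwd, trivial⟩ ⟨RouterTrans.recv, trivial⟩)
    (.edge (.back π' t h') (.root π t h) (by simp)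
      ⟨RouterTrans.reset, trivial⟩ ⟨RouterTrans.ack, trivial⟩)

/-- The edges `half π → root π t` with label `(attempt t, recv)` and `root π t → half π` with
label `(reset, commit t)`. -/
noncomputable def halfLinkTerm (π : Port) (t : (P (ptype π)).Obs) : ExpTerm P ptype :=
  .comp
    (.edge (.half π) (.root π ⟨ptype π, t⟩ rfl) (by simp)
      ⟨ProcessType.HalfTrans.attempt t, trivial⟩ ⟨RouterTrans.recv, trivial⟩)
    (.edge (.root π ⟨ptype π, t⟩ rfl) (.half π) (by simp)
      ⟨RouterTrans.reset, trivial⟩ ⟨ProcessType.HalfTrans.commit t, trivial⟩)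

/-- The terms `linkTerm t π (α π)`, for all `π` in the domain of `α` and all observable
transitions `t` of the process type of `π`. -/
noncomputable def encList [Finite Port] (α : PortMap ptype) : List (ExpTerm P ptype) :=
  (enumerate (Σ x : {x : Port × Port // α.toFun x.1 = some x.2}, (P (ptype x.1.1)).Obs)).map
    fun y => linkTerm ⟨ptype y.1.1.1, y.2⟩ y.1.1.1 y.1.1.2 rfl
      (α.type_eq y.1.1.1 y.1.1.2 y.1.2).symm

open Classical in
variable (ptype) in
/-- The identity on a set of ports, undefined elsewhere. -/
noncomputable def idOn (s : Set Port) : PortMap ptype where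
  toFun π := if π ∈ s then some π else none
  type_eq := by
    intro π π' h
    split at h
    · cases h; rfl
    · cases h

/-- The translation of VR-terms to HR-terms. -/
noncomputable def VRTerm.expand [Finite Port] : VRTerm P ptype → ExpTerm P ptype
  | .single π =>
    .rename (obsMap P ptype) (obsMap_injective ptype)
      ((HRTerm.single (.half π)).compList
        ((enumerate (P (ptype π)).Obs).map fun t => halfLinkTerm π t))
  | .addEdge π π' hne t t' θ =>
    .comp
      (.edge (.root π ⟨ptype π, t⟩ rfl) (.root π' ⟨ptype π', t'⟩ rfl)
        (by
          intro h
          exact hne (ExpPort.root.inj h).1)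
        ⟨RouterTrans.exec, trivial⟩ ⟨RouterTrans.exec, trivial⟩)
      θ.expand
  | .rename α θ =>
    .rename (freshMap P ptype) (freshMap_injective ptype) (θ.expand.compList (encList α))
  | .disjUnion θ₁ θ₂ =>
    .comp
      (.rename (unionMap P ptype θ₁.val.sort θ₂.val.sort) (unionMap_injective ptype _ _)
        (θ₁.expand.compList (encList (idOn ptype (θ₁.val.sort ∩ θ₂.val.sort)))))
      (.rename (unionMap P ptype θ₂.val.sort θ₁.val.sort) (unionMap_injective ptype _ _)
        (θ₂.expand.compList (encList (idOn ptype (θ₁.val.sort ∩ θ₂.val.sort)))))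

end Expand

/-! ## Stuttering -/

section Stuttering

variable {ι : Type} [Finite ι] {P : ι → ProcessType} {Port Port' : Type} {ptype : Port → ι}
  {ptype' : Port' → ι ⊕ ObsOf P}

/-- `ρ'` is a stuttering of `ρ`. -/
def IsStuttering (L : PlaceOf P → Option Var) (S : System P ptype)
    (S' : System (expTypes P) ptype') (ρ : Stream'.Seq S.behavior.Trans)
    (ρ' : Stream'.Seq S'.behavior.Trans) : Prop :=
  ∃ (A : Stream'.Seq (Set Formula)) (n : ℕ → ℕ),
    S.behavior.atomsSeq (S.liftLabeling L) ρ = A ∧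
    IsStretch A n (S'.behavior.atomsSeq (S'.liftLabeling (expLabeling L)) ρ')

/-- Each firing sequence of the behavior of `S` has a stuttering among those of the behavior of
`S'`, and each of the latter is a stuttering of one of the former. -/
def StutterEquiv (L : PlaceOf P → Option Var) (S : System P ptype)
    (S' : System (expTypes P) ptype') : Prop :=
  (∀ ρ ∈ S.behavior.paths, ∃ ρ' ∈ S'.behavior.paths, IsStuttering L S S' ρ ρ') ∧
    ∀ ρ' ∈ S'.behavior.paths, ∃ ρ ∈ S.behavior.paths, IsStuttering L S S' ρ ρ'

end Stuttering

end VRHR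

namespace VRHR

/-! ## Stretching sequences -/

/-! The expansion replaces each vertex `v` by a process `half v` and, for each observable transition
`t` of it, a path of routers. The path starts at a router attached to the process and grows by one
router when ports are redefined, and when a port shared by both arguments passes through a disjoint
union. Ports of VR-terms may label many vertices and be merged, so vertices may share routers; but
the path of a vertex never branches, and two paths for the same `t` that meet go on together
(`at_add`). The last router on the path of `v` for `t` carries the port `root π t` exactly when `v`
carries `π`. Hence one `exec` edge between two routers with ports stands for all the edges that the
VR-operation creates. `Expansion` records this structure, `Ported` what induction on terms needs to
know about ports, and `exists_expansion` carries out the induction.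

To fire an edge from `v` to `w`, each end issues an `attempt`; the request climbs the path and
leaves waiting routers behind it; the two heads fire `exec` jointly; then the replies come down to a
`commit`. Each vertex thus has exactly one place that stands for its state: its own place when it is
at rest, and otherwise its head router, whose `active` is labeled like the predecessor and whose
`reply` like the successor of `t`. The places `mid`, `wait` and `idle` have no label. So a state of
the system and any state representing it satisfy the same formulas (`Inv.card_eq`), and the
represented state changes only when `exec` or an internal transition fires.

From the expansion to the system (`Inv.backward`): a step is either an `exec` or internal step,
which the system matches, or it is silent and lowers a potential. A run therefore splits into finite
blocks. A run that ends with requests blocked by one another is harmless: its last silent steps only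
repeat the last set of formulas.

From the system to the expansion (`Inv.forward`): when all vertices are at rest, an edge is
simulated by letting one end climb, then the other, firing `exec`, and descending twice. The second
climb is not blocked by the first: if the paths met, the `exec` edge would join two routers on the
path of a single vertex, and by soundness of `exec` edges the system would have a loop.

`exists_stretch_of_backward` and `exists_stretch_of_forward` turn these one-step simulations into
statements about finite and infinite firing sequences. -/

/-- The first `i` elements of `ρ` exist. -/
def Lasts {α : Type} (ρ : Stream'.Seq α) (i : ℕ) : Prop := ∀ j < i, ρ.get? j ≠ none

theorem lasts_zero {α : Type} (ρ : Stream'.Seq α) : Lasts ρ 0 := fun _ h => absurd h (by omega)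

theorem lasts_succ {α : Type} {ρ : Stream'.Seq α} {i : ℕ} :
    Lasts ρ (i + 1) ↔ ρ.get? i ≠ none := by
  refine ⟨fun h => h i (by omega), fun h j hj e => h ?_⟩
  exact ρ.le_stable (by omega) e

theorem Lasts.mono {α : Type} {ρ : Stream'.Seq α} {i j : ℕ} (h : Lasts ρ j) (hij : i ≤ j) :
    Lasts ρ i := fun k hk => h k (by omega)

namespace PetriNet

variable {N N' : PetriNet}

open Classical in
theorem atomsSeq_get? (lab : N.Place → Option Var) (ρ : Stream'.Seq N.Trans) (i : ℕ) :
    (N.atomsSeq lab ρ).get? i =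
      if Lasts ρ i then some (N.atoms lab (N.markingAfter ρ i)) else none := by
  cases i with
  | zero => rw [if_pos (lasts_zero ρ)]; rfl
  | succ j =>
    change (ρ.get? j).map _ = _
    cases h : ρ.get? j with
    | none => rw [if_neg (by rw [lasts_succ, h]; simp)]; rfl
    | some t => rw [if_pos (by rw [lasts_succ, h]; simp)]; rfl

theorem markingAfter_succ_some {ρ : Stream'.Seq N.Trans} {i : ℕ} {t : N.Trans}
    (h : ρ.get? i = some t) : N.markingAfter ρ (i + 1) = N.fire (N.markingAfter ρ i) t := by
  rw [markingAfter, h]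

theorem markingAfter_succ_none {ρ : Stream'.Seq N.Trans} {i : ℕ}
    (h : ρ.get? i = none) : N.markingAfter ρ (i + 1) = N.markingAfter ρ i := by
  rw [markingAfter, h]

/-- Only two things have to agree inside a block: whether the sequence has got that far, and the
formulas satisfied there. Past the end of `ρ` there is no condition on atoms. -/
theorem isStretch_atomsSeq {lab : N.Place → Option Var} {lab' : N'.Place → Option Var}
    {ρ : Stream'.Seq N.Trans} {ρ' : Stream'.Seq N'.Trans} {n : ℕ → ℕ} (hn : ∀ i, 1 ≤ n i)
    (hl : ∀ i k, k < n i → (Lasts ρ' ((∑ j ∈ Finset.range i, n j) + k) ↔ Lasts ρ i))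
    (ha : ∀ i k, k < n i → Lasts ρ i → N.atoms lab (N.markingAfter ρ i) =
      N'.atoms lab' (N'.markingAfter ρ' ((∑ j ∈ Finset.range i, n j) + k))) :
    IsStretch (N.atomsSeq lab ρ) n (N'.atomsSeq lab' ρ') := by
  refine ⟨hn, fun i k hk => ?_⟩
  rw [atomsSeq_get?, atomsSeq_get?]
  by_cases h : Lasts ρ i
  · rw [if_pos h, if_pos ((hl i k hk).2 h), ha i k hk h]
  · rw [if_neg h, if_neg (fun h' => h ((hl i k hk).1 h'))]

/-- If each step of `N'` is matched by a step of `N` or decreases a measure, the firing sequences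
of `N'` are stutterings of those of `N`. -/
theorem exists_stretch_of_backward (lab : N.Place → Option Var) (lab' : N'.Place → Option Var)
    (R : N.Marking → N'.Marking → ℕ → Prop)
    (hobs : ∀ m m' μ, R m m' μ → N.atoms lab m = N'.atoms lab' m')
    (hinit : ∃ μ, R N.init N'.init μ)
    (hstep : ∀ m m' μ t', R m m' μ → N'.Enabled m' t' →
      (∃ t μ₂, N.Enabled m t ∧ R (N.fire m t) (N'.fire m' t') μ₂) ∨
        ∃ μ₂ < μ, R m (N'.fire m' t') μ₂)
    (ρ' : Stream'.Seq N'.Trans) (hρ' : ρ' ∈ N'.paths) :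
    ∃ ρ ∈ N.paths, ∃ n, IsStretch (N.atomsSeq lab ρ) n (N'.atomsSeq lab' ρ') := by
  -- Strong induction on the measure collects the maximal run of `k` silent steps from position `j`;
  -- `o` is the matched step that ends it, or `none` if `ρ'` stops there.
  have block : ∀ μ m j, R m (N'.markingAfter ρ' j) μ →
      ∃ (k : ℕ) (o : Option N.Trans), (∀ l ≤ k, ∃ μ, R m (N'.markingAfter ρ' (j + l)) μ) ∧
        (∀ l < k, ρ'.get? (j + l) ≠ none) ∧ (o = none ↔ ρ'.get? (j + k) = none) ∧
        (∀ t, o = some t → N.Enabled m t) ∧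
        ∃ μ, R (o.elim m (N.fire m)) (N'.markingAfter ρ' (j + (k + 1))) μ := by
    intro μ
    induction μ using Nat.strong_induction_on with
    | _ μ ih =>
      intro m j hR
      cases h : ρ'.get? j with
      | none =>
        -- The sequence is over: `markingAfter` is constant from here on, so position `j + 1` can
        -- serve as padding.
        refine ⟨0, none, ?_, ?_, by simpa using h, by simp, μ, ?_⟩
        · intro l hl
          obtain rfl : l = 0 := by omega
          exact ⟨μ, hR⟩
        · intro l hl; omega
        · rw [Nat.zero_add, markingAfter_succ_none h]; exact hR
      | some t' =>
        have hm := markingAfter_succ_some h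
        rcases hstep m _ μ t' hR (hρ' j t' h) with ⟨t, μ₂, ht, hR₂⟩ | ⟨μ₂, hμ, hR₂⟩
        · refine ⟨0, some t, ?_, ?_, by simp [h], ?_, μ₂, ?_⟩
          · intro l hl
            obtain rfl : l = 0 := by omega
            exact ⟨μ, hR⟩
          · intro l hl; omega
          · rintro _ ⟨⟩; exact ht
          · rw [Nat.zero_add, hm]; exact hR₂
        · rw [← hm] at hR₂
          obtain ⟨k, o, h₁, h₂, h₃, h₄, h₅⟩ := ih μ₂ hμ m (j + 1) hR₂
          have e : ∀ l, j + 1 + l = j + (l + 1) := fun l => by omega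
          simp only [e] at h₁ h₂ h₃ h₅
          refine ⟨k + 1, o, ?_, ?_, h₃, h₄, h₅⟩
          · rintro (_ | l) hl
            · exact ⟨μ, hR⟩
            · exact h₁ l (by omega)
          · rintro (_ | l) hl
            · rw [Nat.add_zero, h]; simp
            · exact h₂ l (by omega)
  -- Pairs of a marking and a position bundled with their relation, so that passing to the next
  -- block is a total function that can be iterated.
  let C := {c : N.Marking × ℕ // ∃ μ, R c.1 (N'.markingAfter ρ' c.2) μ}
  have next : ∀ c : C, ∃ (k : ℕ) (o : Option N.Trans) (c' : C),
      (∀ l ≤ k, ∃ μ, R c.1.1 (N'.markingAfter ρ' (c.1.2 + l)) μ) ∧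
        (∀ l < k, ρ'.get? (c.1.2 + l) ≠ none) ∧ (o = none ↔ ρ'.get? (c.1.2 + k) = none) ∧
        (∀ t, o = some t → N.Enabled c.1.1 t) ∧
        c'.1 = (o.elim c.1.1 (N.fire c.1.1), c.1.2 + (k + 1)) := by
    rintro ⟨⟨m, j⟩, μ, hR⟩
    obtain ⟨k, o, h₁, h₂, h₃, h₄, h₅⟩ := block μ m j hR
    exact ⟨k, o, ⟨(_, _), h₅⟩, h₁, h₂, h₃, h₄, rfl⟩
  choose k o nx h₁ h₂ h₃ h₄ h₅ using next
  let c : ℕ → C := fun i => nx^[i] ⟨(N.init, 0), hinit⟩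
  have hc : ∀ i, c (i + 1) = nx (c i) := fun i => Function.iterate_succ_apply' _ _ _
  have hsum : ∀ i, (∑ j ∈ Finset.range i, (k (c j) + 1)) = (c i).1.2 := by
    intro i
    induction i with
    | zero => rfl
    | succ i ih => rw [Finset.sum_range_succ, ih, hc, h₅]
  have hnone : ∀ i, o (c i) = none → ρ'.get? (c (i + 1)).1.2 = none := by
    intro i hi
    rw [hc, h₅]
    exact ρ'.le_stable (by simp) ((h₃ _).1 hi)
  let ρ : Stream'.Seq N.Trans := ⟨fun i => o (c i), by
    intro i hi
    exact (h₃ _).2 (ρ'.le_stable (by omega) (hnone i hi))⟩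
  have hmark : ∀ i, N.markingAfter ρ i = (c i).1.1 := by
    intro i
    induction i with
    | zero => rfl
    | succ i ih =>
      have e : ρ.get? i = o (c i) := rfl
      rw [hc, h₅]
      cases h : o (c i) with
      | none => rw [markingAfter_succ_none (e.trans h), ih]; rfl
      | some t => rw [markingAfter_succ_some (e.trans h), ih]; rfl
  have hlasts : ∀ i, Lasts ρ' (c i).1.2 ↔ Lasts ρ i := by
    intro i
    cases i with
    | zero => exact iff_of_true (lasts_zero _) (lasts_zero _)
    | succ i =>
      have e : (c (i + 1)).1.2 = (c i).1.2 + k (c i) + 1 := by rw [hc, h₅]; rfl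
      rw [e, lasts_succ, lasts_succ]
      exact (not_congr (h₃ (c i))).symm
  -- A block is the `k` silent steps plus one position for the matched step, or for padding after
  -- the end.
  refine ⟨ρ, fun i t hi => ?_, fun i => k (c i) + 1, isStretch_atomsSeq (fun _ => by omega) ?_ ?_⟩
  · rw [hmark]; exact h₄ _ _ hi
  · intro i l hl
    rw [hsum]
    cases l with
    | zero => exact hlasts i
    | succ l =>
      have := h₂ (c i) l (by omega)
      rw [← add_assoc, lasts_succ]
      refine iff_of_true this ?_
      rw [← hlasts]
      exact (lasts_succ.2 this).mono (by omega)
  · intro i l hl _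
    rw [hsum, hmark]
    obtain ⟨μ, hμ⟩ := h₁ (c i) l (by omega)
    exact hobs _ _ _ hμ

/-! ### Forward simulation: concatenating finite blocks -/

/-- The marking reached from `m` by firing a list of transitions. -/
def run (N : PetriNet) (m : N.Marking) (l : List N.Trans) : N.Marking := l.foldl N.fire m

/-- One step of `N` from a marking whose atoms are `A`. -/
def StepAt (N : PetriNet) (lab : N.Place → Option Var) (A : Set Formula) (m m₂ : N.Marking) :
    Prop :=
  N.atoms lab m = A ∧ ∃ t, N.Enabled m t ∧ m₂ = N.fire m t

/-- Firing sequences consist of transitions, so the reachability relation has to be unfolded into a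
list. The final step `h₂` makes the list nonempty; the marking it reaches is the only one whose
atoms are not constrained. -/
theorem exists_list_of_reflTransGen {lab : N.Place → Option Var} {A : Set Formula}
    {m m₁ : N.Marking} (h : Relation.ReflTransGen (N.StepAt lab A) m m₁) {m₂ : N.Marking}
    (h₂ : N.StepAt lab A m₁ m₂) :
    ∃ l : List N.Trans, l ≠ [] ∧ N.run m l = m₂ ∧ ∀ k t, l[k]? = some t →
      N.atoms lab (N.run m (l.take k)) = A ∧ N.Enabled (N.run m (l.take k)) t := by
  have cons : ∀ {m m₁ t} {l : List N.Trans}, N.atoms lab m = A → N.Enabled m t →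
      m₁ = N.fire m t → (∀ k t, l[k]? = some t →
      N.atoms lab (N.run m₁ (l.take k)) = A ∧ N.Enabled (N.run m₁ (l.take k)) t) →
      ∀ k s, (t :: l)[k]? = some s → N.atoms lab (N.run m ((t :: l).take k)) = A ∧
        N.Enabled (N.run m ((t :: l).take k)) s := by
    rintro m _ t l hA ht rfl hl (_ | k) s hs
    · cases hs; exact ⟨hA, ht⟩
    · exact hl k s (by simpa using hs)
  induction h using Relation.ReflTransGen.head_induction_on with
  | refl =>
    obtain ⟨hA, t, ht, rfl⟩ := h₂
    exact ⟨[t], by simp, rfl, cons hA ht rfl (by simp)⟩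
  | head h₀ _ ih =>
    obtain ⟨l, -, hr, hl⟩ := ih
    obtain ⟨hA, t, ht, rfl⟩ := h₀
    exact ⟨t :: l, by simp, hr, cons hA ht rfl hl⟩

/-- Division with remainder for blocks of varying length; `block_index_unique` is its uniqueness
part. -/
theorem exists_block_index {n : ℕ → ℕ} (hn : ∀ i, 1 ≤ n i) (j : ℕ) :
    ∃ i k, k < n i ∧ j = (∑ a ∈ Finset.range i, n a) + k := by
  induction j with
  | zero => exact ⟨0, 0, hn 0, by simp⟩
  | succ j ih =>
    obtain ⟨i, k, hk, rfl⟩ := ih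
    by_cases h : k + 1 < n i
    · exact ⟨i, k + 1, h, by omega⟩
    · refine ⟨i + 1, 0, hn _, ?_⟩
      rw [Finset.sum_range_succ]
      omega

theorem block_index_unique {n : ℕ → ℕ} {i i' k k' : ℕ} (hk : k < n i) (hk' : k' < n i')
    (h : (∑ a ∈ Finset.range i, n a) + k = (∑ a ∈ Finset.range i', n a) + k') :
    i = i' ∧ k = k' := by
  have key : ∀ {i i' k k' : ℕ}, k < n i → i < i' →
      (∑ a ∈ Finset.range i, n a) + k < (∑ a ∈ Finset.range i', n a) + k' := by
    intro i i' k k' hk hi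
    have h₁ : ∑ a ∈ Finset.range (i + 1), n a ≤ ∑ a ∈ Finset.range i', n a :=
      Finset.sum_le_sum_of_subset (Finset.range_subset_range.2 hi)
    rw [Finset.sum_range_succ] at h₁
    omega
  rcases lt_trichotomy i i' with hi | rfl | hi
  · have := key (k' := k') hk hi; omega
  · exact ⟨rfl, by omega⟩
  · have := key (k' := k) hk' hi; omega

/-- If each step of `N` is matched by a nonempty sequence of steps of `N'` that preserve the
atoms except for the last one, the firing sequences of `N` have stutterings in `N'`. -/
theorem exists_stretch_of_forward (lab : N.Place → Option Var) (lab' : N'.Place → Option Var)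
    (W : N.Marking → N'.Marking → Prop)
    (hobs : ∀ m m', W m m' → N.atoms lab m = N'.atoms lab' m')
    (hinit : W N.init N'.init)
    (hstep : ∀ m m' t, W m m' → N.Enabled m t →
      ∃ m₁ m₂, Relation.ReflTransGen (N'.StepAt lab' (N.atoms lab m)) m' m₁ ∧
        N'.StepAt lab' (N.atoms lab m) m₁ m₂ ∧ W (N.fire m t) m₂)
    (ρ : Stream'.Seq N.Trans) (hρ : ρ ∈ N.paths) :
    ∃ ρ' ∈ N'.paths, ∃ n, IsStretch (N.atomsSeq lab ρ) n (N'.atomsSeq lab' ρ') := by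
  -- The relation `W` is assumed inside the existential, so that `choose` returns a function of `i`
  -- and `m'` without a proof argument.
  have block : ∀ (i : ℕ) (m' : N'.Marking), ∃ l : List N'.Trans, W (N.markingAfter ρ i) m' →
      (l = [] ↔ ρ.get? i = none) ∧ W (N.markingAfter ρ (i + 1)) (N'.run m' l) ∧
      ∀ k t, l[k]? = some t →
        N'.atoms lab' (N'.run m' (l.take k)) = N.atoms lab (N.markingAfter ρ i) ∧
          N'.Enabled (N'.run m' (l.take k)) t := by
    intro i m'
    by_cases hW : W (N.markingAfter ρ i) m'
    · cases h : ρ.get? i with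
      | none =>
        refine ⟨[], fun _ => ⟨by simp, ?_, by simp⟩⟩
        rw [markingAfter_succ_none h]; exact hW
      | some t =>
        obtain ⟨m₁, m₂, h₁, h₂, h₃⟩ := hstep _ m' t hW (hρ i t h)
        obtain ⟨l, hl, hr, ha⟩ := exists_list_of_reflTransGen h₁ h₂
        refine ⟨l, fun _ => ⟨by simp [hl], ?_, ha⟩⟩
        rw [hr, markingAfter_succ_some h]; exact h₃
    · exact ⟨[], fun h => absurd h hW⟩
  choose L hL using block
  let c : ℕ → N'.Marking := fun i => Nat.rec N'.init (fun i m' => N'.run m' (L i m')) i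
  have hc : ∀ i, c (i + 1) = N'.run (c i) (L i (c i)) := fun i => rfl
  have hW : ∀ i, W (N.markingAfter ρ i) (c i) := by
    intro i
    induction i with
    | zero => exact hinit
    | succ i ih => rw [hc]; exact (hL i _ ih).2.1
  let l : ℕ → List N'.Trans := fun i => L i (c i)
  have hl : ∀ i, l i = [] ↔ ρ.get? i = none := fun i => (hL i _ (hW i)).1
  have ha := fun i => (hL i _ (hW i)).2.2
  -- The list is empty once `ρ` has ended, whereas a stretch needs blocks of positive length.
  let n : ℕ → ℕ := fun i => max 1 (l i).length
  have hn : ∀ i, 1 ≤ n i := fun i => le_max_left _ _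
  choose blk off hoff hblk using exists_block_index hn
  have hidx : ∀ i k, k < n i → blk ((∑ a ∈ Finset.range i, n a) + k) = i ∧
      off ((∑ a ∈ Finset.range i, n a) + k) = k := fun i k hk =>
    block_index_unique (hoff _) hk (hblk _).symm
  have hget : ∀ i k, k < n i → ((l i)[k]? = none ↔ ρ.get? i = none) := by
    intro i k hk
    rw [← hl]
    refine ⟨fun h => ?_, fun h => by rw [h]; rfl⟩
    by_contra h'
    have := List.length_pos_iff.2 h'
    have := List.getElem?_eq_none_iff.1 h
    have : n i = (l i).length := max_eq_right (by omega)
    omega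
  -- Needed for `ρ'` to be a sequence: after a missing element all later ones are missing, because
  -- later positions lie in the same or later blocks.
  have hmono : ∀ j, blk j ≤ blk (j + 1) := by
    intro j
    by_contra h
    have h₁ := hblk j
    have h₂ := hblk (j + 1)
    have h₃ : ∑ a ∈ Finset.range (blk (j + 1) + 1), n a ≤ ∑ a ∈ Finset.range (blk j), n a :=
      Finset.sum_le_sum_of_subset (Finset.range_subset_range.2 (by omega))
    rw [Finset.sum_range_succ] at h₃
    have := hoff (j + 1)
    omega
  let ρ' : Stream'.Seq N'.Trans := ⟨fun j => (l (blk j))[off j]?, by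
    intro j hj
    exact (hget _ _ (hoff _)).2 (ρ.le_stable (hmono j) ((hget _ _ (hoff j)).1 hj))⟩
  have hρ'j : ∀ j, ρ'.get? j = (l (blk j))[off j]? := fun j => rfl
  have hρ' : ∀ i k, k < n i → ρ'.get? ((∑ a ∈ Finset.range i, n a) + k) = (l i)[k]? := by
    intro i k hk
    rw [hρ'j, (hidx i k hk).1, (hidx i k hk).2]
  have hmark : ∀ i k, k ≤ n i → N'.markingAfter ρ' (∑ a ∈ Finset.range i, n a) = c i →
      N'.markingAfter ρ' ((∑ a ∈ Finset.range i, n a) + k) = N'.run (c i) ((l i).take k) := by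
    intro i k
    induction k with
    | zero => intro _ h; simpa [run] using h
    | succ k ih =>
      intro hk h
      have e := hρ' i k (by omega)
      have ih := ih (by omega) h
      rw [← add_assoc]
      cases hx : (l i)[k]? with
      | none =>
        rw [markingAfter_succ_none (e.trans hx), ih, List.take_add_one, hx]; simp
      | some t =>
        rw [markingAfter_succ_some (e.trans hx), ih, List.take_add_one, hx]
        simp [run]
  have hmark₀ : ∀ i, N'.markingAfter ρ' (∑ a ∈ Finset.range i, n a) = c i := by
    intro i
    induction i with
    | zero => rfl
    | succ i ih =>
      rw [Finset.sum_range_succ, hmark i (n i) le_rfl ih, hc, List.take_of_length_le]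
      exact le_max_right _ _
  refine ⟨ρ', ?_, n, isStretch_atomsSeq hn ?_ ?_⟩
  · intro j t hj
    obtain ⟨i, k, hk, rfl⟩ := exists_block_index hn j
    rw [hmark i k hk.le (hmark₀ i)]
    rw [hρ' i k hk] at hj
    exact (ha i k t hj).2
  · intro i k hk
    have zero : Lasts ρ' (∑ a ∈ Finset.range i, n a) ↔ Lasts ρ i := by
      cases i with
      | zero => exact iff_of_true (lasts_zero _) (lasts_zero _)
      | succ i =>
        have h₁ := hn i
        have e : ∑ a ∈ Finset.range (i + 1), n a =
          (∑ a ∈ Finset.range i, n a) + (n i - 1) + 1 := by rw [Finset.sum_range_succ]; omega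
        rw [e, lasts_succ, lasts_succ, hρ' i _ (by omega)]
        exact not_congr (hget _ _ (by omega))
    cases k with
    | zero => exact zero
    | succ k =>
      rw [← add_assoc, lasts_succ, hρ' i k (by omega)]
      have h₁ : (l i)[k]? ≠ none := by
        rw [ne_eq, List.getElem?_eq_none_iff]
        -- Since `k + 1 < n i`, the second alternative is impossible, so the list fills the whole
        -- block.
        have : n i = (l i).length ∨ n i = 1 := by
          rcases max_choice 1 (l i).length with h | h
          · exact Or.inr h
          · exact Or.inl h
        omega
      refine iff_of_true h₁ (zero.1 ?_)
      refine Lasts.mono (j := (∑ a ∈ Finset.range i, n a) + k + 1) ?_ (by omega)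
      rw [lasts_succ, hρ' i k (by omega)]
      exact h₁
  · intro i k hk _
    rw [hmark i k hk.le (hmark₀ i)]
    cases hx : (l i)[k]? with
    | some t => exact (ha i k t hx).1.symm
    | none =>
      have : l i = [] := (hl i).2 ((hget i k hk).1 hx)
      rw [this, List.take_nil]
      exact hobs _ _ (hW i)

end PetriNet

/-! ## States -/

section States

variable {ι : Type} {P : ι → ProcessType}

theorem ProcessType.inW_eq (p : ProcessType) (q : p.Place) (t : p.Trans) [Decidable (q = p.pre t)] :
    p.inW q t = if q = p.pre t then 1 else 0 := by
  have h := (p.existsUnique_pre t).choose_spec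
  have h₁ := p.inW_le q t
  split_ifs with hq
  · subst hq
    have : 0 < p.inW (p.pre t) t := h.1
    omega
  · by_contra h₀
    exact hq (h.2 q (by simp only; omega))

theorem ProcessType.outW_eq (p : ProcessType) (q : p.Place) (t : p.Trans)
    [Decidable (q = p.post t)] : p.outW t q = if q = p.post t then 1 else 0 := by
  have h := (p.existsUnique_post t).choose_spec
  have h₁ := p.outW_le t q
  split_ifs with hq
  · subst hq
    have : 0 < p.outW t (p.post t) := h.1
    omega
  · by_contra h₀
    exact hq (h.2 q (by simp only; omega))

theorem ProcessType.pre_eq {p : ProcessType} {q : p.Place} {t : p.Trans} (h : 0 < p.inW q t) :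
    p.pre t = q :=
  ((p.existsUnique_pre t).choose_spec.2 q h).symm

theorem ProcessType.post_eq {p : ProcessType} {q : p.Place} {t : p.Trans} (h : 0 < p.outW t q) :
    p.post t = q :=
  ((p.existsUnique_post t).choose_spec.2 q h).symm

/-- The initially marked place. -/
noncomputable def ProcessType.start (p : ProcessType) : p.Place := p.exists_init.choose

theorem ProcessType.init_eq (p : ProcessType) (q : p.Place) [Decidable (p.start = q)] :
    p.init q = if p.start = q then 1 else 0 := by
  have h := p.exists_init.choose_spec
  split_ifs with hq
  · subst hq; exact h.1
  · exact h.2 q (Ne.symm hq)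

theorem ProcessType.start_eq {p : ProcessType} {q : p.Place} (h : 0 < p.init q) :
    p.start = q := by
  classical
  rw [p.init_eq] at h
  by_contra hq
  simp [hq] at h

variable (P) in
/-- The predecessor of a transition of a family of process types. -/
noncomputable def preOf (t : TransOf P) : PlaceOf P := ⟨t.1, (P t.1).pre t.2⟩

variable (P) in
/-- The successor of a transition of a family of process types. -/
noncomputable def postOf (t : TransOf P) : PlaceOf P := ⟨t.1, (P t.1).post t.2⟩

variable (P) in
/-- The initially marked place of a process type of a family. -/
noncomputable def startOf (p : ι) : PlaceOf P := ⟨p, (P p).start⟩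

open Classical in
theorem inWeight_eq (q : PlaceOf P) (t : TransOf P) :
    inWeight P q t = if q = preOf P t then 1 else 0 := by
  obtain ⟨p, q⟩ := q
  obtain ⟨p', t⟩ := t
  unfold inWeight preOf
  by_cases h : p = p'
  · subst h
    simp [ProcessType.inW_eq]
  · simp [h]

open Classical in
theorem outWeight_eq (t : TransOf P) (q : PlaceOf P) :
    outWeight P t q = if q = postOf P t then 1 else 0 := by
  obtain ⟨p, q⟩ := q
  obtain ⟨p', t⟩ := t
  unfold outWeight postOf
  by_cases h : p = p'
  · subst h
    simp [ProcessType.outW_eq]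
  · simp [h]

variable {Port : Type} {ptype : Port → ι}

/-! ### Behaviors as transition systems on one-token-per-vertex states -/

namespace System

open Classical in
/-- A step between states, that is, choices of a marked place for each vertex. -/
def Step (S : System P ptype) (σ σ₂ : S.V → PlaceOf P) : Prop :=
  (∃ v t t' w, S.edge v t t' w ∧ σ v = preOf P t.toTrans ∧ σ w = preOf P t'.toTrans ∧
    σ₂ = Function.update (Function.update σ v (postOf P t.toTrans)) w (postOf P t'.toTrans)) ∨
  ∃ v t, t.1 = S.proc v ∧ ¬ (P t.1).obs t.2 ∧ σ v = preOf P t ∧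
    σ₂ = Function.update σ v (postOf P t)

theorem edge_ne {S : System P ptype} {v w : S.V} {t t' : ObsOf P} (h : S.edge v t t' w) : v ≠ w := by
  rintro rfl
  exact S.loopless _ _ _ h

variable [Finite ι]

open Classical in
/-- The marking `m` has exactly one token in each vertex, given by the state `σ`. -/
def Rep (S : System P ptype) (m : S.behavior.Marking) (σ : S.V → PlaceOf P) : Prop :=
  (∀ v, (σ v).1 = S.proc v) ∧
    ∀ x : {x : PlaceOf P × S.V // x.1.1 = S.proc x.2}, m x = if x.1.1 = σ x.1.2 then 1 else 0

theorem rep_init (S : System P ptype) :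
    S.Rep S.behavior.init fun v => startOf P (S.proc v) := by
  classical
  refine ⟨fun v => rfl, ?_⟩
  rintro ⟨⟨⟨p, q⟩, v⟩, h⟩
  change p = S.proc v at h
  subst h
  change (P (S.proc v)).init q = if (⟨S.proc v, q⟩ : PlaceOf P) = startOf P (S.proc v) then 1 else 0
  rw [ProcessType.init_eq]
  simp [startOf, eq_comm]

/-- The transition of the behavior that belongs to an edge. -/
def edgeTrans {S : System P ptype} {v w : S.V} {t t' : ObsOf P} (h : S.edge v t t' w) :
    S.behavior.Trans :=
  Sum.inl ⟨(v, t, t', w), h⟩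

/-- The transition of the behavior that belongs to an internal transition of a vertex. -/
def internalTrans {S : System P ptype} {v : S.V} {t : TransOf P} (h : t.1 = S.proc v)
    (ho : ¬ (P t.1).obs t.2) : S.behavior.Trans :=
  Sum.inr ⟨(t, v), h, ho⟩

variable {S : System P ptype} {m : S.behavior.Marking} {σ σ₂ : S.V → PlaceOf P}

/-- There are no loops, so the two predecessor places lie in different vertices and their weights
never add up to two; enabledness is then one condition for each end. -/
theorem Rep.enabled_edge (h : S.Rep m σ) {v w : S.V} {t t' : ObsOf P} (he : S.edge v t t' w) :
    S.behavior.Enabled m (edgeTrans he) ↔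
      σ v = preOf P t.toTrans ∧ σ w = preOf P t'.toTrans := by
  classical
  obtain ⟨hσ, hm⟩ := h
  have hvw := edge_ne he
  constructor
  · intro hτ
    have h₁ := hτ ⟨(preOf P t.toTrans, v), S.edge_src _ _ _ _ he⟩
    have h₂ := hτ ⟨(preOf P t'.toTrans, w), S.edge_tgt _ _ _ _ he⟩
    rw [hm] at h₁ h₂
    change (if v = v then inWeight P (preOf P t.toTrans) t.toTrans else 0) +
      (if v = w then inWeight P (preOf P t.toTrans) t'.toTrans else 0) ≤ _ at h₁
    change (if w = v then inWeight P (preOf P t'.toTrans) t.toTrans else 0) +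
      (if w = w then inWeight P (preOf P t'.toTrans) t'.toTrans else 0) ≤ _ at h₂
    simp only [inWeight_eq, hvw, hvw.symm, if_true, if_false, add_zero, zero_add] at h₁ h₂
    constructor
    · by_contra hne; simp [Ne.symm hne] at h₁
    · by_contra hne; simp [Ne.symm hne] at h₂
  · rintro ⟨e₁, e₂⟩ ⟨⟨q, u⟩, hq⟩
    rw [hm]
    change (if u = v then inWeight P q t.toTrans else 0) +
      (if u = w then inWeight P q t'.toTrans else 0) ≤ _
    simp only [inWeight_eq]
    by_cases hw : u = w
    · subst hw; simp [e₂, hvw.symm]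
    · by_cases hv : u = v
      · subst hv; simp [e₁, hvw]
      · simp [hw, hv]

theorem Rep.enabled_internal (h : S.Rep m σ) {v : S.V} {t : TransOf P} (ht : t.1 = S.proc v)
    (ho : ¬ (P t.1).obs t.2) :
    S.behavior.Enabled m (internalTrans ht ho) ↔ σ v = preOf P t := by
  classical
  obtain ⟨hσ, hm⟩ := h
  constructor
  · intro hτ
    have h₁ := hτ ⟨(preOf P t, v), ht⟩
    rw [hm] at h₁
    change (if v = v then inWeight P (preOf P t) t else 0) ≤ _ at h₁
    simp only [inWeight_eq, if_true] at h₁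
    by_contra hne; simp [Ne.symm hne] at h₁
  · rintro e₁ ⟨⟨q, u⟩, hq⟩
    rw [hm]
    change (if u = v then inWeight P q t else 0) ≤ _
    simp only [inWeight_eq]
    by_cases hv : u = v
    · subst hv; simp [e₁]
    · simp [hv]

open Classical in
theorem Rep.fire_edge (h : S.Rep m σ) {v w : S.V} {t t' : ObsOf P} (he : S.edge v t t' w)
    (e₁ : σ v = preOf P t.toTrans) (e₂ : σ w = preOf P t'.toTrans) :
    S.Rep (S.behavior.fire m (edgeTrans he)) (Function.update
      (Function.update σ v (postOf P t.toTrans)) w (postOf P t'.toTrans)) := by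
  obtain ⟨hσ, hm⟩ := h
  have hvw := edge_ne he
  refine ⟨fun u => ?_, ?_⟩
  · by_cases hw : u = w
    · subst hw; rw [Function.update_self]; exact S.edge_tgt _ _ _ _ he
    · rw [Function.update_of_ne hw]
      by_cases hv : u = v
      · subst hv; rw [Function.update_self]; exact S.edge_src _ _ _ _ he
      · rw [Function.update_of_ne hv]; exact hσ u
  · rintro ⟨⟨q, u⟩, hq⟩
    change m ⟨(q, u), hq⟩ - ((if u = v then inWeight P q t.toTrans else 0) +
      (if u = w then inWeight P q t'.toTrans else 0)) +
      ((if u = v then outWeight P t.toTrans q else 0) +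
      (if u = w then outWeight P t'.toTrans q else 0)) = _
    rw [hm]
    simp only [inWeight_eq, outWeight_eq]
    by_cases hw : u = w
    · subst hw; simp [e₂, hvw.symm]
    · by_cases hv : u = v
      · subst hv; simp [e₁, hvw]
      · simp [hw, hv]

open Classical in
theorem Rep.fire_internal (h : S.Rep m σ) {v : S.V} {t : TransOf P} (ht : t.1 = S.proc v)
    (ho : ¬ (P t.1).obs t.2) (e₁ : σ v = preOf P t) :
    S.Rep (S.behavior.fire m (internalTrans ht ho)) (Function.update σ v (postOf P t)) := by
  obtain ⟨hσ, hm⟩ := h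
  refine ⟨fun u => ?_, ?_⟩
  · by_cases hv : u = v
    · subst hv; rw [Function.update_self]; exact ht
    · rw [Function.update_of_ne hv]; exact hσ u
  · rintro ⟨⟨q, u⟩, hq⟩
    change m ⟨(q, u), hq⟩ - (if u = v then inWeight P q t else 0) +
      (if u = v then outWeight P t q else 0) = _
    rw [hm]
    simp only [inWeight_eq, outWeight_eq]
    by_cases hv : u = v
    · subst hv; simp [e₁]
    · simp [hv]

/-- Together with `Rep.exists_enabled` this reduces the token game to `Step`, so that the simulation
argument never mentions weights. -/
theorem Rep.step_of_enabled (h : S.Rep m σ) {τ : S.behavior.Trans}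
    (hτ : S.behavior.Enabled m τ) :
    ∃ σ₂, S.Step σ σ₂ ∧ S.Rep (S.behavior.fire m τ) σ₂ := by
  rcases τ with ⟨⟨v, t, t', w⟩, he⟩ | ⟨⟨t, v⟩, ht, ho⟩
  · obtain ⟨e₁, e₂⟩ := (h.enabled_edge he).1 hτ
    exact ⟨_, Or.inl ⟨v, t, t', w, he, e₁, e₂, rfl⟩, h.fire_edge he e₁ e₂⟩
  · have e₁ := (h.enabled_internal ht ho).1 hτ
    exact ⟨_, Or.inr ⟨v, t, ht, ho, e₁, rfl⟩, h.fire_internal ht ho e₁⟩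

theorem Rep.exists_enabled (h : S.Rep m σ) (hs : S.Step σ σ₂) :
    ∃ τ, S.behavior.Enabled m τ ∧ S.Rep (S.behavior.fire m τ) σ₂ := by
  rcases hs with ⟨v, t, t', w, he, e₁, e₂, rfl⟩ | ⟨v, t, ht, ho, e₁, rfl⟩
  · exact ⟨_, (h.enabled_edge he).2 ⟨e₁, e₂⟩, h.fire_edge he e₁ e₂⟩
  · exact ⟨_, (h.enabled_internal ht ho).2 e₁, h.fire_internal ht ho e₁⟩

/-- With one token in each vertex, summing over labeled places amounts to counting the vertices
whose current place has the label: the marked places are the pairs `(σ v, v)`. -/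
theorem Rep.varValue (h : S.Rep m σ) (L : PlaceOf P → Option Var) (x : Var) :
    S.behavior.varValue (S.liftLabeling L) m x = Nat.card {v // L (σ v) = some x} := by
  classical
  have := Fintype.ofFinite S.behavior.Place
  have := Fintype.ofFinite S.V
  unfold PetriNet.varValue
  rw [finsum_eq_sum_of_fintype]
  have e : ∀ y : S.behavior.Place, (if S.liftLabeling L y = some x then m y else 0) =
      if (L y.1.1 = some x ∧ y.1.1 = σ y.1.2) then 1 else 0 := by
    intro y
    have := h.2 y
    by_cases h₁ : L y.1.1 = some x <;> by_cases h₂ : y.1.1 = σ y.1.2 <;>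
      simp_all [liftLabeling]
  rw [Finset.sum_congr rfl fun y _ => e y, Finset.sum_boole, Nat.cast_id,
    ← Fintype.card_subtype, ← Nat.card_eq_fintype_card]
  refine Nat.card_congr ⟨fun y => ⟨y.1.1.2, ?_⟩, fun v => ⟨⟨(σ v.1, v.1), h.1 v.1⟩, v.2, rfl⟩,
    ?_, ?_⟩
  · rw [← y.2.2]; exact y.2.1
  · rintro ⟨⟨⟨q, v⟩, hq⟩, h₁, h₂⟩
    change q = σ v at h₂
    subst h₂
    rfl
  · rintro v; rfl

end System

end States

/-! ## Expansions -/

section Expansions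

variable {ι : Type} {P : ι → ProcessType}

/-- The transition `k` of the router of `t`. -/
def routerLabel (t : ObsOf P) (k : RouterTrans) : ObsOf (expTypes P) := ⟨.inr t, ⟨k, trivial⟩⟩

/-- The first half of `t`. -/
def attemptLabel (t : ObsOf P) : ObsOf (expTypes P) :=
  ⟨.inl t.1, ⟨ProcessType.HalfTrans.attempt t.2, trivial⟩⟩

/-- The second half of `t`. -/
def commitLabel (t : ObsOf P) : ObsOf (expTypes P) :=
  ⟨.inl t.1, ⟨ProcessType.HalfTrans.commit t.2, trivial⟩⟩

/-- A place of the original process types. -/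
def origPlace (q : PlaceOf P) : PlaceOf (expTypes P) := ⟨.inl q.1, ProcessType.HalfPlace.orig q.2⟩

/-- The place between the two halves of `t`. -/
def midPlace (t : ObsOf P) : PlaceOf (expTypes P) := ⟨.inl t.1, ProcessType.HalfPlace.mid t.2⟩

/-- The place `k` of the router of `t`. -/
def routerPlace (t : ObsOf P) (k : RouterPlace) : PlaceOf (expTypes P) := ⟨.inr t, k⟩

theorem origPlace_inj {q q' : PlaceOf P} : origPlace q = origPlace q' ↔ q = q' := by
  refine ⟨fun h => ?_, fun h => by rw [h]⟩
  obtain ⟨p, q⟩ := q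
  obtain ⟨p', q'⟩ := q'
  obtain ⟨h₁, h₂⟩ := Sigma.mk.inj h
  cases h₁
  cases eq_of_heq h₂
  rfl

theorem midPlace_inj {t t' : ObsOf P} : midPlace t = midPlace t' ↔ t = t' := by
  refine ⟨fun h => ?_, fun h => by rw [h]⟩
  obtain ⟨p, q⟩ := t
  obtain ⟨p', q'⟩ := t'
  obtain ⟨h₁, h₂⟩ := Sigma.mk.inj h
  cases h₁
  cases eq_of_heq h₂
  rfl

theorem routerPlace_inj {t t' : ObsOf P} {k k' : RouterPlace} :
    routerPlace t k = routerPlace t' k' ↔ t = t' ∧ k = k' := by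
  refine ⟨fun h => ?_, by rintro ⟨rfl, rfl⟩; rfl⟩
  obtain ⟨h₁, h₂⟩ := Sigma.mk.inj h
  cases h₁
  exact ⟨rfl, eq_of_heq h₂⟩

theorem routerLabel_inj {t t' : ObsOf P} {k k' : RouterTrans} :
    routerLabel t k = routerLabel t' k' ↔ t = t' ∧ k = k' := by
  refine ⟨fun h => ?_, by rintro ⟨rfl, rfl⟩; rfl⟩
  obtain ⟨h₁, h₂⟩ := Sigma.mk.inj h
  cases h₁
  cases eq_of_heq h₂
  exact ⟨rfl, rfl⟩

theorem origPlace_ne_midPlace {q : PlaceOf P} {t : ObsOf P} : origPlace q ≠ midPlace t := by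
  intro h
  obtain ⟨p, q⟩ := q
  obtain ⟨p', t⟩ := t
  obtain ⟨h₁, h₂⟩ := Sigma.mk.inj h
  cases h₁
  cases eq_of_heq h₂

theorem preOf_attempt (t : ObsOf P) :
    preOf (expTypes P) (attemptLabel t).toTrans = origPlace (preOf P t.toTrans) := by
  obtain ⟨p, t⟩ := t
  have h : (P p).half.pre (.attempt t) = .orig ((P p).pre t.1) :=
    ProcessType.pre_eq ((P p).existsUnique_pre t.1).choose_spec.1
  exact congrArg (fun q => (⟨.inl p, q⟩ : PlaceOf (expTypes P))) h

theorem postOf_attempt (t : ObsOf P) :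
    postOf (expTypes P) (attemptLabel t).toTrans = midPlace t := by
  obtain ⟨p, t⟩ := t
  have h : (P p).half.post (.attempt t) = .mid t :=
    ProcessType.post_eq (by simp [ProcessType.half])
  exact congrArg (fun q => (⟨.inl p, q⟩ : PlaceOf (expTypes P))) h

theorem preOf_commit (t : ObsOf P) :
    preOf (expTypes P) (commitLabel t).toTrans = midPlace t := by
  obtain ⟨p, t⟩ := t
  have h : (P p).half.pre (.commit t) = .mid t :=
    ProcessType.pre_eq (by simp [ProcessType.half])
  exact congrArg (fun q => (⟨.inl p, q⟩ : PlaceOf (expTypes P))) h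

theorem postOf_commit (t : ObsOf P) :
    postOf (expTypes P) (commitLabel t).toTrans = origPlace (postOf P t.toTrans) := by
  obtain ⟨p, t⟩ := t
  have h : (P p).half.post (.commit t) = .orig ((P p).post t.1) :=
    ProcessType.post_eq ((P p).existsUnique_post t.1).choose_spec.1
  exact congrArg (fun q => (⟨.inl p, q⟩ : PlaceOf (expTypes P))) h

theorem preOf_router (t : ObsOf P) (k : RouterTrans) :
    preOf (expTypes P) (routerLabel t k).toTrans = routerPlace t k.src := by
  have h : router.pre k = k.src := ProcessType.pre_eq (by simp [router])
  exact congrArg (fun q => (⟨.inr t, q⟩ : PlaceOf (expTypes P))) h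

theorem postOf_router (t : ObsOf P) (k : RouterTrans) :
    postOf (expTypes P) (routerLabel t k).toTrans = routerPlace t k.tgt := by
  have h : router.post k = k.tgt := ProcessType.post_eq (by simp [router])
  exact congrArg (fun q => (⟨.inr t, q⟩ : PlaceOf (expTypes P))) h

/-- The internal transition `t` of a process type in its expansion. -/
def internalTransOf (t : TransOf P) (h : ¬ (P t.1).obs t.2) : TransOf (expTypes P) :=
  ⟨.inl t.1, ProcessType.HalfTrans.internal ⟨t.2, h⟩⟩

theorem preOf_internal (t : TransOf P) (ht : ¬ (P t.1).obs t.2) :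
    preOf (expTypes P) (internalTransOf t ht) = origPlace (preOf P t) := by
  obtain ⟨p, t⟩ := t
  have h : (P p).half.pre (.internal ⟨t, ht⟩) = .orig ((P p).pre t) :=
    ProcessType.pre_eq ((P p).existsUnique_pre t).choose_spec.1
  exact congrArg (fun q => (⟨.inl p, q⟩ : PlaceOf (expTypes P))) h

theorem postOf_internal (t : TransOf P) (ht : ¬ (P t.1).obs t.2) :
    postOf (expTypes P) (internalTransOf t ht) = origPlace (postOf P t) := by
  obtain ⟨p, t⟩ := t
  have h : (P p).half.post (.internal ⟨t, ht⟩) = .orig ((P p).post t) :=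
    ProcessType.post_eq ((P p).existsUnique_post t).choose_spec.1
  exact congrArg (fun q => (⟨.inl p, q⟩ : PlaceOf (expTypes P))) h

theorem not_obs_internalTransOf (t : TransOf P) (h : ¬ (P t.1).obs t.2) :
    ¬ (expTypes P (internalTransOf t h).1).obs (internalTransOf t h).2 := fun h => h

/-- Routers have no internal transitions, and both halves of an observable transition are
observable, so only copies of the original internal transitions remain. -/
theorem exists_internalTransOf (t : TransOf (expTypes P)) (h : ¬ (expTypes P t.1).obs t.2) :
    ∃ s hs, t = internalTransOf s hs := by
  obtain ⟨p | t, k⟩ := t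
  · rcases k with ⟨s, hs⟩ | s | s
    · exact ⟨⟨p, s⟩, hs, rfl⟩
    · exact absurd trivial h
    · exact absurd trivial h
  · exact absurd trivial h

theorem startOf_inl (p : ι) : startOf (expTypes P) (.inl p) = origPlace (startOf P p) := by
  have h : (P p).half.start = .orig (P p).start :=
    ProcessType.start_eq (by
      classical
      change 0 < (P p).init (P p).start
      simp [ProcessType.init_eq])
  exact congrArg (fun q => (⟨.inl p, q⟩ : PlaceOf (expTypes P))) h

theorem startOf_inr (t : ObsOf P) : startOf (expTypes P) (.inr t) = routerPlace t .idle := by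
  have h : router.start = .idle := ProcessType.start_eq (by simp [router])
  exact congrArg (fun q => (⟨.inr t, q⟩ : PlaceOf (expTypes P))) h

variable {Port Port' : Type} {ptype : Port → ι} {ptype' : Port' → ι ⊕ ObsOf P}

namespace System

/-- The router `x` of `t` sends requests to `y`. -/
def Fwd (S' : System (expTypes P) ptype') (t : ObsOf P) (x y : S'.V) : Prop :=
  S'.edge x (routerLabel t .fwd) (routerLabel t .recv) y

/-- The router `x` of `t` receives replies from `y`. -/
def Reply (S' : System (expTypes P) ptype') (t : ObsOf P) (x y : S'.V) : Prop :=
  S'.edge y (routerLabel t .reset) (routerLabel t .ack) x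

/-- The routers `x` of `t` and `y` of `t'` can jointly execute `(t, t')`. -/
def Exec (S' : System (expTypes P) ptype') (t t' : ObsOf P) (x y : S'.V) : Prop :=
  S'.edge x (routerLabel t .exec) (routerLabel t' .exec) y

end System

/-- The structure of `S'` as an expansion of `S`: the vertex `v` of `S` is implemented by
`half v`, and `At v t i x` says that `x` is the `i`-th router on the path that the requests of `v`
to execute `t` follow. -/
structure Expansion (S : System P ptype) (S' : System (expTypes P) ptype') where
  half : S.V → S'.V
  At : S.V → ObsOf P → ℕ → S'.V → Prop
  half_inj : Function.Injective half
  half_proc : ∀ v, S'.proc (half v) = .inl (S.proc v)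
  half_surj : ∀ x p, S'.proc x = .inl p → ∃ v, x = half v
  edge_cases : ∀ x a b y, S'.edge x a b y →
    (∃ v t, x = half v ∧ a = attemptLabel t ∧ b = routerLabel t .recv ∧ At v t 0 y) ∨
    (∃ v t, y = half v ∧ a = routerLabel t .reset ∧ b = commitLabel t ∧ At v t 0 x) ∨
    -- No path is mentioned here: an edge created for a port that labels no vertex yields routers
    -- that lie on no path, and these may be linked further.
    (∃ t, a = routerLabel t .fwd ∧ b = routerLabel t .recv) ∨
    (∃ t, a = routerLabel t .reset ∧ b = routerLabel t .ack ∧ S'.Fwd t y x) ∨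
    (∃ t t', a = routerLabel t .exec ∧ b = routerLabel t' .exec)
  attempt_edge : ∀ v t x, At v t 0 x → S'.edge (half v) (attemptLabel t) (routerLabel t .recv) x
  commit_edge : ∀ v t x, At v t 0 x → S'.edge x (routerLabel t .reset) (commitLabel t) (half v)
  at_zero : ∀ v (t : ObsOf P), t.1 = S.proc v → ∃ x, At v t 0 x
  at_succ : ∀ v t i y, At v t (i + 1) y → ∃ x, At v t i x ∧ S'.Fwd t x y ∧ S'.Reply t x y
  -- With `at_func`, a router on a path has at most one target for its requests, whichever vertex
  -- they come from.
  at_fwd : ∀ v t i x y, At v t i x → S'.Fwd t x y → At v t (i + 1) y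
  at_func : ∀ v t i x y, At v t i x → At v t i y → x = y
  at_inj : ∀ v t i j x, At v t i x → At v t j x → i = j
  -- The vertices and levels are arbitrary because routers are shared: every vertex whose path
  -- visits `x` must be allowed to use this edge.
  exec_sound : ∀ v w t t' i j x y, S'.Exec t t' x y → At v t i x → At w t' j y → S.edge v t t' w
  exec_complete : ∀ v w t t', S.edge v t t' w →
    ∃ i j x y, At v t i x ∧ At w t' j y ∧ S'.Exec t t' x y

/-- The phase of a vertex: `none` if it is not executing an observable transition, otherwise the
transition, the level of the router that handles it, and whether it has been executed. -/
abbrev Phase (P : ι → ProcessType) : Type := Option (ObsOf P × ℕ × Bool)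

/-- The place of the router that handles a request. -/
def headPlace : Bool → RouterPlace
  | false => .active
  | true => .reply

/-- The place of the vertex that represents a process. -/
def halfState : Phase P → PlaceOf P → PlaceOf (expTypes P)
  | none, q => origPlace q
  | some (t, _, _), _ => midPlace t

/-! ### The invariant and its preservation by each kind of step -/

namespace Expansion

variable {S : System P ptype} {S' : System (expTypes P) ptype'} (E : Expansion S S')

theorem at_proc {v : S.V} {t : ObsOf P} {i : ℕ} {x : S'.V} (h : E.At v t i x) :
    S'.proc x = .inr t := by
  cases i with
  | zero => exact (S'.edge_src _ _ _ _ (E.commit_edge _ _ _ h)).symm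
  | succ i =>
    obtain ⟨_, -, h, -⟩ := E.at_succ _ _ _ _ h
    exact (S'.edge_tgt _ _ _ _ h).symm

theorem at_ne_half {v w : S.V} {t : ObsOf P} {i : ℕ} {x : S'.V} (h : E.At v t i x) :
    x ≠ E.half w := by
  rintro rfl
  have := (E.at_proc h).symm.trans (E.half_proc w)
  cases this

/-- The router `x` takes part in the handling of the request of `v`, whose phase is `o`. -/
def Engages (v : S.V) (o : Phase P) (x : S'.V) : Prop :=
  ∃ t k c i, o = some (t, k, c) ∧ E.At v t i x ∧ i ≤ k

theorem not_engages_none {v : S.V} {x : S'.V} : ¬ E.Engages v none x := by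
  rintro ⟨_, _, _, _, h, -⟩
  cases h

theorem engages_some {v : S.V} {t : ObsOf P} {k : ℕ} {c : Bool} {x : S'.V} :
    E.Engages v (some (t, k, c)) x ↔ ∃ i ≤ k, E.At v t i x := by
  constructor
  · rintro ⟨_, _, _, i, ⟨⟩, h, hi⟩
    exact ⟨i, hi, h⟩
  · rintro ⟨i, hi, h⟩
    exact ⟨_, _, _, i, rfl, h, hi⟩

/-- The vertex `v` in state `q` and phase `o` is represented in the state `σ'`. -/
structure LocalInv (σ' : S'.V → PlaceOf (expTypes P)) (v : S.V) (q : PlaceOf P) (o : Phase P) :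
    Prop where
  half_eq : σ' (E.half v) = halfState o q
  wait : ∀ t k c i x, o = some (t, k, c) → E.At v t i x → i < k → σ' x = routerPlace t .wait
  head : ∀ t k c x, o = some (t, k, c) → E.At v t k x → σ' x = routerPlace t (headPlace c)
  exists_head : ∀ t k c, o = some (t, k, c) → ∃ x, E.At v t k x
  -- The represented state changes when the transition is executed at the head, not at the commit;
  -- the process itself rests in `mid` all the while.
  val : ∀ t k c, o = some (t, k, c) → q = cond c (postOf P t.toTrans) (preOf P t.toTrans)

/-- The state `σ`, in the phases `b`, is represented by the state `σ'`. -/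
structure Inv (σ : S.V → PlaceOf P) (σ' : S'.V → PlaceOf (expTypes P)) (b : S.V → Phase P) :
    Prop where
  localInv : ∀ v, E.LocalInv σ' v (σ v) (b v)
  idle : ∀ x t, S'.proc x = .inr t → (∀ v, ¬ E.Engages v (b v) x) → σ' x = routerPlace t .idle
  unique : ∀ v w x, E.Engages v (b v) x → E.Engages w (b w) x → v = w

variable {E} {σ : S.V → PlaceOf P} {σ' : S'.V → PlaceOf (expTypes P)} {b : S.V → Phase P}

theorem LocalInv.ne_idle {v : S.V} {q : PlaceOf P} {o : Phase P} (h : E.LocalInv σ' v q o)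
    {x : S'.V} (hx : E.Engages v o x) (t : ObsOf P) : σ' x ≠ routerPlace t .idle := by
  obtain ⟨s, k, c, i, rfl, hi, hik⟩ := hx
  rcases hik.lt_or_eq with hlt | rfl
  · rw [h.wait _ _ _ _ _ rfl hi hlt]
    intro e
    cases (routerPlace_inj.1 e).2
  · rw [h.head _ _ _ _ rfl hi]
    intro e
    cases c <;> cases (routerPlace_inj.1 e).2

/-- Engaged routers wait, are active or reply. Hence a router that is able to receive a request is
not used by anyone, which keeps `unique` true when it is taken. -/
theorem Inv.not_engages_of_idle (h : E.Inv σ σ' b) {x : S'.V} {t : ObsOf P}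
    (hx : σ' x = routerPlace t .idle) (v : S.V) : ¬ E.Engages v (b v) x :=
  fun he => (h.localInv v).ne_idle he t hx

open Classical in
-- Frame rule for a step that concerns only the request of `v`. Newly engaged routers must have been
-- free, released ones must become idle, and everything else apart from `half v` must be untouched;
-- the other vertices then keep their invariant.
theorem Inv.update (h : E.Inv σ σ' b) {v : S.V} {q : PlaceOf P} {o : Phase P}
    {σ'' : S'.V → PlaceOf (expTypes P)} (hl : E.LocalInv σ'' v q o)
    (hfree : ∀ x, E.Engages v o x → ¬ E.Engages v (b v) x → ∀ w, ¬ E.Engages w (b w) x)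
    (hidle : ∀ x t, S'.proc x = .inr t → E.Engages v (b v) x → ¬ E.Engages v o x →
      σ'' x = routerPlace t .idle)
    (hsame : ∀ x, x ≠ E.half v → ¬ E.Engages v (b v) x → ¬ E.Engages v o x → σ'' x = σ' x) :
    E.Inv (Function.update σ v q) σ'' (Function.update b v o) := by
  -- A router engaged by another vertex is engaged by `v` neither before nor after the step, so
  -- `hsame` applies to it.
  have hother : ∀ x w, w ≠ v → E.Engages w (b w) x →
      ¬ E.Engages v (b v) x ∧ ¬ E.Engages v o x := by
    intro x w hw hx
    have h₁ : ¬ E.Engages v (b v) x := fun h₂ => hw (h.unique _ _ _ hx h₂)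
    exact ⟨h₁, fun h₂ => hfree x h₂ h₁ w hx⟩
  refine ⟨fun w => ?_, fun x t hx hne => ?_, ?_⟩
  · by_cases hw : w = v
    · subst hw; simpa using hl
    · rw [Function.update_of_ne hw, Function.update_of_ne hw]
      have hr : ∀ t k c i x, b w = some (t, k, c) → E.At w t i x → i ≤ k → σ'' x = σ' x := by
        intro t k c i x hb hx hi
        obtain ⟨h₁, h₂⟩ := hother x w hw ⟨_, _, _, _, hb, hx, hi⟩
        exact hsame x (E.at_ne_half hx) h₁ h₂
      have hw' := h.localInv w
      refine ⟨?_, ?_, ?_, hw'.exists_head, hw'.val⟩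
      · rw [hsame, hw'.half_eq]
        · exact fun e => hw (E.half_inj e)
        · rintro ⟨_, _, _, _, -, hx, -⟩; exact E.at_ne_half hx rfl
        · rintro ⟨_, _, _, _, -, hx, -⟩; exact E.at_ne_half hx rfl
      · intro t k c i x hb hx hi
        rw [hr t k c i x hb hx hi.le]
        exact hw'.wait t k c i x hb hx hi
      · intro t k c x hb hx
        rw [hr t k c k x hb hx le_rfl]
        exact hw'.head t k c x hb hx
  · have ho : ¬ E.Engages v o x := by simpa using hne v
    by_cases hv : E.Engages v (b v) x
    · exact hidle x t hx hv ho
    · rw [hsame x _ hv ho]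
      · refine h.idle x t hx fun w => ?_
        by_cases hw : w = v
        · subst hw; exact hv
        · simpa [hw] using hne w
      · rintro rfl
        have := hx.symm.trans (E.half_proc v)
        cases this
  · intro u w x hu hw
    by_cases h₁ : u = v <;> by_cases h₂ : w = v
    · rw [h₁, h₂]
    · subst h₁
      rw [Function.update_self] at hu
      rw [Function.update_of_ne h₂] at hw
      exact absurd hu (hother x w h₂ hw).2
    · subst h₂
      rw [Function.update_self] at hw
      rw [Function.update_of_ne h₁] at hu
      exact absurd hw (hother x u h₁ hu).2
    · rw [Function.update_of_ne h₁] at hu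
      rw [Function.update_of_ne h₂] at hw
      exact h.unique _ _ _ hu hw

open Classical in
theorem Inv.internal (h : E.Inv σ σ' b) {v : S.V} (hb : b v = none) (q : PlaceOf P) :
    E.Inv (Function.update σ v q) (Function.update σ' (E.half v) (origPlace q)) b := by
  have := h.update (v := v) (q := q) (o := none)
    (σ'' := Function.update σ' (E.half v) (origPlace q))
    ⟨by simp [halfState], by simp, by simp, by simp, by simp⟩
    (fun x hx => absurd hx E.not_engages_none)
    (fun x t _ hx => by rw [hb] at hx; exact absurd hx E.not_engages_none)
    (fun x hx _ _ => by rw [Function.update_of_ne hx])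
  rwa [← hb, Function.update_eq_self] at this

open Classical in
theorem Inv.attempt (h : E.Inv σ σ' b) {v : S.V} (hb : b v = none) {t : ObsOf P} {x : S'.V}
    (hq : σ v = preOf P t.toTrans) (hx : E.At v t 0 x) (hi : σ' x = routerPlace t .idle) :
    E.Inv σ (Function.update (Function.update σ' (E.half v) (midPlace t)) x
      (routerPlace t .active)) (Function.update b v (some (t, 0, false))) := by
  have hne := E.at_ne_half (w := v) hx
  have := h.update (v := v) (q := σ v) (o := some (t, 0, false))
    (σ'' := Function.update (Function.update σ' (E.half v) (midPlace t)) x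
      (routerPlace t .active)) ?_ ?_ ?_ ?_
  · rwa [Function.update_eq_self] at this
  · refine ⟨by simp [hne.symm, halfState], ?_, ?_, ?_, ?_⟩
    · rintro _ _ _ i y ⟨⟩ - h; omega
    · rintro _ _ _ y ⟨⟩ hy
      obtain rfl := E.at_func _ _ _ _ _ hx hy
      simp [headPlace]
    · rintro _ _ _ ⟨⟩; exact ⟨x, hx⟩
    · rintro _ _ _ ⟨⟩; exact hq
  · intro y hy _
    obtain ⟨i, hi', hy⟩ := E.engages_some.1 hy
    obtain rfl : i = 0 := by omega
    obtain rfl := E.at_func _ _ _ _ _ hx hy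
    exact h.not_engages_of_idle hi
  · intro y _ _ hy
    rw [hb] at hy
    exact absurd hy E.not_engages_none
  · intro y hy _ hy'
    rw [Function.update_of_ne, Function.update_of_ne hy]
    rintro rfl
    exact hy' (E.engages_some.2 ⟨0, le_rfl, hx⟩)

open Classical in
-- The only newly engaged router is `y`, which was idle and hence free. It is not a lower router of
-- the same path because levels on a path are unique; `x` joins the waiting ones.
theorem Inv.fwd (h : E.Inv σ σ' b) {v : S.V} {t : ObsOf P} {k : ℕ} {x y : S'.V}
    (hb : b v = some (t, k, false)) (hx : E.At v t k x) (hy : E.At v t (k + 1) y)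
    (hi : σ' y = routerPlace t .idle) :
    E.Inv σ (Function.update (Function.update σ' x (routerPlace t .wait)) y
      (routerPlace t .active)) (Function.update b v (some (t, k + 1, false))) := by
  have hl := h.localInv v
  rw [hb] at hl
  have hxy : x ≠ y := by
    rintro rfl
    have := E.at_inj _ _ _ _ _ hx hy
    omega
  have := h.update (v := v) (q := σ v) (o := some (t, k + 1, false))
    (σ'' := Function.update (Function.update σ' x (routerPlace t .wait)) y
      (routerPlace t .active)) ?_ ?_ ?_ ?_
  · rwa [Function.update_eq_self] at this
  · refine ⟨?_, ?_, ?_, ?_, ?_⟩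
    · rw [Function.update_of_ne (E.at_ne_half hy).symm, Function.update_of_ne (E.at_ne_half hx).symm]
      exact hl.half_eq
    · rintro _ _ _ i z ⟨⟩ hz hik
      have hzy : z ≠ y := by
        rintro rfl
        have := E.at_inj _ _ _ _ _ hz hy
        omega
      rw [Function.update_of_ne hzy]
      by_cases hzx : z = x
      · subst hzx; simp
      · rw [Function.update_of_ne hzx]
        refine hl.wait _ _ _ i z rfl hz ?_
        by_contra hik'
        obtain rfl : i = k := by omega
        exact hzx (E.at_func _ _ _ _ _ hz hx)
    · rintro _ _ _ z ⟨⟩ hz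
      obtain rfl := E.at_func _ _ _ _ _ hy hz
      simp [headPlace]
    · rintro _ _ _ ⟨⟩; exact ⟨y, hy⟩
    · rintro _ _ _ ⟨⟩; exact hl.val _ _ _ rfl
  · intro z hz hz'
    rw [hb] at hz'
    obtain ⟨i, hi', hz⟩ := E.engages_some.1 hz
    rcases hi'.lt_or_eq with hlt | rfl
    · exact absurd (E.engages_some.2 ⟨i, by omega, hz⟩) hz'
    · obtain rfl := E.at_func _ _ _ _ _ hy hz
      exact h.not_engages_of_idle hi
  · intro z _ _ hz hz'
    rw [hb] at hz
    obtain ⟨i, hi', hz⟩ := E.engages_some.1 hz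
    exact absurd (E.engages_some.2 ⟨i, by omega, hz⟩) hz'
  · intro z _ _ hz'
    rw [Function.update_of_ne, Function.update_of_ne]
    · rintro rfl
      exact hz' (E.engages_some.2 ⟨k, by omega, hx⟩)
    · rintro rfl
      exact hz' (E.engages_some.2 ⟨k + 1, le_rfl, hy⟩)

open Classical in
-- One half of a joint execution: the set of engaged routers stays the same, and the represented
-- state of `v` moves. An `exec` edge uses this once for each end.
theorem Inv.exec (h : E.Inv σ σ' b) {v : S.V} {t : ObsOf P} {k : ℕ} {x : S'.V}
    (hb : b v = some (t, k, false)) (hx : E.At v t k x) :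
    E.Inv (Function.update σ v (postOf P t.toTrans))
      (Function.update σ' x (routerPlace t .reply)) (Function.update b v (some (t, k, true))) := by
  have hl := h.localInv v
  rw [hb] at hl
  have he : ∀ z, E.Engages v (some (t, k, true)) z ↔ E.Engages v (b v) z := by
    intro z; rw [hb, engages_some, engages_some]
  refine h.update ?_ ?_ ?_ ?_
  · refine ⟨?_, ?_, ?_, ?_, ?_⟩
    · rw [Function.update_of_ne (E.at_ne_half hx).symm]
      exact hl.half_eq
    · rintro _ _ _ i z ⟨⟩ hz hik
      have hzx : z ≠ x := by
        rintro rfl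
        have := E.at_inj _ _ _ _ _ hz hx
        omega
      rw [Function.update_of_ne hzx]
      exact hl.wait _ _ _ i z rfl hz hik
    · rintro _ _ _ z ⟨⟩ hz
      obtain rfl := E.at_func _ _ _ _ _ hx hz
      simp [headPlace]
    · rintro _ _ _ ⟨⟩; exact ⟨x, hx⟩
    · rintro _ _ _ ⟨⟩; rfl
  · intro z hz hz'
    exact absurd ((he z).1 hz) hz'
  · intro z _ _ hz hz'
    exact absurd ((he z).2 hz) hz'
  · intro z _ _ hz'
    rw [Function.update_of_ne]
    rintro rfl
    exact hz' (E.engages_some.2 ⟨k, le_rfl, hx⟩)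

open Classical in
-- The reply moves one level down: `y` is released, the waiting `x` becomes the head, and no router
-- is newly engaged.
theorem Inv.ack (h : E.Inv σ σ' b) {v : S.V} {t : ObsOf P} {k : ℕ} {x y : S'.V}
    (hb : b v = some (t, k + 1, true)) (hx : E.At v t k x) (hy : E.At v t (k + 1) y) :
    E.Inv σ (Function.update (Function.update σ' y (routerPlace t .idle)) x
      (routerPlace t .reply)) (Function.update b v (some (t, k, true))) := by
  have hl := h.localInv v
  rw [hb] at hl
  have hxy : y ≠ x := by
    rintro rfl
    have := E.at_inj _ _ _ _ _ hx hy
    omega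
  have := h.update (v := v) (q := σ v) (o := some (t, k, true))
    (σ'' := Function.update (Function.update σ' y (routerPlace t .idle)) x
      (routerPlace t .reply)) ?_ ?_ ?_ ?_
  · rwa [Function.update_eq_self] at this
  · refine ⟨?_, ?_, ?_, ?_, ?_⟩
    · rw [Function.update_of_ne (E.at_ne_half hx).symm, Function.update_of_ne (E.at_ne_half hy).symm]
      exact hl.half_eq
    · rintro _ _ _ i z ⟨⟩ hz hik
      have hzy : z ≠ y := by
        rintro rfl
        have := E.at_inj _ _ _ _ _ hz hy
        omega
      have hzx : z ≠ x := by
        rintro rfl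
        have := E.at_inj _ _ _ _ _ hz hx
        omega
      rw [Function.update_of_ne hzx, Function.update_of_ne hzy]
      exact hl.wait _ _ _ i z rfl hz (by omega)
    · rintro _ _ _ z ⟨⟩ hz
      obtain rfl := E.at_func _ _ _ _ _ hx hz
      simp [headPlace]
    · rintro _ _ _ ⟨⟩; exact ⟨x, hx⟩
    · rintro _ _ _ ⟨⟩; exact hl.val _ _ _ rfl
  · intro z hz hz'
    rw [hb] at hz'
    obtain ⟨i, hi', hz⟩ := E.engages_some.1 hz
    exact absurd (E.engages_some.2 ⟨i, by omega, hz⟩) hz'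
  · intro z s hs hz hz'
    rw [hb] at hz
    obtain ⟨i, hi', hz⟩ := E.engages_some.1 hz
    rcases hi'.lt_or_eq with hlt | rfl
    · exact absurd (E.engages_some.2 ⟨i, by omega, hz⟩) hz'
    · obtain rfl := E.at_func _ _ _ _ _ hy hz
      cases hs.symm.trans (E.at_proc hz)
      simp [hxy]
  · intro z _ hz hz'
    rw [hb] at hz
    rw [Function.update_of_ne, Function.update_of_ne]
    · rintro rfl
      exact hz (E.engages_some.2 ⟨k + 1, le_rfl, hy⟩)
    · rintro rfl
      exact hz' (E.engages_some.2 ⟨k, le_rfl, hx⟩)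

open Classical in
theorem Inv.commit (h : E.Inv σ σ' b) {v : S.V} {t : ObsOf P} {x : S'.V}
    (hb : b v = some (t, 0, true)) (hx : E.At v t 0 x) :
    E.Inv σ (Function.update (Function.update σ' x (routerPlace t .idle)) (E.half v)
      (origPlace (postOf P t.toTrans))) (Function.update b v none) := by
  have hl := h.localInv v
  rw [hb] at hl
  have := h.update (v := v) (q := σ v) (o := none)
    (σ'' := Function.update (Function.update σ' x (routerPlace t .idle)) (E.half v)
      (origPlace (postOf P t.toTrans))) ?_ ?_ ?_ ?_
  · rwa [Function.update_eq_self] at this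
  · refine ⟨?_, by simp, by simp, by simp, by simp⟩
    rw [Function.update_self, hl.val _ _ _ rfl]
    rfl
  · exact fun x hx => absurd hx E.not_engages_none
  · intro z s hs hz _
    rw [hb] at hz
    obtain ⟨i, hi', hz⟩ := E.engages_some.1 hz
    obtain rfl : i = 0 := by omega
    obtain rfl := E.at_func _ _ _ _ _ hx hz
    cases hs.symm.trans (E.at_proc hz)
    rw [Function.update_of_ne (E.at_ne_half hx), Function.update_self]
  · intro z hz hz' _
    rw [hb] at hz'
    rw [Function.update_of_ne hz, Function.update_of_ne]
    rintro rfl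
    exact hz' (E.engages_some.2 ⟨0, le_rfl, hx⟩)

end Expansion

end Expansions

/-! ### Counting labeled places and simulating steps in both directions -/

section Simulation

variable {ι : Type} {P : ι → ProcessType} {Port Port' : Type} {ptype : Port → ι}
  {ptype' : Port' → ι ⊕ ObsOf P}

namespace Expansion

variable {S : System P ptype} {S' : System (expTypes P) ptype'} {E : Expansion S S'}
  {σ σ₂ : S.V → PlaceOf P} {σ' σ₂' : S'.V → PlaceOf (expTypes P)} {b : S.V → Phase P}

/-- `Tok` sends a vertex to the place holder of its state: its process when at rest, its head router
otherwise. The labels agree there, the map is injective because engaged routers are not shared, and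
it reaches every labeled token because `mid`, `wait` and `idle` are unlabeled. -/
theorem Inv.card_eq (h : E.Inv σ σ' b) (L : PlaceOf P → Option Var) (z : Var) :
    Nat.card {v // L (σ v) = some z} = Nat.card {x // expLabeling L (σ' x) = some z} := by
  let Tok : S.V → S'.V → Prop := fun v x =>
    (b v = none ∧ x = E.half v) ∨ ∃ t k c, b v = some (t, k, c) ∧ E.At v t k x
  have ex : ∀ v, ∃ x, Tok v x := by
    intro v
    rcases hb : b v with _ | ⟨t, k, c⟩
    · exact ⟨_, Or.inl ⟨hb, rfl⟩⟩
    · obtain ⟨x, hx⟩ := (h.localInv v).exists_head _ _ _ hb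
      exact ⟨x, Or.inr ⟨t, k, c, hb, hx⟩⟩
  have func : ∀ v x y, Tok v x → Tok v y → x = y := by
    rintro v x y (⟨hb, rfl⟩ | ⟨t, k, c, hb, hx⟩) (⟨hb', rfl⟩ | ⟨t', k', c', hb', hy⟩)
    · rfl
    · simp [hb] at hb'
    · simp [hb] at hb'
    · cases hb.symm.trans hb'
      exact E.at_func _ _ _ _ _ hx hy
  have inj : ∀ v w x, Tok v x → Tok w x → v = w := by
    rintro v w x (⟨hb, rfl⟩ | ⟨t, k, c, hb, hx⟩) (⟨hb', h'⟩ | ⟨t', k', c', hb', hy⟩)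
    · exact E.half_inj h'
    · exact absurd rfl (E.at_ne_half hy)
    · exact absurd h' (E.at_ne_half hx)
    · exact h.unique _ _ x ⟨_, _, _, _, hb, hx, le_rfl⟩ ⟨_, _, _, _, hb', hy, le_rfl⟩
  have lab : ∀ v x, Tok v x → expLabeling L (σ' x) = L (σ v) := by
    rintro v x (⟨hb, rfl⟩ | ⟨t, k, c, hb, hx⟩)
    · rw [(h.localInv v).half_eq, hb]; rfl
    · rw [(h.localInv v).head _ _ _ _ hb hx, (h.localInv v).val _ _ _ hb]
      cases c <;> rfl
  have surj : ∀ x, expLabeling L (σ' x) ≠ none → ∃ v, Tok v x := by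
    intro x hx
    rcases hp : S'.proc x with p | t
    · obtain ⟨v, rfl⟩ := E.half_surj x p hp
      refine ⟨v, Or.inl ⟨?_, rfl⟩⟩
      rw [(h.localInv v).half_eq] at hx
      rcases hb : b v with _ | ⟨t, k, c⟩
      · rfl
      · rw [hb] at hx; exact absurd rfl hx
    · by_contra hne
      by_cases he : ∃ v, E.Engages v (b v) x
      · obtain ⟨v, t', k, c, i, hb, hi, hik⟩ := he
        rcases hik.lt_or_eq with hlt | rfl
        · rw [(h.localInv v).wait _ _ _ _ _ hb hi hlt] at hx
          exact hx rfl
        · exact hne ⟨v, Or.inr ⟨_, _, _, hb, hi⟩⟩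
      · rw [h.idle x t hp (fun v hv => he ⟨v, hv⟩)] at hx
        exact hx rfl
  choose tok htok using ex
  refine Nat.card_congr (Equiv.ofBijective
    (fun v => (⟨tok v.1, (lab _ _ (htok v.1)).trans v.2⟩ : {x // expLabeling L (σ' x) = some z}))
    ⟨?_, ?_⟩)
  · intro v w hvw
    have e : tok v.1 = tok w.1 := congrArg Subtype.val hvw
    exact Subtype.ext (inj _ _ _ (htok v.1) (e ▸ htok w.1))
  · rintro ⟨x, hx⟩
    obtain ⟨v, hv⟩ := surj x (by rw [hx]; simp)
    exact ⟨⟨v, (lab v x hv).symm.trans hx⟩, Subtype.ext (func _ _ _ (htok v) hv)⟩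

/-! ### Steps of the expansion -/

theorem Inv.of_half_orig (h : E.Inv σ σ' b) {v : S.V} {q : PlaceOf P}
    (hq : σ' (E.half v) = origPlace q) : b v = none ∧ σ v = q := by
  rw [(h.localInv v).half_eq] at hq
  rcases hb : b v with _ | ⟨t, k, c⟩
  · rw [hb] at hq
    exact ⟨rfl, origPlace_inj.1 hq⟩
  · rw [hb] at hq
    exact absurd hq.symm origPlace_ne_midPlace

theorem Inv.of_half_mid (h : E.Inv σ σ' b) {v : S.V} {t : ObsOf P}
    (hq : σ' (E.half v) = midPlace t) : ∃ k c, b v = some (t, k, c) := by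
  rw [(h.localInv v).half_eq] at hq
  rcases hb : b v with _ | ⟨t', k, c⟩
  · rw [hb] at hq
    exact absurd hq origPlace_ne_midPlace
  · rw [hb] at hq
    obtain rfl := midPlace_inj.1 hq
    exact ⟨k, c, rfl⟩

theorem Inv.exists_engages (h : E.Inv σ σ' b) {x : S'.V} {t : ObsOf P} {k : RouterPlace}
    (hp : S'.proc x = .inr t) (hx : σ' x = routerPlace t k) (hk : k ≠ .idle) :
    ∃ v l c i, b v = some (t, l, c) ∧ E.At v t i x ∧ i ≤ l := by
  by_contra hne
  have := h.idle x t hp fun v hv => by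
    obtain ⟨t', l, c, i, hb, hi, hil⟩ := hv
    cases hp.symm.trans (E.at_proc hi)
    exact hne ⟨v, l, c, i, hb, hi, hil⟩
  exact hk (routerPlace_inj.1 (hx.symm.trans this)).2

/-- Below the head all routers wait, so `active` or `reply` identifies the head and tells whether
the transition has been executed. -/
theorem Inv.head_of_place (h : E.Inv σ σ' b) {x : S'.V} {t : ObsOf P} {c : Bool}
    (hx : σ' x = routerPlace t (headPlace c)) {v : S.V} {l i : ℕ} {c' : Bool}
    (hb : b v = some (t, l, c')) (hi : E.At v t i x) (hil : i ≤ l) : l = i ∧ c' = c := by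
  rcases hil.lt_or_eq with hlt | rfl
  · rw [(h.localInv v).wait _ _ _ _ _ hb hi hlt] at hx
    cases c <;> cases (routerPlace_inj.1 hx).2
  · rw [(h.localInv v).head _ _ _ _ hb hi] at hx
    refine ⟨rfl, ?_⟩
    cases c <;> cases c' <;> first | rfl | cases (routerPlace_inj.1 hx).2

theorem Inv.exists_head_of_place (h : E.Inv σ σ' b) {x : S'.V} {t : ObsOf P} {c : Bool}
    (hp : S'.proc x = .inr t) (hx : σ' x = routerPlace t (headPlace c)) :
    ∃ v k, b v = some (t, k, c) ∧ E.At v t k x := by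
  obtain ⟨v, l, c', i, hb, hi, hil⟩ := h.exists_engages hp hx (by cases c <;> simp [headPlace])
  obtain ⟨rfl, rfl⟩ := h.head_of_place hx hb hi hil
  exact ⟨v, l, hb, hi⟩

/-- The weight of a phase in the termination measure of the steps that are not observed. -/
def weight (K : ℕ) : Phase P → ℕ
  -- The silent life cycle read downwards: replies descend from `K + 2 + k` to `K + 2`, the commit
  -- gives `K + 1`, the attempt `K`, and forwarding `K - k`. Only `exec` moves up.
  | none => K + 1
  | some (_, k, false) => K - k
  | some (_, k, true) => K + 2 + k

/-- The termination measure of the steps that are not observed. -/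
noncomputable def potential (K : ℕ) (b : S.V → Phase P) : ℕ :=
  (@Finset.univ S.V (Fintype.ofFinite S.V)).sum fun v => weight K (b v)

open Classical in
theorem potential_update_lt {K : ℕ} {b : S.V → Phase P} {v : S.V} {o : Phase P}
    (h : weight K o < weight K (b v)) :
    potential (S := S) K (Function.update b v o) < potential K b := by
  refine Finset.sum_lt_sum (fun w _ => ?_) ⟨v, @Finset.mem_univ _ (_) _, by simpa using h⟩
  by_cases hw : w = v
  · subst hw; simpa using h.le
  · simp [hw]

/-- By `at_inj` each triple of a vertex, a transition and a router has at most one level, and there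
are finitely many triples. -/
theorem exists_level_bound [Finite ι] (E : Expansion S S') :
    ∃ K, ∀ v t i x, E.At v t i x → i ≤ K := by
  have hf : (⋃ y : S.V × ObsOf P × S'.V, {i | E.At y.1 y.2.1 i y.2.2}).Finite :=
    Set.finite_iUnion fun y => Set.Subsingleton.finite fun i hi j hj => E.at_inj _ _ _ _ _ hi hj
  obtain ⟨K, hK⟩ := hf.bddAbove
  exact ⟨K, fun v t i x h => hK (Set.mem_iUnion.2 ⟨(v, t, x), h⟩)⟩

/-- The label of the edge determines the kind of step. Attempt, commit, forward and acknowledge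
change one phase and lower its weight; `exec` edges and internal transitions are steps of the
system. -/
theorem Inv.backward (h : E.Inv σ σ' b) {K : ℕ} (hK : ∀ v t i x, E.At v t i x → i ≤ K)
    (hs : S'.Step σ' σ₂') :
    (∃ σ₂ b₂, S.Step σ σ₂ ∧ E.Inv σ₂ σ₂' b₂) ∨
      ∃ b₂, E.Inv σ σ₂' b₂ ∧ potential (S := S) K b₂ < potential K b := by
  classical
  rcases hs with ⟨x, s, s', y, he, e₁, e₂, rfl⟩ | ⟨x, s, hs, ho, e₁, rfl⟩
  · have hx := S'.edge_src _ _ _ _ he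
    have hy := S'.edge_tgt _ _ _ _ he
    rcases E.edge_cases _ _ _ _ he with ⟨v, t, rfl, rfl, rfl, hv⟩ | ⟨v, t, rfl, rfl, rfl, hv⟩ |
      ⟨t, rfl, rfl⟩ | ⟨t, rfl, rfl, hf⟩ | ⟨t, t', rfl, rfl⟩
    · right
      rw [preOf_attempt] at e₁
      rw [preOf_router] at e₂
      obtain ⟨hb, hq⟩ := h.of_half_orig e₁
      refine ⟨_, ?_, potential_update_lt (v := v) (o := some (t, 0, false)) ?_⟩
      · rw [postOf_attempt, postOf_router]
        exact h.attempt hb hq hv e₂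
      · rw [hb]; simp [weight]
    · right
      rw [preOf_router] at e₁
      rw [preOf_commit] at e₂
      obtain ⟨k, c, hb⟩ := h.of_half_mid e₂
      -- The router at level zero replies, so it is the head: the reply has come all the way down.
      obtain ⟨rfl, rfl⟩ := h.head_of_place (c := true) e₁ hb hv (Nat.zero_le _)
      refine ⟨_, ?_, potential_update_lt (v := v) (o := none) ?_⟩
      · rw [postOf_commit, postOf_router]
        exact h.commit hb hv
      · rw [hb]; simp [weight]
    · right
      rw [preOf_router] at e₁ e₂
      obtain ⟨v, k, hb, hv⟩ := h.exists_head_of_place (c := false) hx.symm e₁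
      have hv' := E.at_fwd _ _ _ _ _ hv he
      refine ⟨_, ?_, potential_update_lt (v := v) (o := some (t, k + 1, false)) ?_⟩
      · rw [postOf_router, postOf_router]
        exact h.fwd hb hv hv' e₂
      -- The bound gives `k + 1 ≤ K`, so the truncated difference `K - k` really decreases.
      · have := hK _ _ _ _ hv'
        rw [hb]; simp only [weight]; omega
    · right
      rw [preOf_router] at e₁ e₂
      obtain ⟨v, l, c, i, hb, hv, hi⟩ := h.exists_engages hy.symm e₂ (by simp [RouterTrans.src])
      have hlt : i < l := by
        rcases hi.lt_or_eq with hlt | rfl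
        · exact hlt
        · rw [(h.localInv v).head _ _ _ _ hb hv] at e₂
          cases c <;> cases (routerPlace_inj.1 e₂).2
      -- A reply edge comes with a forward edge the other way. So the replying router is next on the
      -- path of the very vertex whose request waits here, and the reply goes to the right
      -- requester.
      have hv' := E.at_fwd _ _ _ _ _ hv hf
      obtain ⟨rfl, rfl⟩ := h.head_of_place (c := true) e₁ hb hv' hlt
      refine ⟨_, ?_, potential_update_lt (v := v) (o := some (t, i, true)) ?_⟩
      · rw [postOf_router, postOf_router]
        exact h.ack hb hv hv'
      · rw [hb]; simp only [weight]; omega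
    · left
      rw [preOf_router] at e₁ e₂
      obtain ⟨v, k, hb, hv⟩ := h.exists_head_of_place (c := false) hx.symm e₁
      obtain ⟨w, l, hb', hw⟩ := h.exists_head_of_place (c := false) hy.symm e₂
      have hedge := E.exec_sound _ _ _ _ _ _ _ _ he hv hw
      have hvw := System.edge_ne hedge
      have hb'' : Function.update b v (some (t, k, true)) w = some (t', l, false) := by
        rw [Function.update_of_ne hvw.symm, hb']
      refine ⟨_, Function.update (Function.update b v (some (t, k, true))) w (some (t', l, true)),
        Or.inl ⟨v, t, t', w, hedge, ?_, ?_, rfl⟩, ?_⟩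
      · exact (h.localInv v).val _ _ _ hb
      · exact (h.localInv w).val _ _ _ hb'
      · rw [postOf_router, postOf_router]
        exact (h.exec hb hv).exec hb'' hw
  · left
    obtain ⟨t, ht, rfl⟩ := exists_internalTransOf s ho
    obtain ⟨v, rfl⟩ := E.half_surj x t.1 hs.symm
    rw [preOf_internal] at e₁
    obtain ⟨hb, hq⟩ := h.of_half_orig e₁
    refine ⟨_, b, Or.inr ⟨v, t, ?_, ht, hq, rfl⟩, ?_⟩
    · exact Sum.inl_injective (hs.trans (E.half_proc v))
    · rw [postOf_internal]
      exact h.internal hb _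

variable (E) in
/-- A step of the expansion that is not observed, in the state `σ`. -/
def Silent (σ : S.V → PlaceOf P) (σ' σ₂' : S'.V → PlaceOf (expTypes P)) : Prop :=
  S'.Step σ' σ₂' ∧ ∃ b, E.Inv σ σ' b

open Classical in
-- As long as no router up to level `k` is engaged, each of them is idle and the request can be
-- passed on.
theorem Inv.climb (h : E.Inv σ σ' b) {v : S.V} (hb : b v = none) {t : ObsOf P}
    (hq : σ v = preOf P t.toTrans) (k : ℕ) (x : S'.V) (hx : E.At v t k x)
    (hfree : ∀ i ≤ k, ∀ y, E.At v t i y → ∀ w, ¬ E.Engages w (b w) y) :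
    ∃ σ₂', Relation.ReflTransGen (E.Silent σ) σ' σ₂' ∧
      E.Inv σ σ₂' (Function.update b v (some (t, k, false))) := by
  induction k generalizing x with
  | zero =>
    have hi := h.idle x t (E.at_proc hx) (hfree 0 le_rfl x hx)
    refine ⟨_, .single ⟨Or.inl ⟨_, _, _, _, E.attempt_edge _ _ _ hx, ?_, ?_, rfl⟩, b, h⟩, ?_⟩
    · rw [preOf_attempt, (h.localInv v).half_eq, hb, hq]; rfl
    · rw [preOf_router]; exact hi
    · rw [postOf_attempt, postOf_router]
      exact h.attempt hb hq hx hi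
  | succ k ih =>
    obtain ⟨y, hy, hf, -⟩ := E.at_succ _ _ _ _ hx
    obtain ⟨σ₂', hr, h₂⟩ := ih y hy fun i hi => hfree i (by omega)
    have hb' : Function.update b v (some (t, k, false)) v = some (t, k, false) := by simp
    -- The next router is not engaged by `v` itself either, since it would then have a second, lower
    -- level on the same path.
    have hi := h₂.idle x t (E.at_proc hx) (by
      intro w
      by_cases hw : w = v
      · subst hw
        rw [hb', engages_some]
        rintro ⟨i, hi, hx'⟩
        have := E.at_inj _ _ _ _ _ hx hx'
        omega
      · rw [Function.update_of_ne hw]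
        exact hfree (k + 1) le_rfl x hx w)
    refine ⟨_, hr.tail ⟨Or.inl ⟨_, _, _, _, hf, ?_, ?_, rfl⟩, _, h₂⟩, ?_⟩
    · rw [preOf_router]; exact (h₂.localInv v).head _ _ _ _ hb' hy
    · rw [preOf_router]; exact hi
    · rw [postOf_router, postOf_router]
      have := h₂.fwd hb' hy hx hi
      rwa [Function.update_idem] at this

open Classical in
-- Replies are never blocked: the router below the head is waiting for exactly this reply, and the
-- process for the commit.
theorem Inv.descend {v : S.V} {t : ObsOf P} (k : ℕ) (h : E.Inv σ σ' b)
    (hb : b v = some (t, k, true)) :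
    ∃ σ₂', Relation.ReflTransGen (E.Silent σ) σ' σ₂' ∧
      E.Inv σ σ₂' (Function.update b v none) := by
  induction k generalizing σ' b with
  | zero =>
    obtain ⟨x, hx⟩ := (h.localInv v).exists_head _ _ _ hb
    refine ⟨_, .single ⟨Or.inl ⟨_, _, _, _, E.commit_edge _ _ _ hx, ?_, ?_, rfl⟩, b, h⟩, ?_⟩
    · rw [preOf_router]; exact (h.localInv v).head _ _ _ _ hb hx
    · rw [preOf_commit, (h.localInv v).half_eq, hb]; rfl
    · rw [postOf_commit, postOf_router]
      exact h.commit hb hx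
  | succ k ih =>
    obtain ⟨y, hy⟩ := (h.localInv v).exists_head _ _ _ hb
    obtain ⟨x, hx, -, hr⟩ := E.at_succ _ _ _ _ hy
    obtain ⟨σ₂', hr₂, h₂⟩ := ih (h.ack hb hx hy) (by simp)
    rw [Function.update_idem] at h₂
    refine ⟨σ₂', .head ⟨Or.inl ⟨_, _, _, _, hr, ?_, ?_, ?_⟩, b, h⟩ hr₂, h₂⟩
    · rw [preOf_router]; exact (h.localInv v).head _ _ _ _ hb hy
    · rw [preOf_router]; exact (h.localInv v).wait _ _ _ _ _ hb hx (by omega)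
    · rw [postOf_router, postOf_router]; rfl

/-- Paths that share a router coincide above it, because the forward edges out of it belong to both.
-/
theorem at_add {v w : S.V} {t : ObsOf P} {i j : ℕ} {x : S'.V} (hv : E.At v t i x)
    (hw : E.At w t j x) (d : ℕ) (y : S'.V) (hy : E.At v t (i + d) y) : E.At w t (j + d) y := by
  induction d generalizing y with
  | zero =>
    obtain rfl := E.at_func _ _ _ _ _ hv hy
    exact hw
  | succ d ih =>
    obtain ⟨z, hz, hf, -⟩ := E.at_succ _ _ _ _ hy
    exact E.at_fwd _ _ _ _ _ (ih z hz) hf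

/-- All routers are free at the start. Both ends climb, `exec` is the single visible step, and both
descend, so all vertices are at rest again; the last part is silent for the new state. -/
theorem Inv.forward (h : E.Inv σ σ' fun _ => none) (hs : S.Step σ σ₂) :
    ∃ σ₁' σ₂' σ₃', Relation.ReflTransGen (E.Silent σ) σ' σ₁' ∧ (∃ b, E.Inv σ σ₁' b) ∧
      S'.Step σ₁' σ₂' ∧ Relation.ReflTransGen (E.Silent σ₂) σ₂' σ₃' ∧
      E.Inv σ₂ σ₃' fun _ => none := by
  classical
  rcases hs with ⟨v, t, t', w, he, e₁, e₂, rfl⟩ | ⟨v, t, ht, ho, e₁, rfl⟩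
  · have hvw := System.edge_ne he
    obtain ⟨i, j, x, y, hx, hy, hexec⟩ := E.exec_complete _ _ _ _ he
    obtain ⟨σ₁', hr₁, h₁⟩ := h.climb rfl e₁ i x hx fun _ _ _ _ _ => E.not_engages_none
    obtain ⟨σ₂', hr₂, h₂⟩ := h₁.climb (by rw [Function.update_of_ne hvw.symm]) e₂ j y hy (by
      intro l hl z hz u
      by_cases hu : u = v
      · subst hu
        rw [Function.update_self, engages_some]
        rintro ⟨m, hm, hz'⟩
        cases (E.at_proc hz).symm.trans (E.at_proc hz')
        -- Suppose the climb of `w` meets a router held by `v`. The paths then coincide up to `x`,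
        -- so `x` and `y` both lie on paths of `w`, and soundness of the `exec` edge gives a loop at
        -- `w`.
        obtain ⟨d, rfl⟩ := Nat.exists_eq_add_of_le hm
        have hx' := at_add hz' hz d x hx
        exact System.edge_ne (E.exec_sound _ _ _ _ _ _ _ _ hexec hx' hy) rfl
      · rw [Function.update_of_ne hu]
        exact E.not_engages_none)
    set b := Function.update (Function.update (fun _ => none) v (some (t, i, false))) w
      (some (t', j, false)) with hb
    have hbv : b v = some (t, i, false) := by simp [hb, hvw]
    have hbw : b w = some (t', j, false) := by simp [hb]
    have h₃ := (h₂.exec hbv hx).exec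
      (by rw [Function.update_of_ne hvw.symm]; exact hbw) hy
    obtain ⟨σ₃', hr₃, h₄⟩ := h₃.descend j (v := w) (t := t') (by simp)
    obtain ⟨σ₄', hr₄, h₅⟩ := h₄.descend i (v := v) (t := t) (by simp [hvw])
    refine ⟨σ₂', _, σ₄', hr₁.trans hr₂, ⟨b, h₂⟩, Or.inl ⟨_, _, _, _, hexec, ?_, ?_, rfl⟩, ?_, ?_⟩
    · rw [preOf_router]; exact (h₂.localInv v).head _ _ _ _ hbv hx
    · rw [preOf_router]; exact (h₂.localInv w).head _ _ _ _ hbw hy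
    · rw [postOf_router, postOf_router]
      exact hr₃.trans hr₄
    · convert h₅ using 1
      funext u
      by_cases hu : u = v
      · subst hu; simp
      · by_cases hw : u = w
        · subst hw; simp [hu]
        · simp [hb, hu, hw]
  · refine ⟨σ', _, _, .refl, ⟨_, h⟩,
      Or.inr ⟨E.half v, internalTransOf t ho, ?_, not_obs_internalTransOf t ho, ?_, rfl⟩, .refl, ?_⟩
    · rw [E.half_proc, ← ht]; rfl
    · rw [preOf_internal, (h.localInv v).half_eq, e₁]; rfl
    · rw [postOf_internal]
      exact h.internal rfl _

/-! ### From one-step simulations to stuttering equivalence -/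

theorem inv_start (E : Expansion S S') :
    E.Inv (fun v => startOf P (S.proc v)) (fun x => startOf (expTypes P) (S'.proc x))
      fun _ => none := by
  refine ⟨fun v => ⟨?_, by simp, by simp, by simp, by simp⟩, fun x t hx _ => ?_, ?_⟩
  · rw [E.half_proc, startOf_inl]; rfl
  · rw [hx, startOf_inr]
  · exact fun v w x hx => absurd hx E.not_engages_none

variable [Finite ι]

theorem Inv.atoms_eq (h : E.Inv σ σ' b) (L : PlaceOf P → Option Var) {m : S.behavior.Marking}
    {m' : S'.behavior.Marking} (hm : S.Rep m σ) (hm' : S'.Rep m' σ') :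
    S.behavior.atoms (S.liftLabeling L) m =
      S'.behavior.atoms (S'.liftLabeling (expLabeling L)) m' := by
  have e : S.behavior.varValue (S.liftLabeling L) m =
      S'.behavior.varValue (S'.liftLabeling (expLabeling L)) m' := by
    funext z
    rw [hm.varValue, hm'.varValue, h.card_eq L z]
  unfold PetriNet.atoms
  rw [e]

/-- Silent steps do not change `σ`, so every marking they start from has the atoms of `m`, which is
what `StepAt` asks for. -/
theorem exists_markings (L : PlaceOf P → Option Var) {m : S.behavior.Marking}
    (hm : S.Rep m σ) (h : Relation.ReflTransGen (E.Silent σ) σ' σ₂') {m' : S'.behavior.Marking}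
    (hm' : S'.Rep m' σ') :
    ∃ m₂', Relation.ReflTransGen (S'.behavior.StepAt (S'.liftLabeling (expLabeling L))
      (S.behavior.atoms (S.liftLabeling L) m)) m' m₂' ∧ S'.Rep m₂' σ₂' := by
  induction h with
  | refl => exact ⟨m', .refl, hm'⟩
  | tail _ hs ih =>
    obtain ⟨m₁', hr, h₁⟩ := ih
    obtain ⟨hs, b, hi⟩ := hs
    obtain ⟨τ, hτ, h₂⟩ := h₁.exists_enabled hs
    exact ⟨_, hr.tail ⟨(hi.atoms_eq L hm h₁).symm, τ, hτ, rfl⟩, h₂⟩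

theorem stutterEquiv (E : Expansion S S') (L : PlaceOf P → Option Var) : StutterEquiv L S S' := by
  constructor
  · intro ρ hρ
    suffices H : ∃ ρ' ∈ S'.behavior.paths, ∃ n, IsStretch
        (S.behavior.atomsSeq (S.liftLabeling L) ρ) n
        (S'.behavior.atomsSeq (S'.liftLabeling (expLabeling L)) ρ') by
      obtain ⟨ρ', hρ', n, hn⟩ := H
      exact ⟨ρ', hρ', _, n, rfl, hn⟩
    refine PetriNet.exists_stretch_of_forward (N := S.behavior)
      (N' := S'.behavior) (S.liftLabeling L) (S'.liftLabeling (expLabeling L))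
      -- A block must end right after the visible step, when replies are still on their way. The
      -- relation therefore only asks that a state at rest can be reached silently, and the next
      -- block starts with that descent.
      (fun m m' => ∃ σ σ' σ₂', S.Rep m σ ∧ S'.Rep m' σ' ∧
        Relation.ReflTransGen (E.Silent σ) σ' σ₂' ∧ E.Inv σ σ₂' fun _ => none) ?_ ?_ ?_ ρ hρ
    · rintro m m' ⟨σ, σ', σ₂', hm, hm', hr, hi⟩
      rcases hr.cases_head with rfl | ⟨_, ⟨_, b, hi'⟩, -⟩
      · exact hi.atoms_eq L hm hm'
      · exact hi'.atoms_eq L hm hm'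
    · exact ⟨_, _, _, S.rep_init, S'.rep_init, .refl, E.inv_start⟩
    · rintro m m' τ ⟨σ, σ', σ₂', hm, hm', hr, hi⟩ hτ
      obtain ⟨σ₂, hs, hm₂⟩ := hm.step_of_enabled hτ
      obtain ⟨σ₃', σ₄', σ₅', hr₃, ⟨b, hi₃⟩, hs₄, hr₅, hi₅⟩ := hi.forward hs
      obtain ⟨m₃', hr', hm₃⟩ := exists_markings L hm (hr.trans hr₃) hm'
      obtain ⟨τ', hτ', hm₄⟩ := hm₃.exists_enabled hs₄
      exact ⟨m₃', _, hr', ⟨(hi₃.atoms_eq L hm hm₃).symm, τ', hτ', rfl⟩,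
        σ₂, σ₄', σ₅', hm₂, hm₄, hr₅, hi₅⟩
  · intro ρ' hρ'
    obtain ⟨K, hK⟩ := E.exists_level_bound
    suffices H : ∃ ρ ∈ S.behavior.paths, ∃ n, IsStretch
        (S.behavior.atomsSeq (S.liftLabeling L) ρ) n
        (S'.behavior.atomsSeq (S'.liftLabeling (expLabeling L)) ρ') by
      obtain ⟨ρ, hρ, n, hn⟩ := H
      exact ⟨ρ, hρ, _, n, rfl, hn⟩
    refine PetriNet.exists_stretch_of_backward (N := S.behavior)
      (N' := S'.behavior) (S.liftLabeling L) (S'.liftLabeling (expLabeling L))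
      (fun m m' μ => ∃ σ σ' b, S.Rep m σ ∧ S'.Rep m' σ' ∧ E.Inv σ σ' b ∧
        μ = potential (S := S) K b) ?_ ?_ ?_ ρ' hρ'
    · rintro m m' μ ⟨σ, σ', b, hm, hm', hi, -⟩
      exact hi.atoms_eq L hm hm'
    · exact ⟨_, _, _, _, S.rep_init, S'.rep_init, E.inv_start, rfl⟩
    · rintro m m' μ τ' ⟨σ, σ', b, hm, hm', hi, rfl⟩ hτ'
      obtain ⟨σ₂', hs', hm₂'⟩ := hm'.step_of_enabled hτ'
      rcases hi.backward hK hs' with ⟨σ₂, b₂, hs, hi₂⟩ | ⟨b₂, hi₂, hlt⟩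
      · obtain ⟨τ, hτ, hm₂⟩ := hm.exists_enabled hs
        exact Or.inl ⟨τ, _, hτ, σ₂, σ₂', b₂, hm₂, hm₂', hi₂, rfl⟩
      · exact Or.inr ⟨_, hlt, σ, σ₂', b₂, hm, hm₂', hi₂, rfl⟩

end Expansion

end Simulation

/-! ## Composition with edges between ports -/

section Composition

variable {ι : Type} {P : ι → ProcessType} {Port : Type} {ptype : Port → ι}

/-- `G` is the composition of `S₁` and `S₂`, with the embeddings `f` and `g`. -/
structure IsComp (S₁ S₂ G : HRSystem P ptype) (f : S₁.V → G.V) (g : S₂.V → G.V) : Prop where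
  left_inj : Function.Injective f
  right_inj : Function.Injective g
  left_proc : ∀ v, G.proc (f v) = S₁.proc v
  right_proc : ∀ w, G.proc (g w) = S₂.proc w
  left_port : ∀ v, G.port (f v) = S₁.port v
  right_port : ∀ w, G.port (g w) = S₂.port w
  surj : ∀ x, (∃ v, f v = x) ∨ ∃ w, g w = x
  join : ∀ v w, f v = g w → ∃ π, S₁.port v = some π ∧ S₂.port w = some π
  edge_iff : ∀ x t t' y, G.edge x t t' y ↔
    (∃ v w, f v = x ∧ f w = y ∧ S₁.edge v t t' w) ∨ ∃ v w, g v = x ∧ g w = y ∧ S₂.edge v t t' w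

theorem IsComp.symm {S₁ S₂ G : HRSystem P ptype} {f : S₁.V → G.V} {g : S₂.V → G.V}
    (h : IsComp S₁ S₂ G f g) : IsComp S₂ S₁ G g f where
  left_inj := h.right_inj
  right_inj := h.left_inj
  left_proc := h.right_proc
  right_proc := h.left_proc
  left_port := h.right_port
  right_port := h.left_port
  surj x := (h.surj x).symm
  join v w e := by
    obtain ⟨π, h₁, h₂⟩ := h.join w v e.symm
    exact ⟨π, h₂, h₁⟩
  edge_iff x t t' y := (h.edge_iff x t t' y).trans or_comm

theorem isComp_comp (S₁ S₂ : HRSystem P ptype) :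
    IsComp S₁ S₂ (S₁.comp S₂) (fun v => Quotient.mk (HRSystem.joinSetoid S₁ S₂) (.inl v))
      (fun w => Quotient.mk (HRSystem.joinSetoid S₁ S₂) (.inr w)) where
  left_inj v w h := Quotient.exact (s := HRSystem.joinSetoid S₁ S₂) h
  right_inj v w h := Quotient.exact (s := HRSystem.joinSetoid S₁ S₂) h
  left_proc _ := rfl
  right_proc _ := rfl
  left_port _ := rfl
  right_port _ := rfl
  surj := by
    rintro ⟨v | w⟩
    · exact Or.inl ⟨v, rfl⟩
    · exact Or.inr ⟨w, rfl⟩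
  join v w h := Quotient.exact (s := HRSystem.joinSetoid S₁ S₂) h
  edge_iff x t t' y := by
    constructor
    · rintro ⟨v | v, w | w, rfl, rfl, h⟩
      · exact Or.inl ⟨v, w, rfl, rfl, h⟩
      · exact h.elim
      · exact h.elim
      · exact Or.inr ⟨v, w, rfl, rfl, h⟩
    · rintro (⟨v, w, rfl, rfl, h⟩ | ⟨v, w, rfl, rfl, h⟩)
      · exact ⟨.inl v, .inl w, rfl, rfl, h⟩
      · exact ⟨.inr v, .inr w, rfl, rfl, h⟩

/-- A set of labeled edges between ports. -/
abbrev PortEdges (P : ι → ProcessType) (Port : Type) : Type :=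
  Port → ObsOf P → ObsOf P → Port → Prop

/-- The port `π` is an end of an edge in `A`. -/
def PortEdges.Touches (A : PortEdges P Port) (π : Port) : Prop :=
  ∃ t t' π', A π t t' π' ∨ A π' t t' π

/-- The vertices of `T` are the ends of the edges in `A`, and its edges are those in `A`. -/
structure IsEdges (T : HRSystem P ptype) (A : PortEdges P Port) : Prop where
  exists_port : ∀ x, ∃ π, T.port x = some π ∧ A.Touches π
  occurs : ∀ π, A.Touches π → ∃ x, T.port x = some π
  edge_iff : ∀ x t t' y, T.edge x t t' y ↔
    ∃ π π', T.port x = some π ∧ T.port y = some π' ∧ A π t t' π'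

/-- `G` is obtained from `S` by adding the edges in `A`, with the embedding `f`. -/
structure IsExt (S : HRSystem P ptype) (A : PortEdges P Port) (G : HRSystem P ptype)
    (f : S.V → G.V) : Prop where
  inj : Function.Injective f
  proc : ∀ v, G.proc (f v) = S.proc v
  port : ∀ v, G.port (f v) = S.port v
  new : ∀ x, (∃ v, f v = x) ∨ ∃ π, G.port x = some π ∧ A.Touches π
  occurs : ∀ π, A.Touches π → ∃ x, G.port x = some π
  edge_iff : ∀ x t t' y, G.edge x t t' y ↔ (∃ v w, f v = x ∧ f w = y ∧ S.edge v t t' w) ∨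
    ∃ π π', G.port x = some π ∧ G.port y = some π' ∧ A π t t' π'

/-- The union of two sets of edges. -/
def PortEdges.union (A B : PortEdges P Port) : PortEdges P Port :=
  fun π t t' π' => A π t t' π' ∨ B π t t' π'

theorem PortEdges.touches_union {A B : PortEdges P Port} {π : Port} :
    (A.union B).Touches π ↔ A.Touches π ∨ B.Touches π := by
  constructor
  · rintro ⟨t, t', π', (h | h) | (h | h)⟩
    · exact Or.inl ⟨t, t', π', Or.inl h⟩
    · exact Or.inr ⟨t, t', π', Or.inl h⟩
    · exact Or.inl ⟨t, t', π', Or.inr h⟩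
    · exact Or.inr ⟨t, t', π', Or.inr h⟩
  · rintro (⟨t, t', π', h | h⟩ | ⟨t, t', π', h | h⟩)
    · exact ⟨t, t', π', Or.inl (Or.inl h)⟩
    · exact ⟨t, t', π', Or.inr (Or.inl h)⟩
    · exact ⟨t, t', π', Or.inl (Or.inr h)⟩
    · exact ⟨t, t', π', Or.inr (Or.inr h)⟩

theorem isExt_refl (S : HRSystem P ptype) : IsExt S (fun _ _ _ _ => False) S id where
  inj := Function.injective_id
  proc _ := rfl
  port _ := rfl
  new x := Or.inl ⟨x, rfl⟩
  occurs := by rintro π ⟨_, _, _, h | h⟩ <;> exact h.elim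
  edge_iff x t t' y := by
    constructor
    · intro h; exact Or.inl ⟨x, y, rfl, rfl, h⟩
    · rintro (⟨v, w, rfl, rfl, h⟩ | ⟨_, _, _, _, h⟩)
      · exact h
      · exact h.elim

/-- Vertices are joined by ports and ports are unique, so an end of a `B`-edge is the vertex of `H`
with that port, whether it is old or new. `H` is any composition, so the order of the two arguments
is immaterial. -/
theorem IsExt.comp {S G T H : HRSystem P ptype} {A B : PortEdges P Port} {f : S.V → G.V}
    {a : G.V → H.V} {b : T.V → H.V} (hG : IsExt S A G f) (hT : IsEdges T B)
    (hH : IsComp G T H a b) : IsExt S (A.union B) H (a ∘ f) := by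
  have hB : ∀ π, B.Touches π → ∃ y, H.port (b y) = some π := by
    intro π h
    obtain ⟨y, hy⟩ := hT.occurs π h
    exact ⟨y, (hH.right_port y).trans hy⟩
  have hA : ∀ π, A.Touches π → ∃ x, H.port (a x) = some π := by
    intro π h
    obtain ⟨x, hx⟩ := hG.occurs π h
    exact ⟨x, (hH.left_port x).trans hx⟩
  refine ⟨hH.left_inj.comp hG.inj, ?_, ?_, ?_, ?_, ?_⟩
  · exact fun v => (hH.left_proc _).trans (hG.proc v)
  · exact fun v => (hH.left_port _).trans (hG.port v)
  · intro x
    rcases hH.surj x with ⟨x, rfl⟩ | ⟨y, rfl⟩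
    · rcases hG.new x with ⟨v, rfl⟩ | ⟨π, hπ, h⟩
      · exact Or.inl ⟨v, rfl⟩
      · exact Or.inr ⟨π, (hH.left_port x).trans hπ, PortEdges.touches_union.2 (Or.inl h)⟩
    · obtain ⟨π, hπ, h⟩ := hT.exists_port y
      exact Or.inr ⟨π, (hH.right_port y).trans hπ, PortEdges.touches_union.2 (Or.inr h)⟩
  · intro π h
    rcases PortEdges.touches_union.1 h with h | h
    · obtain ⟨x, hx⟩ := hA π h; exact ⟨_, hx⟩
    · obtain ⟨y, hy⟩ := hB π h; exact ⟨_, hy⟩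
  · intro x t t' y
    rw [hH.edge_iff]
    constructor
    · rintro (⟨v, w, rfl, rfl, h⟩ | ⟨v, w, rfl, rfl, h⟩)
      · rcases (hG.edge_iff _ _ _ _).1 h with ⟨v, w, rfl, rfl, h'⟩ | ⟨π, π', h₁, h₂, h⟩
        · exact Or.inl ⟨v, w, rfl, rfl, h'⟩
        · exact Or.inr ⟨π, π', (hH.left_port _).trans h₁, (hH.left_port _).trans h₂, Or.inl h⟩
      · obtain ⟨π, π', h₁, h₂, h⟩ := (hT.edge_iff _ _ _ _).1 h
        exact Or.inr ⟨π, π', (hH.right_port _).trans h₁, (hH.right_port _).trans h₂, Or.inr h⟩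
    · rintro (⟨v, w, rfl, rfl, h⟩ | ⟨π, π', h₁, h₂, h | h⟩)
      · exact Or.inl ⟨_, _, rfl, rfl, (hG.edge_iff _ _ _ _).2 (Or.inl ⟨v, w, rfl, rfl, h⟩)⟩
      · obtain ⟨x', hx⟩ := hA π ⟨t, t', π', Or.inl h⟩
        obtain ⟨y', hy⟩ := hA π' ⟨t, t', π, Or.inr h⟩
        refine Or.inl ⟨x', y', H.port_unique _ _ _ hx h₁, H.port_unique _ _ _ hy h₂,
          (hG.edge_iff _ _ _ _).2 (Or.inr ⟨π, π', ?_, ?_, h⟩)⟩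
        · rw [← hH.left_port, hx]
        · rw [← hH.left_port, hy]
      · obtain ⟨x', hx⟩ := hB π ⟨t, t', π', Or.inl h⟩
        obtain ⟨y', hy⟩ := hB π' ⟨t, t', π, Or.inr h⟩
        refine Or.inr ⟨x', y', H.port_unique _ _ _ hx h₁, H.port_unique _ _ _ hy h₂,
          (hT.edge_iff _ _ _ _).2 ⟨π, π', ?_, ?_, h⟩⟩
        · rw [← hH.right_port, hx]
        · rw [← hH.right_port, hy]

theorem IsExt.congr {S G : HRSystem P ptype} {A B : PortEdges P Port} {f : S.V → G.V}
    (h : IsExt S A G f) (hAB : ∀ π t t' π', A π t t' π' ↔ B π t t' π') : IsExt S B G f := by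
  obtain rfl : A = B := by
    funext π t t' π'
    exact propext (hAB π t t' π')
  exact h

/-- Composing two systems of edges yields the union of the edges. -/
theorem IsEdges.comp {T₁ T₂ : HRSystem P ptype} {A B : PortEdges P Port} (h₁ : IsEdges T₁ A)
    (h₂ : IsEdges T₂ B) : IsEdges (T₁.comp T₂) (A.union B) := by
  have hc := isComp_comp T₁ T₂
  have h : IsExt T₁ (A.union B) (T₁.comp T₂) _ :=
    -- `T₁` is regarded as an extension of itself by its own edges.
    IsExt.comp (G := T₁) (A := A) (f := id) ⟨Function.injective_id, fun _ => rfl, fun _ => rfl,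
      fun x => Or.inl ⟨x, rfl⟩, h₁.occurs, fun x t t' y => by
        constructor
        · exact fun h => Or.inl ⟨x, y, rfl, rfl, h⟩
        · rintro (⟨v, w, rfl, rfl, h⟩ | h)
          · exact h
          · exact (h₁.edge_iff _ _ _ _).2 h⟩ h₂ hc
  refine ⟨fun x => ?_, h.occurs, fun x t t' y => ?_⟩
  · rcases hc.surj x with ⟨v, rfl⟩ | ⟨w, rfl⟩
    · obtain ⟨π, hπ, ht⟩ := h₁.exists_port v
      exact ⟨π, (hc.left_port v).trans hπ, PortEdges.touches_union.2 (Or.inl ht)⟩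
    · obtain ⟨π, hπ, ht⟩ := h₂.exists_port w
      exact ⟨π, (hc.right_port w).trans hπ, PortEdges.touches_union.2 (Or.inr ht)⟩
  · rw [h.edge_iff]
    refine or_iff_right_of_imp ?_
    rintro ⟨v, w, rfl, rfl, he⟩
    obtain ⟨π, π', hv, hw, he⟩ := (h₁.edge_iff _ _ _ _).1 he
    exact ⟨π, π', (hc.left_port v).trans hv, (hc.left_port w).trans hw, Or.inl he⟩

/-- The single edge from `π` to `π'` with label `(t, t')`. -/
def PortEdges.single (π : Port) (t t' : ObsOf P) (π' : Port) : PortEdges P Port :=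
  fun ϖ s s' ϖ' => ϖ = π ∧ s = t ∧ s' = t' ∧ ϖ' = π'

theorem isEdges_singleEdge (π π' : Port) (hne : π ≠ π') (t : (P (ptype π)).Obs)
    (t' : (P (ptype π')).Obs) :
    IsEdges (HRSystem.singleEdge (P := P) (ptype := ptype) π π' hne t t')
      (PortEdges.single π ⟨ptype π, t⟩ ⟨ptype π', t'⟩ π') := by
  refine ⟨?_, ?_, ?_⟩
  · rintro (_ | _)
    · exact ⟨π, rfl, _, _, _, Or.inl ⟨rfl, rfl, rfl, rfl⟩⟩
    · exact ⟨π', rfl, _, _, _, Or.inr ⟨rfl, rfl, rfl, rfl⟩⟩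
  · rintro _ ⟨_, _, _, ⟨rfl, rfl, rfl, rfl⟩ | ⟨rfl, rfl, rfl, rfl⟩⟩
    · exact ⟨false, rfl⟩
    · exact ⟨true, rfl⟩
  · intro x s s' y
    constructor
    · rintro ⟨rfl, rfl, rfl, rfl⟩
      exact ⟨π, π', rfl, rfl, rfl, rfl, rfl, rfl⟩
    · rintro ⟨_, _, h₁, h₂, rfl, rfl, rfl, rfl⟩
      refine ⟨?_, ?_, rfl, rfl⟩
      · cases x
        · rfl
        · exact absurd (Option.some.inj h₁).symm hne
      · cases y
        · exact absurd (Option.some.inj h₂) hne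
        · rfl

/-- The term, the edge set and the embedding are generalized because the left fold changes its
starting term at each element of the list. -/
theorem exists_isExt_compList_map {α : Type} {S : HRSystem P ptype} (g : α → HRTerm P ptype)
    (F : α → PortEdges P Port) (hg : ∀ y, IsEdges (g y).val (F y)) (l : List α) :
    ∀ (θ : HRTerm P ptype) (A : PortEdges P Port) (f : S.V → θ.val.V), IsExt S A θ.val f →
      ∃ f, IsExt S (A.union fun π t t' π' => ∃ y ∈ l, F y π t t' π')
        (θ.compList (l.map g)).val f := by
  induction l with
  | nil =>
    intro θ A f h
    exact ⟨f, h.congr fun _ _ _ _ => by simp [PortEdges.union]⟩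
  | cons y l ih =>
    intro θ A f h
    obtain ⟨f', h'⟩ := ih (θ.comp (g y)) _ _ (h.comp (hg y) (isComp_comp _ _))
    exact ⟨f', h'.congr fun _ _ _ _ => by simp [PortEdges.union, or_assoc]⟩

theorem exists_isExt_compList {α : Type} [Finite α] (θ : HRTerm P ptype) (g : α → HRTerm P ptype)
    (F : α → PortEdges P Port) (hg : ∀ y, IsEdges (g y).val (F y)) :
    ∃ f, IsExt θ.val (fun π t t' π' => ∃ y, F y π t t' π')
      (θ.compList ((enumerate α).map g)).val f := by
  obtain ⟨f, h⟩ := exists_isExt_compList_map g F hg (enumerate α) θ _ _ (isExt_refl θ.val)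
  exact ⟨f, h.congr fun _ _ _ _ => by simp [PortEdges.union, enumerate]⟩

end Composition

/-! ## Operations on expansions -/

section Operations

variable {ι : Type} {P : ι → ProcessType} {Port : Type} {ptype : Port → ι}

theorem attemptLabel_ne_routerLabel {t t' : ObsOf P} {k : RouterTrans} :
    attemptLabel t ≠ routerLabel t' k := fun h => by cases (Sigma.mk.inj h).1

/-- Systems over the expanded process types and ports in which each port is unique. -/
abbrev ExpSystem (P : ι → ProcessType) (ptype : Port → ι) : Type 1 :=
  HRSystem (expTypes P) (expPtype (P := P) ptype)

namespace Expansion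

variable {S : System P ptype} {S' G : ExpSystem P ptype}

/-- Only the last routers on the paths have ports, which are those of the vertices of `S`. -/
structure Ported (E : Expansion S S'.toSystem) : Prop where
  port_root : ∀ x p, S'.port x = some p → ∃ π t ht, p = .root π t ht
  port_at : ∀ v π t ht, S.port v = some π →
    ∃ i x, E.At v t i x ∧ S'.port x = some (.root π t ht)
  at_port : ∀ v t i x π s ht, E.At v t i x → S'.port x = some (.root π s ht) → S.port v = some π
  port_no_fwd : ∀ x p t y, S'.port x = some p → ¬ S'.Fwd t x y

/-- Redefining the ports of `S`. -/
def renameLeft (E : Expansion S S'.toSystem) (α : PortMap ptype) :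
    Expansion (S.rename α) S'.toSystem where
  half := E.half
  At := E.At
  half_inj := E.half_inj
  half_proc := E.half_proc
  half_surj := E.half_surj
  edge_cases := E.edge_cases
  attempt_edge := E.attempt_edge
  commit_edge := E.commit_edge
  at_zero := E.at_zero
  at_succ := E.at_succ
  at_fwd := E.at_fwd
  at_func := E.at_func
  at_inj := E.at_inj
  exec_sound := E.exec_sound
  exec_complete := E.exec_complete

/-- Redefining the ports of `S'`. -/
def renameRight (E : Expansion S S'.toSystem) (β : PortMap (expPtype (P := P) ptype))
    (hβ : β.Injective) : Expansion S (S'.rename β hβ).toSystem where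
  half := E.half
  At := E.At
  half_inj := E.half_inj
  half_proc := E.half_proc
  half_surj := E.half_surj
  edge_cases := E.edge_cases
  attempt_edge := E.attempt_edge
  commit_edge := E.commit_edge
  at_zero := E.at_zero
  at_succ := E.at_succ
  at_fwd := E.at_fwd
  at_func := E.at_func
  at_inj := E.at_inj
  exec_sound := E.exec_sound
  exec_complete := E.exec_complete

/-! ### Edge creation -/

/-- The edge that implements the creation of `(t, t')`-edges from `π` to `π'`. -/
def execEdges (π π' : Port) (t : (P (ptype π)).Obs) (t' : (P (ptype π')).Obs) :
    PortEdges (expTypes P) (ExpPort P ptype) :=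
  PortEdges.single (.root π ⟨ptype π, t⟩ rfl) (routerLabel ⟨ptype π, t⟩ .exec)
    (routerLabel ⟨ptype π', t'⟩ .exec) (.root π' ⟨ptype π', t'⟩ rfl)

variable {E : Expansion S S'.toSystem} {π π' : Port} {t : (P (ptype π)).Obs}
  {t' : (P (ptype π')).Obs} {f : S'.V → G.V}

theorem edge_execEdges (hG : IsExt S' (execEdges π π' t t') G f) {x y : G.V}
    {a b : ObsOf (expTypes P)} (hb : ∀ s, b ≠ routerLabel s .exec) :
    G.edge x a b y ↔ ∃ v w, f v = x ∧ f w = y ∧ S'.edge v a b w := by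
  rw [hG.edge_iff]
  refine or_iff_left ?_
  rintro ⟨_, _, _, _, _, _, h, _⟩
  exact hb _ h

/-- Adding an edge between routers with ports implements the creation of edges. -/
def addExec (hE : E.Ported) (hne : π ≠ π') (hG : IsExt S' (execEdges π π' t t') G f) :
    Expansion (S.addEdge π π' hne t t') G.toSystem where
  half v := f (E.half v)
  At v s i x := ∃ x₀, f x₀ = x ∧ E.At v s i x₀
  half_inj := hG.inj.comp E.half_inj
  half_proc v := (hG.proc _).trans (E.half_proc v)
  half_surj x p hx := by
    rcases hG.new x with ⟨v, rfl⟩ | ⟨q, hq, ht⟩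
    · obtain ⟨w, rfl⟩ := E.half_surj v p ((hG.proc v).symm.trans hx)
      exact ⟨w, rfl⟩
    -- The ports touched by the edge belong to routers, so a vertex with such a port is not a
    -- process.
    · have h := G.port_type _ _ hq
      rw [hx] at h
      rcases ht with ⟨_, _, _, ⟨rfl, -, -, -⟩ | ⟨-, -, -, rfl⟩⟩ <;> cases h
  edge_cases x a b y h := by
    rcases (hG.edge_iff _ _ _ _).1 h with ⟨x, y, rfl, rfl, h'⟩ | ⟨_, _, _, _, _, rfl, rfl, _⟩
    · rcases E.edge_cases _ _ _ _ h' with ⟨v, t, rfl, rfl, rfl, hv⟩ | ⟨v, t, rfl, rfl, rfl, hv⟩ |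
        ⟨t, rfl, rfl⟩ | ⟨t, rfl, rfl, hf⟩ | ⟨t, t', rfl, rfl⟩
      · exact Or.inl ⟨v, t, rfl, rfl, rfl, _, rfl, hv⟩
      · exact Or.inr (Or.inl ⟨v, t, rfl, rfl, rfl, _, rfl, hv⟩)
      · exact Or.inr (Or.inr (Or.inl ⟨t, rfl, rfl⟩))
      · exact Or.inr (Or.inr (Or.inr (Or.inl ⟨t, rfl, rfl,
          (hG.edge_iff _ _ _ _).2 (Or.inl ⟨_, _, rfl, rfl, hf⟩)⟩)))
      · exact Or.inr (Or.inr (Or.inr (Or.inr ⟨t, t', rfl, rfl⟩)))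
    · exact Or.inr (Or.inr (Or.inr (Or.inr ⟨_, _, rfl, rfl⟩)))
  attempt_edge := by
    rintro v s _ ⟨x, rfl, hx⟩
    exact (hG.edge_iff _ _ _ _).2 (Or.inl ⟨_, _, rfl, rfl, E.attempt_edge v s x hx⟩)
  commit_edge := by
    rintro v s _ ⟨x, rfl, hx⟩
    exact (hG.edge_iff _ _ _ _).2 (Or.inl ⟨_, _, rfl, rfl, E.commit_edge v s x hx⟩)
  at_zero v s hs := by
    obtain ⟨x, hx⟩ := E.at_zero v s hs
    exact ⟨_, x, rfl, hx⟩
  at_succ := by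
    rintro v s i _ ⟨y, rfl, hy⟩
    obtain ⟨x, hx, hf, hr⟩ := E.at_succ _ _ _ _ hy
    exact ⟨_, ⟨x, rfl, hx⟩, (hG.edge_iff _ _ _ _).2 (Or.inl ⟨_, _, rfl, rfl, hf⟩),
      (hG.edge_iff _ _ _ _).2 (Or.inl ⟨_, _, rfl, rfl, hr⟩)⟩
  at_fwd := by
    rintro v s i _ y ⟨x, rfl, hx⟩ h
    obtain ⟨x', y, e, rfl, h'⟩ := (edge_execEdges hG
      (fun _ h => by cases (routerLabel_inj.1 h).2)).1 h
    obtain rfl := hG.inj e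
    exact ⟨y, rfl, E.at_fwd _ _ _ _ _ hx h'⟩
  at_func := by
    rintro v s i _ _ ⟨x, rfl, hx⟩ ⟨y, rfl, hy⟩
    rw [E.at_func _ _ _ _ _ hx hy]
  at_inj := by
    rintro v s i j _ ⟨x, rfl, hx⟩ ⟨y, e, hy⟩
    obtain rfl := hG.inj e
    exact E.at_inj _ _ _ _ _ hx hy
  exec_sound := by
    rintro v w s s' i j _ _ h ⟨x, rfl, hx⟩ ⟨y, rfl, hy⟩
    rcases (hG.edge_iff _ _ _ _).1 h with ⟨x', y', ex, ey, h'⟩ | ⟨_, _, px, py, rfl, h₁, h₂, rfl⟩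
    · obtain rfl := hG.inj ex
      obtain rfl := hG.inj ey
      exact Or.inl (E.exec_sound _ _ _ _ _ _ _ _ h' hx hy)
    -- `at_port` recovers from the ports of the two routers that `v` carries `π` and `w` carries
    -- `π'`.
    · rw [hG.port] at px py
      exact Or.inr ⟨hE.at_port _ _ _ _ _ _ _ hx px, hE.at_port _ _ _ _ _ _ _ hy py,
        (routerLabel_inj.1 h₁).1, (routerLabel_inj.1 h₂).1⟩
  exec_complete := by
    rintro v w s s' (h | ⟨hv, hw, rfl, rfl⟩)
    · obtain ⟨i, j, x, y, hx, hy, h⟩ := E.exec_complete _ _ _ _ h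
      exact ⟨i, j, _, _, ⟨x, rfl, hx⟩, ⟨y, rfl, hy⟩,
        (hG.edge_iff _ _ _ _).2 (Or.inl ⟨_, _, rfl, rfl, h⟩)⟩
    · obtain ⟨i, x, hx, px⟩ := hE.port_at v π ⟨_, t⟩ rfl hv
      obtain ⟨j, y, hy, py⟩ := hE.port_at w π' ⟨_, t'⟩ rfl hw
      refine ⟨i, j, _, _, ⟨x, rfl, hx⟩, ⟨y, rfl, hy⟩, (hG.edge_iff _ _ _ _).2
        (Or.inr ⟨_, _, ?_, ?_, rfl, rfl, rfl, rfl⟩)⟩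
      · rw [hG.port, px]
      · rw [hG.port, py]

/-- If `π` labels no vertex, the edge may bring in a router with a port that lies on no path. This
is why `at_port` speaks only of routers on paths. -/
theorem ported_addExec (hE : E.Ported) (hne : π ≠ π')
    (hG : IsExt S' (execEdges π π' t t') G f) : (addExec hE hne hG).Ported where
  port_root x p hx := by
    rcases hG.new x with ⟨v, rfl⟩ | ⟨q, hq, ht⟩
    · exact hE.port_root v p ((hG.port v).symm.trans hx)
    · obtain rfl := Option.some.inj (hx.symm.trans hq)
      rcases ht with ⟨_, _, _, ⟨rfl, -, -, -⟩ | ⟨-, -, -, rfl⟩⟩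
      · exact ⟨_, _, _, rfl⟩
      · exact ⟨_, _, _, rfl⟩
  port_at v ϖ s hs hv := by
    obtain ⟨i, x, hx, px⟩ := hE.port_at v ϖ s hs hv
    exact ⟨i, _, ⟨x, rfl, hx⟩, (hG.port x).trans px⟩
  at_port := by
    rintro v s i _ ϖ s' hs ⟨x, rfl, hx⟩ px
    exact hE.at_port v s i x ϖ s' hs hx ((hG.port x).symm.trans px)
  port_no_fwd x p s y hx h := by
    obtain ⟨x, y, rfl, rfl, h'⟩ := (edge_execEdges hG
      (fun _ h => by cases (routerLabel_inj.1 h).2)).1 h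
    exact hE.port_no_fwd x p s y ((hG.port x).symm.trans hx) h'

end Expansion

namespace Expansion

variable {S : System P ptype} {S' G : ExpSystem P ptype}

/-! ### Links -/

/-- The edges that connect the routers with port `π` to new routers with port `α π`. -/
def linkEdges (α : PortMap ptype) : PortEdges (expTypes P) (ExpPort P ptype) :=
  fun p a b q => ∃ π π' t ht ht', α.toFun π = some π' ∧
    ((p = .root π t ht ∧ a = routerLabel t .fwd ∧ b = routerLabel t .recv ∧ q = .back π' t ht') ∨
      (p = .back π' t ht' ∧ a = routerLabel t .reset ∧ b = routerLabel t .ack ∧ q = .root π t ht))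

variable {E : Expansion S S'.toSystem} {α : PortMap ptype} {f : S'.V → G.V}

theorem touches_linkEdges {p : ExpPort P ptype} (h : (linkEdges α).Touches p) :
    ∃ π π' t ht ht', α.toFun π = some π' ∧ (p = .root π t ht ∨ p = .back π' t ht') := by
  rcases h with ⟨_, _, _, ⟨π, π', t, ht, ht', h, ⟨rfl, -, -, -⟩ | ⟨rfl, -, -, -⟩⟩ |
    ⟨π, π', t, ht, ht', h, ⟨-, -, -, rfl⟩ | ⟨-, -, -, rfl⟩⟩⟩
  · exact ⟨π, π', t, ht, ht', h, Or.inl rfl⟩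
  · exact ⟨π, π', t, ht, ht', h, Or.inr rfl⟩
  · exact ⟨π, π', t, ht, ht', h, Or.inr rfl⟩
  · exact ⟨π, π', t, ht, ht', h, Or.inl rfl⟩

theorem fwd_linkEdges (hG : IsExt S' (linkEdges α) G f) {t : ObsOf P} {x y : G.V} :
    G.Fwd t x y ↔ (∃ v w, f v = x ∧ f w = y ∧ S'.Fwd t v w) ∨
      ∃ π π' ht ht', α.toFun π = some π' ∧ G.port x = some (.root π t ht) ∧
        G.port y = some (.back π' t ht') := by
  unfold System.Fwd
  rw [hG.edge_iff]
  refine or_congr_right ⟨?_, ?_⟩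
  · rintro ⟨_, _, hx, hy, π, π', s, hs, hs', hα, ⟨rfl, h₁, -, rfl⟩ | ⟨-, h₁, -, -⟩⟩
    · obtain rfl := (routerLabel_inj.1 h₁).1
      exact ⟨π, π', hs, hs', hα, hx, hy⟩
    · cases (routerLabel_inj.1 h₁).2
  · rintro ⟨π, π', ht, ht', hα, hx, hy⟩
    exact ⟨_, _, hx, hy, π, π', t, ht, ht', hα, Or.inl ⟨rfl, rfl, rfl, rfl⟩⟩

theorem exec_linkEdges (hG : IsExt S' (linkEdges α) G f) {t t' : ObsOf P} {x y : G.V} :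
    G.Exec t t' x y ↔ ∃ v w, f v = x ∧ f w = y ∧ S'.Exec t t' v w := by
  unfold System.Exec
  rw [hG.edge_iff]
  refine or_iff_left ?_
  rintro ⟨_, _, _, _, π, π', s, hs, hs', hα, ⟨-, h₁, -, -⟩ | ⟨-, h₁, -, -⟩⟩ <;>
    cases (routerLabel_inj.1 h₁).2

/-- This makes the `back` ports fresh: any router that carries one after linking is new. -/
theorem Ported.port_ne_back (hE : E.Ported) {x : S'.V} {π : Port} {t : ObsOf P}
    {ht : t.1 = ptype π} : S'.port x ≠ some (.back π t ht) := by
  intro h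
  obtain ⟨_, _, _, h⟩ := hE.port_root x _ h
  cases h

/-- The router `x`, whose port is the new port of `v`, is the `i`-th router on the path of `v`. -/
def NewAt (E : Expansion S S'.toSystem) (α : PortMap ptype) (G : ExpSystem P ptype) (v : S.V)
    (t : ObsOf P) (i : ℕ) (x : G.V) : Prop :=
  ∃ π π' ht ht' j x₀, i = j + 1 ∧ E.At v t j x₀ ∧ S'.port x₀ = some (.root π t ht) ∧
    α.toFun π = some π' ∧ G.port x = some (.back π' t ht')

theorem not_newAt (hE : E.Ported) (hG : IsExt S' (linkEdges α) G f) {v : S.V} {t : ObsOf P}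
    {i : ℕ} {x : S'.V} : ¬ E.NewAt α G v t i (f x) := by
  rintro ⟨π, π', ht, ht', j, x₀, -, -, -, -, h⟩
  rw [hG.port] at h
  exact hE.port_ne_back h

/-- Linking the routers with ports to new ones extends the paths. -/
def link (hE : E.Ported) (hG : IsExt S' (linkEdges α) G f) : Expansion S G.toSystem where
  half v := f (E.half v)
  At v s i x := (∃ x₀, f x₀ = x ∧ E.At v s i x₀) ∨ E.NewAt α G v s i x
  half_inj := hG.inj.comp E.half_inj
  half_proc v := (hG.proc _).trans (E.half_proc v)
  half_surj x p hx := by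
    rcases hG.new x with ⟨v, rfl⟩ | ⟨q, hq, ht⟩
    · obtain ⟨w, rfl⟩ := E.half_surj v p ((hG.proc v).symm.trans hx)
      exact ⟨w, rfl⟩
    · have h := G.port_type _ _ hq
      rw [hx] at h
      obtain ⟨_, _, _, _, _, _, rfl | rfl⟩ := touches_linkEdges ht <;> cases h
  edge_cases x a b y h := by
    rcases (hG.edge_iff _ _ _ _).1 h with ⟨x, y, rfl, rfl, h'⟩ |
      ⟨_, _, hx, hy, π, π', t, ht, ht', hα, ⟨rfl, rfl, rfl, rfl⟩ | ⟨rfl, rfl, rfl, rfl⟩⟩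
    · rcases E.edge_cases _ _ _ _ h' with ⟨v, t, rfl, rfl, rfl, hv⟩ | ⟨v, t, rfl, rfl, rfl, hv⟩ |
        ⟨t, rfl, rfl⟩ | ⟨t, rfl, rfl, hf⟩ | ⟨t, t', rfl, rfl⟩
      · exact Or.inl ⟨v, t, rfl, rfl, rfl, Or.inl ⟨_, rfl, hv⟩⟩
      · exact Or.inr (Or.inl ⟨v, t, rfl, rfl, rfl, Or.inl ⟨_, rfl, hv⟩⟩)
      · exact Or.inr (Or.inr (Or.inl ⟨t, rfl, rfl⟩))
      · exact Or.inr (Or.inr (Or.inr (Or.inl ⟨t, rfl, rfl,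
          (hG.edge_iff _ _ _ _).2 (Or.inl ⟨_, _, rfl, rfl, hf⟩)⟩)))
      · exact Or.inr (Or.inr (Or.inr (Or.inr ⟨t, t', rfl, rfl⟩)))
    · exact Or.inr (Or.inr (Or.inl ⟨t, rfl, rfl⟩))
    · exact Or.inr (Or.inr (Or.inr (Or.inl ⟨t, rfl, rfl,
        (fwd_linkEdges hG).2 (Or.inr ⟨π, π', ht, ht', hα, hy, hx⟩)⟩)))
  attempt_edge := by
    rintro v s _ (⟨x, rfl, hx⟩ | ⟨_, _, _, _, _, _, h, _⟩)
    · exact (hG.edge_iff _ _ _ _).2 (Or.inl ⟨_, _, rfl, rfl, E.attempt_edge v s x hx⟩)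
    · omega
  commit_edge := by
    rintro v s _ (⟨x, rfl, hx⟩ | ⟨_, _, _, _, _, _, h, _⟩)
    · exact (hG.edge_iff _ _ _ _).2 (Or.inl ⟨_, _, rfl, rfl, E.commit_edge v s x hx⟩)
    · omega
  at_zero v s hs := by
    obtain ⟨x, hx⟩ := E.at_zero v s hs
    exact ⟨_, Or.inl ⟨x, rfl, hx⟩⟩
  at_succ := by
    rintro v s i y (⟨y, rfl, hy⟩ | ⟨π, π', ht, ht', j, x₀, hi, hx₀, px₀, hα, py⟩)
    · obtain ⟨x, hx, hf, hr⟩ := E.at_succ _ _ _ _ hy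
      exact ⟨_, Or.inl ⟨x, rfl, hx⟩, (hG.edge_iff _ _ _ _).2 (Or.inl ⟨_, _, rfl, rfl, hf⟩),
        (hG.edge_iff _ _ _ _).2 (Or.inl ⟨_, _, rfl, rfl, hr⟩)⟩
    · obtain rfl : i = j := by omega
      have px := (hG.port x₀).trans px₀
      exact ⟨f x₀, Or.inl ⟨_, rfl, hx₀⟩,
        (fwd_linkEdges hG).2 (Or.inr ⟨π, π', ht, ht', hα, px, py⟩),
        (hG.edge_iff _ _ _ _).2 (Or.inr ⟨_, _, py, px, π, π', s, ht, ht', hα,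
          Or.inr ⟨rfl, rfl, rfl, rfl⟩⟩)⟩
  at_fwd := by
    rintro v s i _ y (⟨x, rfl, hx⟩ | hx) h
    · rcases (fwd_linkEdges hG).1 h with ⟨x', y, e, rfl, h'⟩ | ⟨π, π', ht, ht', hα, px, py⟩
      · obtain rfl := hG.inj e
        exact Or.inl ⟨y, rfl, E.at_fwd _ _ _ _ _ hx h'⟩
      · rw [hG.port] at px
        exact Or.inr ⟨π, π', ht, ht', i, x, rfl, hx, px, hα, py⟩
    · rcases (fwd_linkEdges hG).1 h with ⟨x', y, rfl, rfl, h'⟩ | ⟨π, π', ht, ht', hα, px, py⟩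
      · exact absurd hx (not_newAt hE hG)
      · obtain ⟨_, _, _, _, _, _, _, _, _, _, hx⟩ := hx
        cases px.symm.trans hx
  at_func := by
    -- An old router one level above a router with a port would be the target of a forward edge from
    -- it, against `port_no_fwd`.
    have key : ∀ v s i x y, E.At v s i x → ¬ E.NewAt α G v s i y := by
      rintro v s _ x y hx ⟨π, π', ht, ht', j, x₀, rfl, hx₀, px₀, hα, py⟩
      obtain ⟨x', hx', hf, -⟩ := E.at_succ _ _ _ _ hx
      obtain rfl := E.at_func _ _ _ _ _ hx' hx₀
      exact hE.port_no_fwd _ _ _ _ px₀ hf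
    rintro v s i x y (⟨x, rfl, hx⟩ | hx) (⟨y, rfl, hy⟩ | hy)
    · rw [E.at_func _ _ _ _ _ hx hy]
    · exact absurd hy (key v s i x y hx)
    · exact absurd hx (key v s i y x hy)
    · obtain ⟨π, π', ht, ht', j, x₀, hi, hx₀, px₀, hα, px⟩ := hx
      obtain ⟨ϖ, ϖ', hs, hs', k, y₀, hk, hy₀, py₀, hα', py⟩ := hy
      obtain rfl : j = k := by omega
      obtain rfl := E.at_func _ _ _ _ _ hx₀ hy₀
      cases px₀.symm.trans py₀
      cases hα.symm.trans hα'
      exact G.port_unique _ _ _ px py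
  at_inj := by
    rintro v s i j x (⟨x, rfl, hx⟩ | hx) (⟨y, e, hy⟩ | hy)
    · obtain rfl := hG.inj e
      exact E.at_inj _ _ _ _ _ hx hy
    · exact absurd hy (not_newAt hE hG)
    · rw [← e] at hx
      exact absurd hx (not_newAt hE hG)
    · obtain ⟨π, π', ht, ht', j', x₀, rfl, hx₀, px₀, hα, px⟩ := hx
      obtain ⟨ϖ, ϖ', hs, hs', k, y₀, rfl, hy₀, py₀, hα', py⟩ := hy
      -- The map `α` need not be injective, so equal new ports do not give equal old ones; the old
      -- ports agree because `v` has only one.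
      cases (hE.at_port _ _ _ _ _ _ _ hx₀ px₀).symm.trans (hE.at_port _ _ _ _ _ _ _ hy₀ py₀)
      obtain rfl := S'.port_unique _ _ _ px₀ py₀
      rw [E.at_inj _ _ _ _ _ hx₀ hy₀]
  exec_sound := by
    rintro v w s s' i j x y h hx hy
    obtain ⟨x, y, rfl, rfl, h'⟩ := (exec_linkEdges hG).1 h
    obtain ⟨x', ex, hx'⟩ := hx.resolve_right (not_newAt hE hG)
    obtain ⟨y', ey, hy'⟩ := hy.resolve_right (not_newAt hE hG)
    obtain rfl := hG.inj ex
    obtain rfl := hG.inj ey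
    exact E.exec_sound _ _ _ _ _ _ _ _ h' hx' hy'
  exec_complete := by
    rintro v w s s' h
    obtain ⟨i, j, x, y, hx, hy, h⟩ := E.exec_complete _ _ _ _ h
    exact ⟨i, j, _, _, Or.inl ⟨x, rfl, hx⟩, Or.inl ⟨y, rfl, hy⟩,
      (exec_linkEdges hG).2 ⟨_, _, rfl, rfl, h⟩⟩

theorem back_of_fwd (hE : E.Ported) (hG : IsExt S' (linkEdges α) G f) {x y : G.V} {π : Port}
    {t s : ObsOf P} {ht : t.1 = ptype π} (hx : G.port x = some (.back π t ht)) :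
    ¬ G.Fwd s x y := by
  intro h
  rcases (fwd_linkEdges hG).1 h with ⟨x', y, rfl, rfl, h'⟩ | ⟨π, π', ht, ht', hα, px, py⟩
  · rw [hG.port] at hx
    exact hE.port_ne_back hx
  · cases px.symm.trans hx

theorem back_of_exec (hE : E.Ported) (hG : IsExt S' (linkEdges α) G f) {x y : G.V} {π : Port}
    {t s s' : ObsOf P} {ht : t.1 = ptype π} (h : G.Exec s s' x y) :
    G.port x ≠ some (.back π t ht) ∧ G.port y ≠ some (.back π t ht) := by
  obtain ⟨x, y, rfl, rfl, -⟩ := (exec_linkEdges hG).1 h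
  rw [hG.port, hG.port]
  exact ⟨hE.port_ne_back, hE.port_ne_back⟩

theorem exists_newAt (hE : E.Ported) (hG : IsExt S' (linkEdges α) G f) {v : S.V} {π π' : Port}
    {t : ObsOf P} (ht' : t.1 = ptype π') (hv : S.port v = some π) (hα : α.toFun π = some π') :
    ∃ i x, E.NewAt α G v t i x ∧ G.port x = some (.back π' t ht') := by
  have ht : t.1 = ptype π := ht'.trans (α.type_eq _ _ hα)
  obtain ⟨i, x₀, hx₀, px₀⟩ := hE.port_at v π t ht hv
  obtain ⟨x, hx⟩ := hG.occurs (.back π' t ht') ⟨_, _, _, Or.inr ⟨π, π', t, ht, ht', hα,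
    Or.inl ⟨rfl, rfl, rfl, rfl⟩⟩⟩
  exact ⟨i + 1, x, ⟨π, π', ht, ht', i, x₀, rfl, hx₀, px₀, hα, hx⟩, hx⟩

theorem NewAt.port_eq (hE : E.Ported) {v : S.V} {π' : Port}
    {t s : ObsOf P} {ht' : s.1 = ptype π'} {i : ℕ} {x : G.V} (h : E.NewAt α G v t i x)
    (hx : G.port x = some (.back π' s ht')) :
    ∃ π, S.port v = some π ∧ α.toFun π = some π' := by
  obtain ⟨π, π', ht, ht', j, x₀, hi, hx₀, px₀, hα, px⟩ := h
  cases px.symm.trans hx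
  exact ⟨π, hE.at_port _ _ _ _ _ _ _ hx₀ px₀, hα⟩

/-! ### Redefinition of ports -/

/-- After the renaming only the new routers have ports. They have no outgoing forward edges, and
merged ports simply share a new router. -/
theorem ported_rename (hE : E.Ported) (hG : IsExt S' (linkEdges α) G f) :
    (((E.link hE hG).renameRight (freshMap P ptype) (freshMap_injective ptype)).renameLeft
      α).Ported := by
  have hp : ∀ x p, (G.rename (freshMap P ptype) (freshMap_injective ptype)).port x = some p →
      ∃ π t ht, G.port x = some (.back π t ht) ∧ p = .root π t ht := by
    intro x p h
    obtain ⟨q, hq, h⟩ := Option.bind_eq_some_iff.1 h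
    rcases q with π | ⟨π, t, ht⟩ | ⟨π, t, ht⟩ <;> cases h
    exact ⟨π, t, ht, hq, rfl⟩
  refine ⟨?_, ?_, ?_, ?_⟩
  · intro x p h
    obtain ⟨π, t, ht, -, h⟩ := hp x p h
    exact ⟨π, t, ht, h⟩
  · intro v π' t ht' hv
    obtain ⟨π, hv, hα⟩ := Option.bind_eq_some_iff.1 hv
    obtain ⟨i, x, hx, px⟩ := exists_newAt hE hG ht' hv hα
    exact ⟨i, x, Or.inr hx, Option.bind_eq_some_iff.2 ⟨_, px, rfl⟩⟩
  · intro v t i x π' s hs hx px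
    obtain ⟨_, _, _, px, ⟨⟩⟩ := hp x _ px
    have hx : E.NewAt α G v t i x := by
      rcases hx with ⟨x, rfl, hx⟩ | hx
      · rw [hG.port] at px
        exact absurd px hE.port_ne_back
      · exact hx
    exact Option.bind_eq_some_iff.2 (hx.port_eq hE px)
  · intro x p t y px h
    obtain ⟨_, _, _, px', rfl⟩ := hp x _ px
    exact back_of_fwd hE hG px' h

theorem port_unionMap {s₁ s₂ : Set Port} {x : G.V} {p : ExpPort P ptype}
    (h : (G.rename (unionMap P ptype s₁ s₂) (unionMap_injective ptype s₁ s₂)).port x = some p) :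
    ∃ π t ht, p = .root π t ht ∧ ((G.port x = some (.back π t ht) ∧ π ∈ s₁ ∧ π ∈ s₂) ∨
      (G.port x = some (.root π t ht) ∧ π ∈ s₁ ∧ π ∉ s₂)) := by
  obtain ⟨q, hq, h⟩ := Option.bind_eq_some_iff.1 h
  rcases q with π | ⟨π, t, ht⟩ | ⟨π, t, ht⟩ <;> dsimp only [unionMap] at h
  · cases h
  · split_ifs at h with hπ
    cases h
    exact ⟨π, t, ht, rfl, Or.inr ⟨hq, hπ⟩⟩
  · split_ifs at h with hπ
    cases h
    exact ⟨π, t, ht, rfl, Or.inl ⟨hq, hπ⟩⟩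

theorem idOn_eq_some {s : Set Port} {π π' : Port} :
    (idOn ptype s).toFun π = some π' ↔ π ∈ s ∧ π = π' := by
  unfold idOn
  by_cases h : π ∈ s <;> simp [h]

/-- A port of both arguments moves to a fresh router, a port of `S` alone keeps its old one. Links
start only at common ports, so a router that keeps its port has no outgoing forward edge. -/
theorem ported_unionMap (hE : E.Ported) {s : Set Port}
    (hG : IsExt S' (linkEdges (idOn ptype (S.sort ∩ s))) G f) :
    ((E.link hE hG).renameRight (unionMap P ptype S.sort s)
      (unionMap_injective ptype S.sort s)).Ported := by
  refine ⟨?_, ?_, ?_, ?_⟩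
  · intro x p h
    obtain ⟨π, t, ht, h, -⟩ := port_unionMap h
    exact ⟨π, t, ht, h⟩
  · intro v π t ht hv
    have hπ : π ∈ S.sort := ⟨v, hv⟩
    by_cases hs : π ∈ s
    · obtain ⟨i, x, hx, px⟩ := exists_newAt hE hG ht hv (idOn_eq_some.2 ⟨⟨hπ, hs⟩, rfl⟩)
      refine ⟨i, x, Or.inr hx, Option.bind_eq_some_iff.2 ⟨_, px, ?_⟩⟩
      exact if_pos ⟨hπ, hs⟩
    · obtain ⟨i, x, hx, px⟩ := hE.port_at v π t ht hv
      refine ⟨i, f x, Or.inl ⟨x, rfl, hx⟩,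
        Option.bind_eq_some_iff.2 ⟨_, (hG.port x).trans px, ?_⟩⟩
      exact if_pos ⟨hπ, hs⟩
  · intro v t i x π r hr hx px
    obtain ⟨_, _, _, ⟨⟩, ⟨px, -⟩ | ⟨px, -⟩⟩ := port_unionMap px
    · rcases hx with ⟨x, rfl, hx⟩ | hx
      · rw [hG.port] at px
        exact absurd px hE.port_ne_back
      · obtain ⟨π', hv, h⟩ := hx.port_eq hE px
        obtain ⟨-, rfl⟩ := idOn_eq_some.1 h
        exact hv
    · rcases hx with ⟨x, rfl, hx⟩ | ⟨_, _, _, _, _, _, _, _, _, _, hx⟩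
      · rw [hG.port] at px
        exact hE.at_port _ _ _ _ _ _ _ hx px
      · cases px.symm.trans hx
  · intro x p t y px h
    obtain ⟨π, s', ht, rfl, ⟨px, -⟩ | ⟨px, -, hs⟩⟩ := port_unionMap px
    · exact back_of_fwd hE hG px h
    · rcases (fwd_linkEdges hG).1 h with ⟨x, y, rfl, rfl, h'⟩ | ⟨ϖ, _, _, _, hα, px', _⟩
      · rw [hG.port] at px
        exact hE.port_no_fwd _ _ _ _ px h'
      · cases px'.symm.trans px
        exact hs (idOn_eq_some.1 hα).1.2

/-- The purpose of the fresh routers in a disjoint union: those to be joined with the other argument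
have no `exec` edges yet, so earlier edges of one argument do not become available to vertices of
the other. -/
theorem not_exec_unionMap (hE : E.Ported) {s : Set Port}
    (hG : IsExt S' (linkEdges (idOn ptype (S.sort ∩ s))) G f) {x y z : G.V} {t t' : ObsOf P}
    {π : Port} {r : ObsOf P} {hr : r.1 = ptype π} (hπ : π ∈ s)
    (hz : (G.rename (unionMap P ptype S.sort s) (unionMap_injective ptype S.sort s)).port z =
      some (.root π r hr))
    (h : (G.rename (unionMap P ptype S.sort s) (unionMap_injective ptype S.sort s)).Exec t t' x y) :
    x ≠ z ∧ y ≠ z := by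
  obtain ⟨_, _, _, ⟨⟩, ⟨px, -⟩ | ⟨-, -, hs⟩⟩ := port_unionMap hz
  · have := back_of_exec (t := r) (ht := hr) hE hG h
    exact ⟨fun e => this.1 (e ▸ px), fun e => this.2 (e ▸ px)⟩
  · exact absurd hπ hs

/-! ### Disjoint union -/

variable {S₁ S₂ : System P ptype} {S₁' S₂' : ExpSystem P ptype}
  {E₁ : Expansion S₁ S₁'.toSystem} {E₂ : Expansion S₂ S₂'.toSystem} {f₁ : S₁'.V → G.V}
  {f₂ : S₂'.V → G.V}

/-- A common port of `S₁'` and `S₂'` is not the port of an end of an `exec` edge in `S₁'`. -/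
def ExecFree (S₁' S₂' : ExpSystem P ptype) : Prop :=
  ∀ p x y z t t', S₁'.port z = some p → (∃ w, S₂'.port w = some p) → S₁'.Exec t t' x y →
    x ≠ z ∧ y ≠ z

theorem left_ne_right (h₁ : E₁.Ported) (hG : IsComp S₁' S₂' G f₁ f₂) (v : S₁.V) (y : S₂'.V) :
    f₁ (E₁.half v) ≠ f₂ y := by
  intro e
  obtain ⟨p, hp, -⟩ := hG.join _ _ e
  have h := S₁'.port_type _ _ hp
  rw [E₁.half_proc] at h
  obtain ⟨_, _, _, rfl⟩ := h₁.port_root _ _ hp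
  cases h

/-- The paths in a composition that come from the first argument. -/
def LeftAt (E₁ : Expansion S₁ S₁'.toSystem) (f₁ : S₁'.V → G.V) (v : S₁.V) (t : ObsOf P) (i : ℕ)
    (x : G.V) : Prop :=
  ∃ x₀, f₁ x₀ = x ∧ E₁.At v t i x₀

/-- A joined router has a port in the second argument and so no outgoing forward edge there; paths
never cross into the other argument. -/
theorem LeftAt.fwd (h₂ : E₂.Ported) (hG : IsComp S₁' S₂' G f₁ f₂) {v : S₁.V}
    {t : ObsOf P} {i : ℕ} {x y : G.V} (hx : LeftAt E₁ f₁ v t i x) (h : G.Fwd t x y) :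
    LeftAt E₁ f₁ v t (i + 1) y := by
  obtain ⟨x, rfl, hx⟩ := hx
  rcases (hG.edge_iff _ _ _ _).1 h with ⟨x', y, e, rfl, h'⟩ | ⟨x', y, e, rfl, h'⟩
  · obtain rfl := hG.left_inj e
    exact ⟨y, rfl, E₁.at_fwd _ _ _ _ _ hx h'⟩
  · obtain ⟨p, -, hp⟩ := hG.join _ _ e.symm
    exact absurd h' (h₂.port_no_fwd _ _ _ _ hp)

theorem LeftAt.succ (hG : IsComp S₁' S₂' G f₁ f₂) {v : S₁.V}
    {t : ObsOf P} {i : ℕ} {y : G.V} (hy : LeftAt E₁ f₁ v t (i + 1) y) :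
    ∃ x, LeftAt E₁ f₁ v t i x ∧ G.Fwd t x y ∧ G.Reply t x y := by
  obtain ⟨y, rfl, hy⟩ := hy
  obtain ⟨x, hx, hf, hr⟩ := E₁.at_succ _ _ _ _ hy
  exact ⟨_, ⟨x, rfl, hx⟩, (hG.edge_iff _ _ _ _).2 (Or.inl ⟨_, _, rfl, rfl, hf⟩),
    (hG.edge_iff _ _ _ _).2 (Or.inl ⟨_, _, rfl, rfl, hr⟩)⟩

theorem LeftAt.func {v : S₁.V} {t : ObsOf P} {i : ℕ} {x y : G.V} (hx : LeftAt E₁ f₁ v t i x)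
    (hy : LeftAt E₁ f₁ v t i y) : x = y := by
  obtain ⟨x, rfl, hx⟩ := hx
  obtain ⟨y, rfl, hy⟩ := hy
  rw [E₁.at_func _ _ _ _ _ hx hy]

theorem LeftAt.inj (hG : IsComp S₁' S₂' G f₁ f₂) {v : S₁.V} {t : ObsOf P} {i j : ℕ} {x : G.V}
    (hx : LeftAt E₁ f₁ v t i x) (hy : LeftAt E₁ f₁ v t j x) : i = j := by
  obtain ⟨x, rfl, hx⟩ := hx
  obtain ⟨y, e, hy⟩ := hy
  obtain rfl := hG.left_inj e
  exact E₁.at_inj _ _ _ _ _ hx hy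

theorem LeftAt.exec (hG : IsComp S₁' S₂' G f₁ f₂) (h₂₁ : ExecFree S₂' S₁') {v : S₁.V}
    {t s s' : ObsOf P} {i : ℕ} {x y z : G.V} (hz : LeftAt E₁ f₁ v t i z)
    (h : G.Exec s s' x y) (hxy : z = x ∨ z = y) :
    ∃ x₀ y₀, f₁ x₀ = x ∧ f₁ y₀ = y ∧ S₁'.Exec s s' x₀ y₀ := by
  obtain ⟨z, rfl, hz⟩ := hz
  rcases (hG.edge_iff _ _ _ _).1 h with ⟨x', y', rfl, rfl, h'⟩ | ⟨x', y', rfl, rfl, h'⟩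
  · exact ⟨x', y', rfl, rfl, h'⟩
  · rcases hxy with e | e
    · obtain ⟨p, hp, hp'⟩ := hG.join _ _ e
      exact absurd rfl (h₂₁ p x' y' x' s s' hp' ⟨z, hp⟩ h').1
    · obtain ⟨p, hp, hp'⟩ := hG.join _ _ e
      exact absurd rfl (h₂₁ p x' y' y' s s' hp' ⟨z, hp⟩ h').2

theorem LeftAt.exec_sound (hG : IsComp S₁' S₂' G f₁ f₂) (h₂₁ : ExecFree S₂' S₁') {v w : S₁.V}
    {t t' : ObsOf P} {i j : ℕ} {x y : G.V} (hx : LeftAt E₁ f₁ v t i x)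
    (hy : LeftAt E₁ f₁ w t' j y) (h : G.Exec t t' x y) : S₁.edge v t t' w := by
  obtain ⟨x₀, y₀, rfl, rfl, h'⟩ := hx.exec hG h₂₁ h (Or.inl rfl)
  obtain ⟨x', ex, hx⟩ := hx
  obtain ⟨y', ey, hy⟩ := hy
  obtain rfl := hG.left_inj ex
  obtain rfl := hG.left_inj ey
  exact E₁.exec_sound _ _ _ _ _ _ _ _ h' hx hy

/-- An `exec` edge at a router on a left path comes from the left argument. An end of it that is
also on a right path would be a joined router, and these are free of `exec` edges. -/
theorem not_exec_of_leftAt (hG : IsComp S₁' S₂' G f₁ f₂) (h₁₂ : ExecFree S₁' S₂')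
    (h₂₁ : ExecFree S₂' S₁') {v : S₁.V} {w : S₂.V}
    {t t' s s' : ObsOf P} {i j : ℕ} {x y z u : G.V} (hz : LeftAt E₁ f₁ v t i z)
    (hu : LeftAt E₂ f₂ w t' j u) (h : G.Exec s s' x y) (hzx : z = x ∨ z = y)
    (hux : u = x ∨ u = y) : False := by
  obtain ⟨x₀, y₀, rfl, rfl, h'⟩ := hz.exec hG h₂₁ h hzx
  obtain ⟨u, rfl, hu⟩ := hu
  rcases hux with e | e
  · obtain ⟨p, hp, hp'⟩ := hG.join _ _ e.symm
    exact (h₁₂ p x₀ y₀ x₀ s s' hp ⟨u, hp'⟩ h').1 rfl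
  · obtain ⟨p, hp, hp'⟩ := hG.join _ _ e.symm
    exact (h₁₂ p x₀ y₀ y₀ s s' hp ⟨u, hp'⟩ h').2 rfl

/-- Composing expansions implements the disjoint union. -/
def comp (h₁ : E₁.Ported) (h₂ : E₂.Ported) (hG : IsComp S₁' S₂' G f₁ f₂)
    (h₁₂ : ExecFree S₁' S₂') (h₂₁ : ExecFree S₂' S₁') :
    Expansion (S₁.disjUnion S₂) G.toSystem where
  half := Sum.elim (fun v => f₁ (E₁.half v)) (fun v => f₂ (E₂.half v))
  At := Sum.elim (LeftAt E₁ f₁) (LeftAt E₂ f₂)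
  half_inj := by
    rintro (v | v) (w | w) h
    · rw [E₁.half_inj (hG.left_inj h)]
    · exact absurd h (left_ne_right h₁ hG _ _)
    · exact absurd h.symm (left_ne_right h₁ hG _ _)
    · rw [E₂.half_inj (hG.right_inj h)]
  half_proc := by
    rintro (v | v)
    · exact (hG.left_proc _).trans (E₁.half_proc v)
    · exact (hG.right_proc _).trans (E₂.half_proc v)
  half_surj x p hx := by
    rcases hG.surj x with ⟨v, rfl⟩ | ⟨v, rfl⟩
    · obtain ⟨w, rfl⟩ := E₁.half_surj v p ((hG.left_proc v).symm.trans hx)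
      exact ⟨.inl w, rfl⟩
    · obtain ⟨w, rfl⟩ := E₂.half_surj v p ((hG.right_proc v).symm.trans hx)
      exact ⟨.inr w, rfl⟩
  edge_cases x a b y h := by
    rcases (hG.edge_iff _ _ _ _).1 h with ⟨x, y, rfl, rfl, h'⟩ | ⟨x, y, rfl, rfl, h'⟩
    · rcases E₁.edge_cases _ _ _ _ h' with ⟨v, t, rfl, rfl, rfl, hv⟩ | ⟨v, t, rfl, rfl, rfl, hv⟩ |
        ⟨t, rfl, rfl⟩ | ⟨t, rfl, rfl, hf⟩ | ⟨t, t', rfl, rfl⟩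
      · exact Or.inl ⟨.inl v, t, rfl, rfl, rfl, _, rfl, hv⟩
      · exact Or.inr (Or.inl ⟨.inl v, t, rfl, rfl, rfl, _, rfl, hv⟩)
      · exact Or.inr (Or.inr (Or.inl ⟨t, rfl, rfl⟩))
      · exact Or.inr (Or.inr (Or.inr (Or.inl ⟨t, rfl, rfl,
          (hG.edge_iff _ _ _ _).2 (Or.inl ⟨_, _, rfl, rfl, hf⟩)⟩)))
      · exact Or.inr (Or.inr (Or.inr (Or.inr ⟨t, t', rfl, rfl⟩)))
    · rcases E₂.edge_cases _ _ _ _ h' with ⟨v, t, rfl, rfl, rfl, hv⟩ | ⟨v, t, rfl, rfl, rfl, hv⟩ |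
        ⟨t, rfl, rfl⟩ | ⟨t, rfl, rfl, hf⟩ | ⟨t, t', rfl, rfl⟩
      · exact Or.inl ⟨.inr v, t, rfl, rfl, rfl, _, rfl, hv⟩
      · exact Or.inr (Or.inl ⟨.inr v, t, rfl, rfl, rfl, _, rfl, hv⟩)
      · exact Or.inr (Or.inr (Or.inl ⟨t, rfl, rfl⟩))
      · exact Or.inr (Or.inr (Or.inr (Or.inl ⟨t, rfl, rfl,
          (hG.edge_iff _ _ _ _).2 (Or.inr ⟨_, _, rfl, rfl, hf⟩)⟩)))
      · exact Or.inr (Or.inr (Or.inr (Or.inr ⟨t, t', rfl, rfl⟩)))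
  attempt_edge := by
    rintro (v | v) s _ ⟨x, rfl, hx⟩
    · exact (hG.edge_iff _ _ _ _).2 (Or.inl ⟨_, _, rfl, rfl, E₁.attempt_edge v s x hx⟩)
    · exact (hG.edge_iff _ _ _ _).2 (Or.inr ⟨_, _, rfl, rfl, E₂.attempt_edge v s x hx⟩)
  commit_edge := by
    rintro (v | v) s _ ⟨x, rfl, hx⟩
    · exact (hG.edge_iff _ _ _ _).2 (Or.inl ⟨_, _, rfl, rfl, E₁.commit_edge v s x hx⟩)
    · exact (hG.edge_iff _ _ _ _).2 (Or.inr ⟨_, _, rfl, rfl, E₂.commit_edge v s x hx⟩)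
  at_zero := by
    rintro (v | v) s hs
    · obtain ⟨x, hx⟩ := E₁.at_zero v s hs
      exact ⟨_, x, rfl, hx⟩
    · obtain ⟨x, hx⟩ := E₂.at_zero v s hs
      exact ⟨_, x, rfl, hx⟩
  at_succ := by
    rintro (v | v) s i y hy
    · exact LeftAt.succ hG hy
    · exact LeftAt.succ hG.symm hy
  at_fwd := by
    rintro (v | v) s i x y hx h
    · exact LeftAt.fwd h₂ hG hx h
    · exact LeftAt.fwd h₁ hG.symm hx h
  at_func := by
    rintro (v | v) s i x y hx hy
    · exact LeftAt.func hx hy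
    · exact LeftAt.func hx hy
  at_inj := by
    rintro (v | v) s i j x hx hy
    · exact LeftAt.inj hG hx hy
    · exact LeftAt.inj hG.symm hx hy
  exec_sound := by
    rintro (v | v) (w | w) s s' i j x y h hx hy
    · exact LeftAt.exec_sound (E₁ := E₁) (v := v) (w := w) hG h₂₁ hx hy h
    · exact (not_exec_of_leftAt hG h₁₂ h₂₁ hx hy h (Or.inl rfl) (Or.inr rfl)).elim
    · exact (not_exec_of_leftAt hG h₁₂ h₂₁ hy hx h (Or.inr rfl) (Or.inl rfl)).elim
    · exact LeftAt.exec_sound (E₁ := E₂) (v := v) (w := w) hG.symm h₁₂ hx hy h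
  exec_complete := by
    rintro (v | v) (w | w) s s' h
    · obtain ⟨i, j, x, y, hx, hy, h⟩ := E₁.exec_complete _ _ _ _ h
      exact ⟨i, j, _, _, ⟨x, rfl, hx⟩, ⟨y, rfl, hy⟩,
        (hG.edge_iff _ _ _ _).2 (Or.inl ⟨_, _, rfl, rfl, h⟩)⟩
    · exact h.elim
    · exact h.elim
    · obtain ⟨i, j, x, y, hx, hy, h⟩ := E₂.exec_complete _ _ _ _ h
      exact ⟨i, j, _, _, ⟨x, rfl, hx⟩, ⟨y, rfl, hy⟩,
        (hG.edge_iff _ _ _ _).2 (Or.inr ⟨_, _, rfl, rfl, h⟩)⟩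

theorem LeftAt.port_eq (h₁ : E₁.Ported) (hG : IsComp S₁' S₂' G f₁ f₂) {v : S₁.V} {t s : ObsOf P}
    {i : ℕ} {x : G.V} {π : Port} {hs : s.1 = ptype π} (hx : LeftAt E₁ f₁ v t i x)
    (px : G.port x = some (.root π s hs)) : S₁.port v = some π := by
  obtain ⟨x, rfl, hx⟩ := hx
  exact h₁.at_port _ _ _ _ _ _ _ hx ((hG.left_port x).symm.trans px)

theorem ported_comp (h₁ : E₁.Ported) (h₂ : E₂.Ported) (hG : IsComp S₁' S₂' G f₁ f₂)
    (h₁₂ : ExecFree S₁' S₂') (h₂₁ : ExecFree S₂' S₁') : (comp h₁ h₂ hG h₁₂ h₂₁).Ported where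
  port_root x p hx := by
    rcases hG.surj x with ⟨v, rfl⟩ | ⟨v, rfl⟩
    · exact h₁.port_root v p ((hG.left_port v).symm.trans hx)
    · exact h₂.port_root v p ((hG.right_port v).symm.trans hx)
  port_at := by
    rintro (v | v) π t ht hv
    · obtain ⟨i, x, hx, px⟩ := h₁.port_at v π t ht hv
      exact ⟨i, _, ⟨x, rfl, hx⟩, (hG.left_port x).trans px⟩
    · obtain ⟨i, x, hx, px⟩ := h₂.port_at v π t ht hv
      exact ⟨i, _, ⟨x, rfl, hx⟩, (hG.right_port x).trans px⟩
  at_port := by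
    rintro (v | v) t i x π s hs hx px
    · exact LeftAt.port_eq h₁ hG hx px
    · exact LeftAt.port_eq h₂ hG.symm hx px
  port_no_fwd x p t y hx h := by
    rcases (hG.edge_iff _ _ _ _).1 h with ⟨x, y, rfl, rfl, h'⟩ | ⟨x, y, rfl, rfl, h'⟩
    · exact h₁.port_no_fwd x p t y ((hG.left_port x).symm.trans hx) h'
    · exact h₂.port_no_fwd x p t y ((hG.right_port x).symm.trans hx) h'

/-! ### Single vertices -/

/-- The edges that connect a vertex with port `π` to its routers. -/
def halfEdges (P : ι → ProcessType) (ptype : Port → ι) (π : Port) :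
    PortEdges (expTypes P) (ExpPort P ptype) :=
  fun p a b q => ∃ t ht,
    (p = .half π ∧ a = attemptLabel t ∧ b = routerLabel t .recv ∧ q = .root π t ht) ∨
      (p = .root π t ht ∧ a = routerLabel t .reset ∧ b = commitLabel t ∧ q = .half π)

variable {π : Port} {g : (HRSystem.single (expTypes P) (expPtype (P := P) ptype) (.half π)).V → G.V}

theorem touches_halfEdges {p : ExpPort P ptype} (h : (halfEdges P ptype π).Touches p) :
    p = .half π ∨ ∃ t ht, p = .root π t ht := by
  rcases h with ⟨_, _, _, ⟨t, ht, ⟨rfl, -, -, -⟩ | ⟨rfl, -, -, -⟩⟩ |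
    ⟨t, ht, ⟨-, -, -, rfl⟩ | ⟨-, -, -, rfl⟩⟩⟩
  · exact Or.inl rfl
  · exact Or.inr ⟨t, ht, rfl⟩
  · exact Or.inr ⟨t, ht, rfl⟩
  · exact Or.inl rfl

theorem edge_halfEdges (hG : IsExt (HRSystem.single (expTypes P) (expPtype (P := P) ptype)
    (.half π)) (halfEdges P ptype π) G g) {x y : G.V} {a b : ObsOf (expTypes P)} :
    G.edge x a b y ↔
      (∃ t ht, x = g () ∧ a = attemptLabel t ∧ b = routerLabel t .recv ∧
        G.port y = some (.root π t ht)) ∨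
      ∃ t ht, y = g () ∧ a = routerLabel t .reset ∧ b = commitLabel t ∧
        G.port x = some (.root π t ht) := by
  have hg : G.port (g ()) = some (.half π) := hG.port ()
  rw [hG.edge_iff]
  constructor
  · rintro (⟨_, _, _, _, h⟩ | ⟨_, _, hx, hy, t, ht, ⟨rfl, rfl, rfl, rfl⟩ | ⟨rfl, rfl, rfl, rfl⟩⟩)
    · exact h.elim
    · exact Or.inl ⟨t, ht, G.port_unique _ _ _ hx hg, rfl, rfl, hy⟩
    · exact Or.inr ⟨t, ht, G.port_unique _ _ _ hy hg, rfl, rfl, hx⟩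
  · rintro (⟨t, ht, rfl, rfl, rfl, hy⟩ | ⟨t, ht, rfl, rfl, rfl, hx⟩)
    · exact Or.inr ⟨_, _, hg, hy, t, ht, Or.inl ⟨rfl, rfl, rfl, rfl⟩⟩
    · exact Or.inr ⟨_, _, hx, hg, t, ht, Or.inr ⟨rfl, rfl, rfl, rfl⟩⟩

theorem not_fwd_halfEdges (hG : IsExt (HRSystem.single (expTypes P) (expPtype (P := P) ptype)
    (.half π)) (halfEdges P ptype π) G g) {x y : G.V} {t : ObsOf P} : ¬ G.Fwd t x y := by
  intro h
  rcases (edge_halfEdges hG).1 h with ⟨s, hs, -, h, -⟩ | ⟨s, hs, -, h, -⟩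
  · exact attemptLabel_ne_routerLabel h.symm
  · cases (routerLabel_inj.1 h).2

/-- A single vertex connected to its routers implements a single vertex. -/
def single (hG : IsExt (HRSystem.single (expTypes P) (expPtype (P := P) ptype)
    (.half π)) (halfEdges P ptype π) G g) :
    Expansion (System.single P ptype π) G.toSystem where
  half _ := g ()
  At _ t i x := i = 0 ∧ ∃ ht, G.port x = some (.root π t ht)
  half_inj _ _ _ := rfl
  half_proc _ := hG.proc ()
  half_surj x p hx := by
    rcases hG.new x with ⟨v, rfl⟩ | ⟨q, hq, ht⟩
    · exact ⟨(), rfl⟩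
    · rcases touches_halfEdges ht with rfl | ⟨t, ht, rfl⟩
      · exact ⟨(), G.port_unique _ _ _ hq (hG.port ())⟩
      · cases (G.port_type _ _ hq).trans hx
  edge_cases x a b y h := by
    rcases (edge_halfEdges hG).1 h with ⟨t, ht, rfl, rfl, rfl, hy⟩ | ⟨t, ht, rfl, rfl, rfl, hx⟩
    · exact Or.inl ⟨(), t, rfl, rfl, rfl, rfl, ht, hy⟩
    · exact Or.inr (Or.inl ⟨(), t, rfl, rfl, rfl, rfl, ht, hx⟩)
  attempt_edge := by
    rintro _ t x ⟨-, ht, hx⟩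
    exact (edge_halfEdges hG).2 (Or.inl ⟨t, ht, rfl, rfl, rfl, hx⟩)
  commit_edge := by
    rintro _ t x ⟨-, ht, hx⟩
    exact (edge_halfEdges hG).2 (Or.inr ⟨t, ht, rfl, rfl, rfl, hx⟩)
  at_zero _ t ht := by
    obtain ⟨x, hx⟩ := hG.occurs (.root π t ht) ⟨_, _, _, Or.inr ⟨t, ht,
      Or.inl ⟨rfl, rfl, rfl, rfl⟩⟩⟩
    exact ⟨x, rfl, ht, hx⟩
  at_succ := by
    rintro _ t i y ⟨h, -⟩
    omega
  at_fwd _ _ _ _ _ _ h := absurd h (not_fwd_halfEdges hG)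
  at_func := by
    rintro _ t i x y ⟨-, ht, hx⟩ ⟨-, _, hy⟩
    exact G.port_unique _ _ _ hx hy
  at_inj := by
    rintro _ t i j x ⟨rfl, -⟩ ⟨rfl, -⟩
    rfl
  exec_sound _ _ _ _ _ _ _ _ h := by
    rcases (edge_halfEdges hG).1 h with ⟨s, hs, -, h, -⟩ | ⟨s, hs, -, h, -⟩
    · exact absurd h.symm attemptLabel_ne_routerLabel
    · cases (routerLabel_inj.1 h).2
  exec_complete _ _ _ _ h := h.elim

theorem ported_single (hG : IsExt (HRSystem.single (expTypes P) (expPtype (P := P) ptype)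
    (.half π)) (halfEdges P ptype π) G g) :
    ((single hG).renameRight (obsMap P ptype) (obsMap_injective ptype)).Ported := by
  have hp : ∀ x p, (G.rename (obsMap P ptype) (obsMap_injective ptype)).port x = some p →
      ∃ t ht, G.port x = some (.root π t ht) ∧ p = .root π t ht := by
    intro x p h
    obtain ⟨q, hq, h⟩ := Option.bind_eq_some_iff.1 h
    rcases q with π' | ⟨π', t, ht⟩ | ⟨π', t, ht⟩ <;> cases h
    -- `obsMap` keeps any `root` port; that it is one of `π` follows from the edges that brought in
    -- the router.
    rcases hG.new x with ⟨v, rfl⟩ | ⟨q, hq', hq''⟩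
    · cases hq.symm.trans (hG.port v)
    · cases hq.symm.trans hq'
      rcases touches_halfEdges hq'' with h | ⟨s, hs, h⟩
      · cases h
      · exact ⟨s, hs, h ▸ hq, h⟩
  refine ⟨?_, ?_, ?_, ?_⟩
  · intro x p h
    obtain ⟨t, ht, -, rfl⟩ := hp x p h
    exact ⟨π, t, ht, rfl⟩
  · rintro v _ t ht ⟨⟩
    obtain ⟨x, -, ht, hx⟩ := (single hG).at_zero () t ht
    exact ⟨0, x, ⟨rfl, ht, hx⟩, Option.bind_eq_some_iff.2 ⟨_, hx, rfl⟩⟩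
  · intro v t i x π' s hs hx px
    obtain ⟨_, _, -, ⟨⟩⟩ := hp x _ px
    rfl
  · exact fun x p t y _ => not_fwd_halfEdges hG

end Expansion

/-! ### Terms -/

theorem isEdges_linkTerm (t : ObsOf P) (π π' : Port) (h : t.1 = ptype π) (h' : t.1 = ptype π') :
    IsEdges (linkTerm t π π' h h').val
      ((PortEdges.single (.root π t h) (routerLabel t .fwd) (routerLabel t .recv)
        (.back π' t h')).union
      (PortEdges.single (.back π' t h') (routerLabel t .reset) (routerLabel t .ack)
        (.root π t h))) :=
  (isEdges_singleEdge _ _ _ _ _).comp (isEdges_singleEdge _ _ _ _ _)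

theorem isEdges_halfLinkTerm (π : Port) (t : (P (ptype π)).Obs) :
    IsEdges (halfLinkTerm π t).val
      ((PortEdges.single (.half π) (attemptLabel ⟨ptype π, t⟩) (routerLabel ⟨ptype π, t⟩ .recv)
        (.root π ⟨ptype π, t⟩ rfl)).union
      (PortEdges.single (.root π ⟨ptype π, t⟩ rfl) (routerLabel ⟨ptype π, t⟩ .reset)
        (commitLabel ⟨ptype π, t⟩) (.half π))) :=
  (isEdges_singleEdge _ _ _ _ _).comp (isEdges_singleEdge _ _ _ _ _)

theorem exists_isExt_encList [Finite Port] (θ : ExpTerm P ptype) (α : PortMap ptype) :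
    ∃ f, IsExt θ.val (Expansion.linkEdges α) (θ.compList (encList α)).val f := by
  obtain ⟨f, h⟩ := exists_isExt_compList θ _ _
    (fun y : (Σ x : {x : Port × Port // α.toFun x.1 = some x.2}, (P (ptype x.1.1)).Obs) =>
      isEdges_linkTerm ⟨ptype y.1.1.1, y.2⟩ y.1.1.1 y.1.1.2 rfl
        (α.type_eq y.1.1.1 y.1.1.2 y.1.2).symm)
  refine ⟨f, h.congr fun p a b q => ⟨?_, ?_⟩⟩
  · rintro ⟨⟨⟨⟨π, π'⟩, hα⟩, t⟩, h | h⟩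
    · exact ⟨π, π', ⟨ptype π, t⟩, rfl, (α.type_eq π π' hα).symm, hα, Or.inl h⟩
    · exact ⟨π, π', ⟨ptype π, t⟩, rfl, (α.type_eq π π' hα).symm, hα, Or.inr h⟩
  · rintro ⟨π, π', ⟨_, t⟩, ht, ht', hα, h⟩
    cases ht
    exact ⟨⟨⟨⟨π, π'⟩, hα⟩, t⟩, h⟩

theorem exists_isExt_halfLinks (π : Port) :
    ∃ f, IsExt (HRSystem.single (expTypes P) (expPtype (P := P) ptype) (.half π))
      (Expansion.halfEdges P ptype π) ((HRTerm.single (.half π)).compList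
        ((enumerate (P (ptype π)).Obs).map fun t => halfLinkTerm π t)).val f := by
  obtain ⟨f, h⟩ := exists_isExt_compList (HRTerm.single (P := expTypes P)
    (ptype := expPtype (P := P) ptype) (.half π)) _ _ (isEdges_halfLinkTerm π)
  refine ⟨f, IsExt.congr h fun p a b q => ⟨?_, ?_⟩⟩
  · rintro ⟨t, h⟩
    exact ⟨⟨ptype π, t⟩, rfl, h⟩
  · rintro ⟨⟨_, t⟩, ht, h⟩
    cases ht
    exact ⟨t, h⟩

theorem execFree_unionMap {S₁ S₂ : System P ptype} {S₁' G₁ G₂ : ExpSystem P ptype}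
    {E₁ : Expansion S₁ S₁'.toSystem} {f : S₁'.V → G₁.V} (h₁ : E₁.Ported)
    (hG : IsExt S₁' (Expansion.linkEdges (idOn ptype (S₁.sort ∩ S₂.sort))) G₁ f) :
    Expansion.ExecFree
      (G₁.rename (unionMap P ptype S₁.sort S₂.sort) (unionMap_injective ptype _ _))
      (G₂.rename (unionMap P ptype S₂.sort S₁.sort) (unionMap_injective ptype _ _)) := by
  rintro p x y z t t' hz ⟨w, hw⟩ h
  obtain ⟨π, s, hs, rfl, hπ⟩ := Expansion.port_unionMap hw
  refine Expansion.not_exec_unionMap h₁ hG ?_ hz h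
  rcases hπ with ⟨-, h, -⟩ | ⟨-, h, -⟩ <;> exact h

/-- The value of the translation of a VR-term is an expansion of the value of the term. -/
theorem exists_expansion [Finite Port] (θ : VRTerm P ptype) :
    ∃ E : Expansion θ.val θ.expand.val.toSystem, E.Ported := by
  induction θ with
  | single π =>
    obtain ⟨f, hf⟩ := exists_isExt_halfLinks (P := P) (ptype := ptype) π
    exact ⟨_, Expansion.ported_single hf⟩
  | addEdge π π' hne t t' θ ih =>
    obtain ⟨E, hE⟩ := ih
    have h : IsExt θ.expand.val (Expansion.execEdges π π' t t')
        (VRTerm.addEdge π π' hne t t' θ).expand.val _ :=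
      -- The edge is the left argument of the composition, hence `symm`; the empty edge set of the
      -- trivial extension is then dropped from the union.
      ((isExt_refl θ.expand.val).comp (isEdges_singleEdge _ _ _ _ _)
        (isComp_comp _ _).symm).congr fun _ _ _ _ => or_iff_right id
    exact ⟨_, Expansion.ported_addExec hE hne h⟩
  | rename α θ ih =>
    obtain ⟨E, hE⟩ := ih
    obtain ⟨f, hf⟩ := exists_isExt_encList θ.expand α
    exact ⟨_, Expansion.ported_rename hE hf⟩
  | disjUnion θ₁ θ₂ ih₁ ih₂ =>
    obtain ⟨E₁, h₁⟩ := ih₁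
    obtain ⟨E₂, h₂⟩ := ih₂
    obtain ⟨f₁, hf₁⟩ := exists_isExt_encList θ₁.expand (idOn ptype (θ₁.val.sort ∩ θ₂.val.sort))
    obtain ⟨f₂, hf₂⟩ := exists_isExt_encList θ₂.expand (idOn ptype (θ₁.val.sort ∩ θ₂.val.sort))
    -- Both arguments are linked along the same intersection, while `ported_unionMap` wants the
    -- argument's own sort first.
    have e : Expansion.linkEdges (P := P) (idOn ptype (θ₁.val.sort ∩ θ₂.val.sort)) =
        Expansion.linkEdges (idOn ptype (θ₂.val.sort ∩ θ₁.val.sort)) := by rw [Set.inter_comm]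
    rw [e] at hf₂
    exact ⟨_, Expansion.ported_comp (Expansion.ported_unionMap h₁ hf₁)
      (Expansion.ported_unionMap h₂ hf₂) (isComp_comp _ _) (execFree_unionMap h₁ hf₁)
      (execFree_unionMap h₂ hf₂)⟩

end Operations

end VRHR

theorem mainTheorem2 {ι : Type} [Finite ι] (P : ι → VRHR.ProcessType)
    {Port : Type} [Finite Port] (ptype : Port → ι)
    (θ : VRHR.VRTerm P ptype) (L : VRHR.PlaceOf P → Option VRHR.Var) :
    VRHR.StutterEquiv L θ.val θ.expand.val.toSystem := by
  obtain ⟨E, -⟩ := VRHR.exists_expansion θ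
  exact E.stutterEquiv L
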